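/- **Notation.** Let $\mathrm{Sp}(1,1)$ be the isometry group of the Hermitian form $\langle z,w\rangle=\bar w_2z_1+\bar w_1z_2$ on the right $\mathbb H$-space $\mathbb H^2$, acting on the quaternionic hyperbolic line $\mathbf H^1_{\mathbb H}$ (negative lines) and its boundary (null lines); $o=[0,1]^T$, $\infty=[1,0]^T$; the standard lift of a point $z\in\mathbb H$ is $(z,1)^T$, that of $\infty$ is $(1,0)^T$. An element is *hyperbolic* if it fixes exactly two boundary points, and *loxodromic* if moreover none of its right eigenvalues is real. For loxodromic $A$, $a_A$ and $r_A$ are the boundary fixed points belonging to the eigenvalue classes of modulus $<1$ and $>1$. The *real trace* is $tr_{\mathbb R}(A)=(a,b)$, where $x^4-ax^3+bx^2-ax+1$ is the characteristic polynomial of the complex $4\times4$ matrix of $A$. The *cross ratio* is $\mathbb X(A,B)=\langle z_3,z_1\rangle\langle z_3,z_2\rangle^{-1}\langle z_4,z_2\rangle\langle z_4,z_1\rangle^{-1}$ for lifts $z_1,\dots,z_4$ of $a_A,r_A,a_B,r_B$; its real part and modulus do not depend on the lifts. The *projective point* $p(A)\in\mathbb{CP}^1=\mathbb H^*/\mathbb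 C^*$ is the class of the $q$ with $A(vq)=(vq)\lambda$, where $v$ is the standard lift of $a_A$ and $\lambda$ is the complex eigenvalue representative with $\mathrm{Im}\,\lambda>0$. A pair is *irreducible* if it has no common fixed point in $\mathbf H^1_{\mathbb H}\cup\partial\mathbf H^1_{\mathbb H}$ and preserves no proper totally geodesic subspace of $\mathbf H^1_{\mathbb H}$. Let $g\ge2$, let $\Sigma_g$ be the closed orientable surface of genus $g$ with a system of $3g-3$ curves $\gamma_j$ that cuts it into $2g-2$ three-holed spheres $P_v$. Fix a spanning tree of the dual graph, and hence the description of $\pi_1(\Sigma_g)$ as the fundamental group of a graph of groups: $\pi_1(P_v)$ is generated by its boundary loops $c_{v,0},c_{v,1},c_{v,2}$ with $c_{v,0}c_{v,1}c_{v,2}=1$; if $\gamma_j$ is glued from boundary circles $x$ of $P_v$ and $y$ of $P_w$, there is an element $t_j$ with $t_jc_yt_j^{-1}=c_x^{-1}$, and $t_j=1$ on the tree. A representation $\rho:\pi_1(\Sigma_g)\to\mathrm{Sp}(1,1)$ is *geometric* if it is discrete and faithful, each $\rho(\gamma_j)$ is loxodromic, and each pair $(\rho(c_{v,0}),\rho(c_{v,1}))$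 is irreducible. *Fenchel–Nielsen coordinates of $\rho$.* For each $v$ choose $F_v\in\mathrm{Sp}(1,1)$ such that $(A_v,B_v)=F_v^{-1}(\rho(c_{v,0}),\rho(c_{v,1}))F_v$ is in the normal form $a_{A_v}=o$, $r_{A_v}=\infty$, $a_{B_v}=i$, $r_{B_v}\in\mathbb Ri+\mathbb R_{\ge0}j$ (generically $F_v$ is unique up to sign). For each $v$ take the ten real parameters $$tr_{\mathbb R}(A_v),\quad tr_{\mathbb R}(B_v),\quad \Re\,\mathbb X(A_v,B_v),\quad |\mathbb X(A_v,B_v)|,\quad p(A_v),\quad p(B_v).$$ For each curve $\gamma_j$, let $X=F_v^{-1}\rho(c_x)F_v$ and $Y=F_w^{-1}\rho(c_y)F_w$, let $R(X,Y)$ be an element, fixed once and for all as a function of $X$ and $Y$, with $R(X,Y)\,Y\,R(X,Y)^{-1}=X^{-1}$, and write $F_v^{-1}\rho(t_j)F_w=K_j\,R(X,Y)$; then $K_j$ commutes with $X$. Take the four real parameters of the twist-bend $K_j$, namely $\kappa_j=(s,\psi,k)$ with $s>0$, $\psi\in[0,\pi]$, $k=[q]\in\mathbb{CP}^1$ and $K_j(vq)=(vq)se^{i\psi}$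 for the standard lift $v$ of $a_X$ (with $k=p(X)$ if $\psi\in\{0,\pi\}$). The two sides of $\gamma_j$ have the same real trace, and $k$ is $p(X)$ or its antipode, which makes four real constraints for each curve: $10(2g-2)+4(3g-3)-4(3g-3)=20g-20$. **Theorem.** Let $g\ge 2$, a curve system on $\Sigma_g$ and a function $R$ be given as above. 1. Every geometric representation $\rho:\pi_1(\Sigma_g)\to\mathrm{Sp}(1,1)$ has Fenchel–Nielsen coordinates. 2. Two geometric representations are conjugate in $\mathrm{Sp}(1,1)$ if and only if they have a common system of Fenchel–Nielsen coordinates; and conjugate geometric representations have the same systems of Fenchel–Nielsen coordinates. 3. Exactly $20g-20$ real parameters are needed: the class of each geometric representation has an open neighbourhood in the deformation space $\mathrm{Hom}(\pi_1(\Sigma_g),\mathrm{Sp}(1,1))/\mathrm{Sp}(1,1)$ (quotient of the topology of pointwise convergence) that is homeomorphic to an open subset of $\mathbb R^{20g-20}$. -/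

import Mathlib

open scoped Quaternion Matrix

noncomputable section

namespace SpOneOne

/-! ### The Hermitian form of signature `(1,1)` and its isometry group -/

/-- Column vectors over the quaternions, a right `ℍ`-space on which matrices act from the left. -/
abbrev Vec : Type := Fin 2 → ℍ[ℝ]

/-- The vector `v q` (right multiplication by a scalar). -/
def rmul (v : Vec) (q : ℍ[ℝ]) : Vec := fun i => v i * q

/-- `⟨z, w⟩ = w̄₂ z₁ + w̄₁ z₂`. -/
def herm (z w : Vec) : ℍ[ℝ] := star (w 1) * z 0 + star (w 0) * z 1

/-- The group `Sp(1,1)` of all isometries of the Hermitian form, with the topology of matrices. -/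
def Sp11 : Subgroup (Matrix (Fin 2) (Fin 2) ℍ[ℝ])ˣ where
  carrier := {A | ∀ z w : Vec, herm (A.val *ᵥ z) (A.val *ᵥ w) = herm z w}
  one_mem' := by
    intro z w
    simp
  mul_mem' := by
    intro A B hA hB z w
    rw [Units.val_mul, ← Matrix.mulVec_mulVec, ← Matrix.mulVec_mulVec, hA, hB]
  inv_mem' := by
    intro A hA z w
    have h := hA (A⁻¹.val *ᵥ z) (A⁻¹.val *ᵥ w)
    rw [Matrix.mulVec_mulVec, Matrix.mulVec_mulVec, Units.mul_inv, Matrix.one_mulVec,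
      Matrix.one_mulVec] at h
    exact h.symm

/-- The linear action of `Sp(1,1)` on vectors. -/
def act (A : Sp11) (v : Vec) : Vec := A.val.val *ᵥ v

/-- The action of `A` as a right-linear map. -/
def toLin (A : Sp11) : Vec →ₗ[ℍ[ℝ]ᵐᵒᵖ] Vec where
  toFun := act A
  map_add' := fun v w => Matrix.mulVec_add _ v w
  map_smul' := fun q v => Matrix.mulVec_smul _ q v

theorem toLin_injective (A : Sp11) : Function.Injective (toLin A) := by
  intro v w h
  have h' : A.val⁻¹.val *ᵥ (A.val.val *ᵥ v) = A.val⁻¹.val *ᵥ (A.val.val *ᵥ w) :=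
    congrArg (fun u : Vec => A.val⁻¹.val *ᵥ u) h
  rwa [Matrix.mulVec_mulVec, Matrix.mulVec_mulVec, Units.inv_mul, Matrix.one_mulVec,
    Matrix.one_mulVec] at h'

/-! ### The quaternionic hyperbolic line and its boundary -/

/-- The quaternionic projective line of right lines in `Vec`. -/
abbrev HP1 : Type := Projectivization ℍ[ℝ]ᵐᵒᵖ Vec

/-- The action of `Sp(1,1)` on the projective line. -/
def move (A : Sp11) : HP1 → HP1 := Projectivization.map (toLin A) (toLin_injective A)

/-- The quaternionic hyperbolic line: the negative lines. -/
def hypSpace : Set HP1 := {p | (herm p.rep p.rep).re < 0}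

/-- Its ideal boundary: the null lines. -/
def bdry : Set HP1 := {p | herm p.rep p.rep = 0}

/-- A totally geodesic subset of the quaternionic hyperbolic line: it contains the complete
geodesic through any two of its points. If the lifts `x`, `y` of two points are chosen with
`⟨x, y⟩` real, that geodesic consists of the negative lines spanned by the real linear
combinations of `x` and `y`. -/
def IsTotallyGeodesic (S : Set HP1) : Prop :=
  S ⊆ hypSpace ∧
    ∀ (x y z : Vec) (hx : x ≠ 0) (hy : y ≠ 0) (hz : z ≠ 0) (r a b : ℝ),
      Projectivization.mk ℍ[ℝ]ᵐᵒᵖ x hx ∈ S → Projectivization.mk ℍ[ℝ]ᵐᵒᵖ y hy ∈ S →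
      herm x y = (r : ℍ[ℝ]) → z = a • x + b • y →
      Projectivization.mk ℍ[ℝ]ᵐᵒᵖ z hz ∈ hypSpace → Projectivization.mk ℍ[ℝ]ᵐᵒᵖ z hz ∈ S

/-- The pair `(A, B)` fixes no point of the closed hyperbolic line and preserves no proper
totally geodesic subspace. -/
def IsIrreduciblePair (A B : Sp11) : Prop :=
  (¬ ∃ p ∈ hypSpace ∪ bdry, move A p = p ∧ move B p = p) ∧
    ¬ ∃ S : Set HP1, S.Nonempty ∧ S ≠ hypSpace ∧ IsTotallyGeodesic S ∧
      move A '' S = S ∧ move B '' S = S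

/-! ### Hyperbolic and loxodromic elements -/

/-- Exactly two fixed points on the boundary. -/
def IsHyperbolic (A : Sp11) : Prop := {p | p ∈ bdry ∧ move A p = p}.ncard = 2

/-- Right eigenvalues. -/
def IsEigenvalue (A : Sp11) (μ : ℍ[ℝ]) : Prop := ∃ v : Vec, v ≠ 0 ∧ act A v = rmul v μ

/-- A hyperbolic element is loxodromic if it has no real eigenvalue. -/
def IsLoxodromic (A : Sp11) : Prop :=
  IsHyperbolic A ∧ ∀ μ, IsEigenvalue A μ → ∀ r : ℝ, μ ≠ (r : ℍ[ℝ])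

/-- `v` is a lift of the attracting fixed point `a_A`, the boundary fixed point that belongs
to the eigenvalue class of modulus less than `1`. -/
def IsAttracting (A : Sp11) (v : Vec) : Prop :=
  v ≠ 0 ∧ herm v v = 0 ∧ ∃ μ : ℍ[ℝ], ‖μ‖ < 1 ∧ act A v = rmul v μ

/-- `v` is a lift of the repelling fixed point `r_A`. -/
def IsRepelling (A : Sp11) (v : Vec) : Prop :=
  v ≠ 0 ∧ herm v v = 0 ∧ ∃ μ : ℍ[ℝ], 1 < ‖μ‖ ∧ act A v = rmul v μ

/-- Standard lifts: `(z, 1)` for a finite point, `(1, 0)` for the point `∞`. -/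
def IsStandard (v : Vec) : Prop := v 1 = 1 ∨ v = ![1, 0]

/-! ### Real trace, cross ratio, projective points -/

/-- Writing `q = z₁ + j z₂` with `z₁, z₂` complex, this is `z₁`. -/
def cpart (q : ℍ[ℝ]) : ℂ := ⟨q.re, q.imI⟩

/-- Writing `q = z₁ + j z₂` with `z₁, z₂` complex, this is `z₂`. -/
def jpart (q : ℍ[ℝ]) : ℂ := ⟨q.imJ, -q.imK⟩

/-- The embedding `A₁ + j A₂ ↦ [[A₁, -Ā₂], [A₂, Ā₁]]` into complex `4 × 4` matrices. -/
def complexify (M : Matrix (Fin 2) (Fin 2) ℍ[ℝ]) : Matrix (Fin 2 ⊕ Fin 2) (Fin 2 ⊕ Fin 2) ℂ :=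
  Matrix.fromBlocks (M.map cpart) (-(M.map fun q => star (jpart q)))
    (M.map jpart) (M.map fun q => star (cpart q))

/-- The real trace `(a, b)`, where the characteristic polynomial of the complexified matrix is
`x⁴ - a x³ + b x² - a x + 1`. -/
def realTrace (A : Sp11) : ℝ × ℝ :=
  (-((complexify A.val.val).charpoly.coeff 3).re, ((complexify A.val.val).charpoly.coeff 2).re)

/-- The Korányi–Reimann cross ratio of four lifts; its similarity class, given by its real part
and its modulus, does not depend on the lifts. -/
def crossRatio (z₁ z₂ z₃ z₄ : Vec) : ℍ[ℝ] :=
  herm z₃ z₁ * (herm z₃ z₂)⁻¹ * herm z₄ z₂ * (herm z₄ z₁)⁻¹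

/-- `X` represents the cross ratio `𝕏(A, B) = 𝕏(a_A, r_A, a_B, r_B)`. -/
def IsCrossRatio (A B : Sp11) (X : ℍ[ℝ]) : Prop :=
  ∃ z₁ z₂ z₃ z₄ : Vec, IsAttracting A z₁ ∧ IsRepelling A z₂ ∧ IsAttracting B z₃ ∧
    IsRepelling B z₄ ∧ X = crossRatio z₁ z₂ z₃ z₄

/-- The complex projective line `ℂℙ¹`, as the set of complex lines `q ℂ` in `ℍ = ℂ²`. -/
abbrev CP1 : Type :=
  ℍ[ℝ]ˣ ⧸ (Units.map (Quaternion.ofComplex : ℂ →ₐ[ℝ] ℍ[ℝ]).toMonoidHom).range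

/-- `k` is the projective point of `A`: the eigenspace of the attracting fixed point is
identified with `ℍ` through the standard lift `v`, and `k` is the complex line of all `q` for
which `v q` is an eigenvector for the complex representative `r e^{iθ}`, `0 < θ < π`, of the
eigenvalue class. -/
def IsProjectivePoint (A : Sp11) (k : CP1) : Prop :=
  ∃ (v : Vec) (q : ℍ[ℝ]ˣ) (μ : ℂ), IsAttracting A v ∧ IsStandard v ∧ 0 < μ.im ∧
    k = (q : CP1) ∧ act A (rmul v q) = rmul (rmul v q) (μ : ℍ[ℝ])

/-! ### Coordinates of a pair of loxodromic elements -/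

/-- The normal form of a pair under conjugation: `a_A = o`, `r_A = ∞`, `a_B = i` and `r_B = y`
in the closed half plane `ℝ i + ℝ_{≥0} j`. -/
def IsNormalized (A B : Sp11) : Prop :=
  ∃ y : ℍ[ℝ], y.re = 0 ∧ y.imK = 0 ∧ 0 ≤ y.imJ ∧
    IsAttracting A ![0, 1] ∧ IsRepelling A ![1, 0] ∧
    IsAttracting B ![((Complex.I : ℂ) : ℍ[ℝ]), 1] ∧ IsRepelling B ![y, 1]

/-- The ten real parameters of a pair: two real traces, the real part and the modulus of the
cross ratio, and two points of `ℂℙ¹`. -/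
structure PairCoord where
  trA : ℝ × ℝ
  trB : ℝ × ℝ
  reX : ℝ
  absX : ℝ
  pA : CP1
  pB : CP1

/-- `c` is the parameter system of the normalized pair `(A, B)`. -/
def IsPairCoord (A B : Sp11) (c : PairCoord) : Prop :=
  IsNormalized A B ∧ c.trA = realTrace A ∧ c.trB = realTrace B ∧
    (∃ X, IsCrossRatio A B X ∧ c.reX = X.re ∧ c.absX = ‖X‖) ∧
    IsProjectivePoint A c.pA ∧ IsProjectivePoint B c.pB

/-- The four real parameters of a twist-bend: `s > 0`, an angle `ψ`, and a point of `ℂℙ¹`. -/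
structure TwistBend where
  s : ℝ
  ψ : ℝ
  k : CP1

/-- `κ = (s, ψ, k)` are the parameters of the twist-bend `K` along the loxodromic `A`: `K`
commutes with `A`, it acts on the eigenline of `a_A` with eigenvalue `s e^{iψ}`, and `k` is the
projective point of this eigenvalue; where the eigenvalue is real, `k` is the projective point
of `A`. -/
def IsTwistBend (A K : Sp11) (κ : TwistBend) : Prop :=
  K * A = A * K ∧ 0 < κ.s ∧ 0 ≤ κ.ψ ∧ κ.ψ ≤ Real.pi ∧
    (∃ (v : Vec) (q : ℍ[ℝ]ˣ), IsAttracting A v ∧ IsStandard v ∧ κ.k = (q : CP1) ∧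
      act K (rmul v q) =
        rmul (rmul v q) (((κ.s : ℂ) * Complex.exp ((κ.ψ : ℂ) * Complex.I) : ℂ) : ℍ[ℝ])) ∧
    (Real.sin κ.ψ = 0 → IsProjectivePoint A κ.k)

/-! ### Surface groups and curve systems -/

/-- The fundamental group of the closed orientable surface of genus `g`:
`⟨a₁, b₁, …, a_g, b_g | [a₁, b₁] ⋯ [a_g, b_g]⟩`. -/
abbrev SurfaceGroup (g : ℕ) : Type :=
  PresentedGroup ({(List.ofFn fun i : Fin g =>
    FreeGroup.of (i, false) * FreeGroup.of (i, true) * (FreeGroup.of (i, false))⁻¹ *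
      (FreeGroup.of (i, true))⁻¹).prod} : Set (FreeGroup (Fin g × Bool)))

/-- The combinatorial type of a system of `3g - 3` curves that cuts the closed orientable
surface of genus `g` into `2g - 2` three-holed spheres. The boundary circles of the three-holed
spheres are the pairs `(v, k)`, and `sides` says which two of them are glued along each curve.
The dual graph has the three-holed spheres as vertices and the curves as edges; `tree` is a
spanning tree of it (a connected spanning subgraph with one edge less than it has vertices). -/
structure CurveSystem (g : ℕ) where
  sides : Fin (3 * g - 3) × Bool ≃ Fin (2 * g - 2) × Fin 3
  tree : Finset (Fin (3 * g - 3))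
  card_tree : tree.card + 1 = 2 * g - 2
  connected : ∀ v w, Relation.EqvGen
    (fun a b => ∃ j ∈ tree, (sides (j, false)).1 = a ∧ (sides (j, true)).1 = b) v w

namespace CurveSystem

variable {g : ℕ}

/-- The generators: `Sum.inl (v, k)` is the `k`-th boundary loop of the `v`-th three-holed
sphere, `Sum.inr j` is the loop (or, on the tree, the trivial path) that crosses the `j`-th
curve. -/
abbrev Gen (g : ℕ) : Type := (Fin (2 * g - 2) × Fin 3) ⊕ Fin (3 * g - 3)

/-- The relations of the fundamental group of the surface as the fundamental group of a graph of
groups: in each three-holed sphere the product of the three boundary loops is trivial, the two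
boundary loops along a curve are inverse to each other (with opposite boundary orientations)
after transport across the curve, and the transports along the tree are trivial. -/
def rels (P : CurveSystem g) : Set (FreeGroup (Gen g)) :=
  {r | ∃ v, r = FreeGroup.of (Sum.inl (v, 0)) * FreeGroup.of (Sum.inl (v, 1)) *
      FreeGroup.of (Sum.inl (v, 2))} ∪
  {r | ∃ j, r = FreeGroup.of (Sum.inr j) * FreeGroup.of (Sum.inl (P.sides (j, true))) *
      (FreeGroup.of (Sum.inr j))⁻¹ * FreeGroup.of (Sum.inl (P.sides (j, false)))} ∪
  {r | ∃ j ∈ P.tree, r = FreeGroup.of (Sum.inr j)}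

/-- The fundamental group of the surface, assembled from the three-holed spheres. -/
abbrev Grp (P : CurveSystem g) : Type := PresentedGroup P.rels

/-- The boundary loop of a three-holed sphere. -/
def bdryLoop (P : CurveSystem g) (x : Fin (2 * g - 2) × Fin 3) : P.Grp :=
  PresentedGroup.of (Sum.inl x)

/-- The element that crosses the `j`-th curve. -/
def crossing (P : CurveSystem g) (j : Fin (3 * g - 3)) : P.Grp :=
  PresentedGroup.of (Sum.inr j)

end CurveSystem

/-! ### Representations -/

/-- `Hom(Γ, Sp(1,1))` with the topology of pointwise convergence. -/
def RepSpace (Γ : Type) [Group Γ] : Type := Γ →* Sp11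

instance (Γ : Type) [Group Γ] : TopologicalSpace (RepSpace Γ) :=
  TopologicalSpace.induced (fun (ρ : Γ →* Sp11) (x : Γ) => ρ x) inferInstance

/-- Conjugation of representations by elements of `Sp(1,1)`. -/
def repSetoid (Γ : Type) [Group Γ] : Setoid (RepSpace Γ) where
  r := fun (ρ ρ' : Γ →* Sp11) => ∃ h : Sp11, ∀ x, ρ' x = h * ρ x * h⁻¹
  iseqv :=
    { refl := fun ρ => ⟨1, fun x => by simp⟩
      symm := by
        rintro ρ ρ' ⟨h, hh⟩
        exact ⟨h⁻¹, fun x => by rw [hh x]; group⟩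
      trans := by
        rintro ρ ρ' ρ'' ⟨h, hh⟩ ⟨k, hk⟩
        exact ⟨k * h, fun x => by rw [hk x, hh x]; group⟩ }

/-- The deformation space `Hom(Γ, Sp(1,1)) / Sp(1,1)` with the quotient topology. -/
def DeformationSpace (Γ : Type) [Group Γ] : Type := Quotient (repSetoid Γ)

instance (Γ : Type) [Group Γ] : TopologicalSpace (DeformationSpace Γ) :=
  inferInstanceAs (TopologicalSpace (Quotient (repSetoid Γ)))

/-- The point of the deformation space given by a representation. -/
def repClass {Γ : Type} [Group Γ] (ρ : Γ →* Sp11) : DeformationSpace Γ :=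
  Quotient.mk (repSetoid Γ) ρ

variable {g : ℕ}

/-- `ρ` is geometric for the curve system `P`, marked by `φ`: discrete and faithful, the image
of each curve loxodromic, and the image of each three-holed sphere group irreducible. -/
def IsGeometric (P : CurveSystem g) (φ : P.Grp ≃* SurfaceGroup g)
    (ρ : SurfaceGroup g →* Sp11) : Prop :=
  Function.Injective ρ ∧ DiscreteTopology ρ.range ∧
    (∀ j, IsLoxodromic (ρ (φ (P.bdryLoop (P.sides (j, false)))))) ∧
    ∀ v, IsIrreduciblePair (ρ (φ (P.bdryLoop (v, 0)))) (ρ (φ (P.bdryLoop (v, 1))))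

/-- A choice of reference gluings: for any two peripheral elements that can be glued, a fixed
element that conjugates the second to the inverse of the first. -/
def IsReference (ref : Sp11 → Sp11 → Sp11) : Prop :=
  ∀ X Y, IsConj Y X⁻¹ → ref X Y * Y * (ref X Y)⁻¹ = X⁻¹

/-- A system of Fenchel–Nielsen coordinates. -/
structure FNCoord (g : ℕ) where
  pants : Fin (2 * g - 2) → PairCoord
  twist : Fin (3 * g - 3) → TwistBend

/-- `c` is a system of Fenchel–Nielsen coordinates of `ρ`. For each three-holed sphere `v`, the
frame `F v` conjugates the pair of its first two peripheral elements into normal form, and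
`c.pants v` are the parameters of this pair. For each curve `j`, which glues `x` to `y`, let `X`
and `Y` be the two normalized peripheral elements; the element that glues the two normalized
groups is `K * ref X Y` with a twist-bend `K` along `X`, and `c.twist j` are the parameters of
`K`. -/
def IsFNCoord (ref : Sp11 → Sp11 → Sp11) (P : CurveSystem g) (φ : P.Grp ≃* SurfaceGroup g)
    (ρ : SurfaceGroup g →* Sp11) (c : FNCoord g) : Prop :=
  ∃ F : Fin (2 * g - 2) → Sp11,
    let per : Fin (2 * g - 2) × Fin 3 → Sp11 :=
      fun x => (F x.1)⁻¹ * ρ (φ (P.bdryLoop x)) * F x.1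
    (∀ v, IsPairCoord (per (v, 0)) (per (v, 1)) (c.pants v)) ∧
    ∀ j, let x := P.sides (j, false)
      let y := P.sides (j, true)
      IsTwistBend (per x)
        ((F x.1)⁻¹ * ρ (φ (P.crossing j)) * F y.1 * (ref (per x) (per y))⁻¹) (c.twist j)

end SpOneOne

end

open SpOneOne

/-!
A framed pair in normal form is determined by its ten parameters: the normal form and the cross
ratio fix all four fixed points, the real trace fixes the eigenvalue class at the attracting point,
and the projective point says which quaternion of that class acts on its standard lift. The same
data fix the twist-bends. A framing of the vertex groups together with the gluing elements
determines the representation up to conjugation, because along the spanning tree the gluing elements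
express all frames through one of them.

For the dimension count, `Sp(1,1)` is viewed as the unitary group of the algebra of quaternionic
`2 × 2` matrices with the adjoint of the Hermitian form as involution; its Lie algebra has dimension
ten. An irreducible pair with a hyperbolic member has only real scalars in its commutant.
Fox calculus identifies a functional that kills the image of the derivative of the surface relator
with an invariant functional; the trace form represents it by a skew-adjoint element of the
commutant, so it vanishes. Hence the relator is a submersion at the representation. The conjugation
action is free there up to the centre `{1, -1}` and proper, so it has local slices, and a slice
inside the relator's zero set is a chart of dimension `10 (2 g) - 10 - 10`.
-/

open Filter Set Topology

open scoped commutatorElement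

/-! ### Fox derivatives and the surface relator -/

section FoxDerivative

variable {k V I : Type*} [CommRing k] [AddCommGroup V] [Module k V]

/-- `d w x` is the Fox derivative of the word `w` in the direction `x`: for fixed `x`, the crossed
homomorphism of the free group into the representation `ρ` that has the value `x i` on the `i`-th
generator. -/
structure IsFoxDerivative (ρ : Representation k (FreeGroup I) V)
    (d : FreeGroup I → (I → V) →ₗ[k] V) : Prop where
  map_mul (v w : FreeGroup I) (x : I → V) : d (v * w) x = d v x + ρ v (d w x)
  map_of (i : I) (x : I → V) : d (FreeGroup.of i) x = x i

/-- The coboundary of a vector, evaluated at the generators: it is the derivative of the orbit of a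
tuple under simultaneous conjugation. -/
def coboundary (ρ : Representation k (FreeGroup I) V) : V →ₗ[k] (I → V) :=
  LinearMap.pi fun i => LinearMap.id - ρ (FreeGroup.of i)

theorem coboundary_apply (ρ : Representation k (FreeGroup I) V) (x : V) (i : I) :
    coboundary ρ x i = x - ρ (FreeGroup.of i) x :=
  rfl

/-- The commutator of the two generators of the `i`-th handle of a surface. -/
def handle {g : ℕ} (i : Fin g) : FreeGroup (Fin g × Bool) :=
  ⁅FreeGroup.of (i, false), FreeGroup.of (i, true)⁆

/-- The defining relator of the group of the closed orientable surface of genus `g`. -/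
def surfaceRelator (g : ℕ) : FreeGroup (Fin g × Bool) :=
  (List.ofFn fun i : Fin g => handle i).prod

namespace IsFoxDerivative

variable {ρ : Representation k (FreeGroup I) V} {d : FreeGroup I → (I → V) →ₗ[k] V}

theorem map_one (hd : IsFoxDerivative ρ d) (x : I → V) : d 1 x = 0 := by
  simpa using hd.map_mul 1 1 x

theorem map_inv (hd : IsFoxDerivative ρ d) (w : FreeGroup I) (x : I → V) :
    d w⁻¹ x = -ρ w⁻¹ (d w x) := by
  have h := hd.map_mul w⁻¹ w x
  rw [inv_mul_cancel, hd.map_one] at h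
  exact eq_neg_of_add_eq_zero_left h.symm

theorem map_commutator_of (hd : IsFoxDerivative ρ d) (i j : I) (x : I → V) :
    d ⁅FreeGroup.of i, FreeGroup.of j⁆ x = x i + ρ (FreeGroup.of i) (x j)
      - ρ (FreeGroup.of i * FreeGroup.of j * (FreeGroup.of i)⁻¹) (x i)
      - ρ ⁅FreeGroup.of i, FreeGroup.of j⁆ (x j) := by
  simp only [commutatorElement_def, hd.map_mul, hd.map_inv, hd.map_of, _root_.map_mul,
    Module.End.mul_apply, map_neg]
  abel

theorem map_coboundary (hd : IsFoxDerivative ρ d) (w : FreeGroup I) (x : V) :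
    d w (coboundary ρ x) = x - ρ w x := by
  induction w using FreeGroup.induction_on with
  | C1 => simp [hd.map_one]
  | of i => rw [hd.map_of, coboundary_apply]
  | inv_of i _ => simp [hd.map_inv, hd.map_of, coboundary_apply]
  | mul v w hv hw => simp [hd.map_mul, hv, hw]

section Surface

variable {g : ℕ} {ρ : Representation k (FreeGroup (Fin g × Bool)) V}
  {d : FreeGroup (Fin g × Bool) → (Fin g × Bool → V) →ₗ[k] V}

theorem map_handle_congr (hd : IsFoxDerivative ρ d) {i : Fin g} {x y : Fin g × Bool → V}
    (hxy : ∀ b, x (i, b) = y (i, b)) : d (handle i) x = d (handle i) y := by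
  simp only [handle, hd.map_commutator_of, hxy]

theorem map_prod_handle_eq_zero (hd : IsFoxDerivative ρ d) {l : List (Fin g)}
    {x : Fin g × Bool → V} (hx : ∀ i ∈ l, ∀ b, x (i, b) = 0) : d (l.map handle).prod x = 0 := by
  induction l with
  | nil => exact hd.map_one x
  | cons i l ih =>
    rw [List.map_cons, List.prod_cons, hd.map_mul, ih fun j hj => hx j (List.mem_cons_of_mem _ hj),
      hd.map_handle_congr (y := 0) (hx i List.mem_cons_self), map_zero, map_zero, add_zero]

/-- Differentiating in the directions of the two generators `a` and `b` shows that `ξ` is invariant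
under `a b a⁻¹` and that `ξ ∘ a` is invariant under `b a⁻¹ b⁻¹`. -/
theorem invariant_of_map_handle (hd : IsFoxDerivative ρ d) {ξ : Module.Dual k V} {i : Fin g}
    (hξ : ∀ x : Fin g × Bool → V, (∀ j b, j ≠ i → x (j, b) = 0) → ξ (d (handle i) x) = 0)
    (b : Bool) (y : V) : ξ (ρ (FreeGroup.of (i, b)) y) = ξ y := by
  set p := ρ (FreeGroup.of (i, false)) with hp
  set q := ρ (FreeGroup.of (i, true)) with hq
  set p' := ρ (FreeGroup.of (i, false))⁻¹ with hp'
  set q' := ρ (FreeGroup.of (i, true))⁻¹ with hq'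
  have hp'p : ∀ y, p' (p y) = y := ρ.inv_self_apply _
  have hq'q : ∀ y, q' (q y) = y := ρ.inv_self_apply _
  have direction_a : ∀ y, ξ (p (q (p' y))) = ξ y := fun y => by
    have h := hξ (Pi.single (i, false) y) fun j c hj => by simp [hj]
    rw [handle, hd.map_commutator_of] at h
    exact (sub_eq_zero.1 (by simpa [← hp, ← hq, ← hp'] using h)).symm
  have direction_b : ∀ y, ξ (p (q (p' (q' y)))) = ξ (p y) := fun y => by
    have h := hξ (Pi.single (i, true) y) fun j c hj => by simp [hj]
    rw [handle, hd.map_commutator_of, commutatorElement_def] at h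
    exact (sub_eq_zero.1 (by simpa [← hp, ← hq, ← hp', ← hq'] using h)).symm
  have invariant_ab : ∀ y, ξ (p (q y)) = ξ y := fun y => by
    rw [← direction_b, hq'q, direction_a]
  have invariant_a : ∀ y, ξ (p y) = ξ y := fun y => by
    rw [← direction_a (p y), hp'p, invariant_ab]
  cases b
  · exact invariant_a y
  · rw [← hq, ← invariant_a, invariant_ab]

theorem invariant_of_map_prod_handle (hd : IsFoxDerivative ρ d) {ξ : Module.Dual k V}
    {l : List (Fin g)} (hl : l.Nodup) (hξ : ∀ x, ξ (d (l.map handle).prod x) = 0) :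
    ∀ i ∈ l, ∀ b y, ξ (ρ (FreeGroup.of (i, b)) y) = ξ y := by
  induction l with
  | nil => simp
  | cons i l ih =>
    rw [List.nodup_cons] at hl
    simp only [List.map_cons, List.prod_cons, hd.map_mul, map_add] at hξ
    have hξi : ∀ x : Fin g × Bool → V, (∀ j b, j ≠ i → x (j, b) = 0) → ξ (d (handle i) x) = 0 :=
      fun x hx => by
        have h := hξ x
        rwa [hd.map_prod_handle_eq_zero fun j hj b => hx j b (ne_of_mem_of_not_mem hj hl.1),
          map_zero, map_zero, add_zero] at h
    have hi := hd.invariant_of_map_handle hξi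
    have hi_inv : ∀ b y, ξ (ρ (FreeGroup.of (i, b))⁻¹ y) = ξ y := fun b y => by
      rw [← hi b, ρ.self_inv_apply]
    have hhandle : ∀ y, ξ (ρ (handle i) y) = ξ y := fun y => by
      simp only [handle, commutatorElement_def, _root_.map_mul, Module.End.mul_apply, hi, hi_inv]
    have hξhandle : ∀ x, ξ (d (handle i) x) = 0 := fun x => by
      rw [hd.map_handle_congr (y := fun j => if j.1 = i then x j else 0) fun b => by simp]
      exact hξi _ fun j b hj => by simp [hj]
    have htail := ih hl.2 fun x => by simpa [hξhandle, hhandle] using hξ x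
    intro j hj
    rcases List.mem_cons.1 hj with rfl | hj
    exacts [hi, htail j hj]

theorem invariant_of_map_surfaceRelator (hd : IsFoxDerivative ρ d) {ξ : Module.Dual k V}
    (hξ : ∀ x, ξ (d (surfaceRelator g) x) = 0) (i : Fin g × Bool) (y : V) :
    ξ (ρ (FreeGroup.of i) y) = ξ y := by
  rw [surfaceRelator, List.ofFn_eq_map] at hξ
  exact hd.invariant_of_map_prod_handle (List.nodup_finRange g) hξ i.1 (List.mem_finRange _) i.2 y

end Surface

end IsFoxDerivative

end FoxDerivative

/-! ### Unitary groups of normed algebras with involution -/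

namespace UnitarySlice

theorem exists_smul_one_eq_of_centralizer_eq_bot {k M I : Type*} [CommSemiring k] [Semiring M]
    [Algebra k M] {a : I → M} (ha : Subalgebra.centralizer k (range a) = ⊥) {z : M}
    (hz : ∀ i, a i * z = z * a i) : ∃ t : k, t • (1 : M) = z := by
  have h : z ∈ (⊥ : Subalgebra k M) := by
    rw [← ha, Subalgebra.mem_centralizer_iff]
    exact forall_mem_range.2 hz
  exact (Algebra.mem_bot.1 h).imp fun t ht => by rw [← ht, Algebra.algebraMap_eq_smul_one]

section Algebra

variable (M : Type*) [Ring M] [Algebra ℝ M] [StarRing M] [StarModule ℝ M]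

/-- The Lie algebra of the unitary group of `M`: the skew-adjoint elements. -/
abbrev LieAlg : Submodule ℝ M := skewAdjoint.submodule ℝ M

variable {M}

theorem star_coe (x : LieAlg M) : star (x : M) = -x := x.2

/-- The adjoint representation of the unitary group on its Lie algebra. -/
noncomputable def Ad : Representation ℝ (unitary M) (LieAlg M) where
  toFun u := (Unitary.conjStarAlgAut ℝ M u).toAlgEquiv.toLinearMap.restrict fun x hx => by
    change star (Unitary.conjStarAlgAut ℝ M u x) = -Unitary.conjStarAlgAut ℝ M u x
    rw [← map_star, ← map_neg]
    exact congrArg _ hx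
  map_one' := by ext; simp [LinearMap.restrict_apply]
  map_mul' u v := by ext; simp [LinearMap.restrict_apply]

theorem coe_Ad (u : unitary M) (x : LieAlg M) : (Ad u x : M) = u * x * star (u : M) := rfl

/-- A tracial functional on `M` that is invariant under the involution and has a nondegenerate trace
form. -/
structure IsStarTrace (T : M →ₗ[ℝ] ℝ) : Prop where
  mul_comm (x y : M) : T (x * y) = T (y * x)
  star (x : M) : T (star x) = T x
  nondegenerate {z : M} (hz : ∀ x, T (z * x) = 0) : z = 0

end Algebra

section Normed

variable {M : Type*} [NormedRing M] [NormedAlgebra ℝ M] [StarRing M] [StarModule ℝ M]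
  [ContinuousStar M]

/-- The skew-adjoint part, as a projection onto the Lie algebra. -/
noncomputable def skewPart : M →L[ℝ] LieAlg M := skewAdjointPartL ℝ M

theorem coe_skewPart (x : M) : (skewPart x : M) = (2⁻¹ : ℝ) • (x - star x) := by
  change (skewAdjointPart ℝ x : M) = _
  rw [skewAdjointPart_apply_coe, invOf_eq_inv]

theorem skewPart_coe (x : LieAlg M) : skewPart (x : M) = x := by
  ext
  rw [coe_skewPart, star_coe, sub_neg_eq_add, ← two_smul ℝ, inv_smul_smul₀ two_ne_zero]

theorem skewPart_conj (u : unitary M) (x : M) :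
    skewPart (u * x * star (u : M)) = Ad u (skewPart x) := by
  ext
  simp [coe_skewPart, coe_Ad, mul_sub, sub_mul, mul_assoc]

theorem skewPart_one : skewPart (1 : M) = 0 := by
  ext
  simp [coe_skewPart]

/-- If `u⁻¹` and `v⁻¹` differ as much as `u` and `v`, then `u (u - v) v = -(u - v)`, which near `1`
forces `u - v` to vanish. -/
theorem exists_injOn_skewPart :
    ∃ U : Set (unitary M), IsOpen U ∧ 1 ∈ U ∧ InjOn (fun u : unitary M => skewPart (u : M)) U := by
  refine ⟨(↑) ⁻¹' Metric.ball (1 : M) (1 / 2), Metric.isOpen_ball.preimage continuous_subtype_val,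
    by simp, fun u hu v hv huv => ?_⟩
  have hu : ‖(u : M) - 1‖ < 1 / 2 := by simpa [dist_eq_norm] using hu
  have hv : ‖(v : M) - 1‖ < 1 / 2 := by simpa [dist_eq_norm] using hv
  set d : M := u - v with hd
  have hstar : d = star (u : M) - star (v : M) := by
    have h : (skewPart (u : M) : M) = skewPart (v : M) := congrArg _ huv
    rw [coe_skewPart, coe_skewPart] at h
    have := smul_right_injective M (inv_ne_zero (two_ne_zero' ℝ)) h
    rw [hd, sub_eq_sub_iff_sub_eq_sub, this]
  have hflip : (u : M) * d * v = -d := by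
    conv_lhs => rw [hstar]
    rw [mul_sub, sub_mul, Unitary.mul_star_self_of_mem u.2, mul_assoc,
      Unitary.star_mul_self_of_mem v.2, one_mul, mul_one, hd, neg_sub]
  have htwo : (2 : ℝ) • d =
      -((u - 1 : M) * d * (v - 1 : M) + (u - 1 : M) * d + d * (v - 1 : M)) := by
    have : (u - 1 : M) * d * (v - 1 : M) + (u - 1 : M) * d + d * (v - 1 : M) = u * d * v - d := by
      noncomm_ring
    rw [this, hflip, two_smul]
    abel
  have hle : 2 * ‖d‖ ≤ ‖(u - 1 : M)‖ * ‖d‖ * ‖(v - 1 : M)‖ + ‖(u - 1 : M)‖ * ‖d‖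
      + ‖d‖ * ‖(v - 1 : M)‖ := by
    calc 2 * ‖d‖ = ‖(2 : ℝ) • d‖ := by rw [norm_smul, Real.norm_ofNat]
      _ ≤ ‖(u - 1 : M) * d * (v - 1 : M)‖ + ‖(u - 1 : M) * d‖ + ‖d * (v - 1 : M)‖ := by
        rw [htwo, norm_neg]
        exact norm_add₃_le
      _ ≤ _ := add_le_add_three ((norm_mul_le _ _).trans (by gcongr; exact norm_mul_le _ _))
        (norm_mul_le _ _) (norm_mul_le _ _)
  have hd0 : ‖d‖ ≤ 0 := by
    by_contra! hpos
    nlinarith [mul_le_mul hu.le hv.le (norm_nonneg _) (by norm_num : (0 : ℝ) ≤ 1 / 2)]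
  exact Subtype.ext (sub_eq_zero.1 (norm_le_zero_iff.1 hd0))

end Normed

/-! ### Logarithmic derivatives -/

section LogDeriv

variable {M : Type*} [NormedRing M] [NormedAlgebra ℝ M] [StarRing M] [StarModule ℝ M]
  {E E' : Type*} [NormedAddCommGroup E] [NormedSpace ℝ E]
  [NormedAddCommGroup E'] [NormedSpace ℝ E']

/-- `f` is strictly differentiable at `x` with right logarithmic derivative `D`, that is,
`df = D f` at `x`. -/
def HasLogDerivAt (f : E → unitary M) (D : E →L[ℝ] LieAlg M) (x : E) : Prop :=
  HasStrictFDerivAt (fun y => (f y : M))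
    ((ContinuousLinearMap.mul ℝ M).flip (f x) ∘L (LieAlg M).subtypeL ∘L D) x

namespace HasLogDerivAt

theorem congr_deriv {f : E → unitary M} {D D' : E →L[ℝ] LieAlg M} {x : E}
    (h : HasLogDerivAt f D x) (hD : ∀ y, D y = D' y) : HasLogDerivAt f D' x :=
  ContinuousLinearMap.ext hD ▸ h

theorem const (u : unitary M) (x : E) : HasLogDerivAt (fun _ => u) 0 x := by
  simpa [HasLogDerivAt] using hasStrictFDerivAt_const (u : M) x

theorem comp {f : E → unitary M} {D : E →L[ℝ] LieAlg M} {φ : E' → E} {φ' : E' →L[ℝ] E} {x : E'}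
    (hf : HasLogDerivAt f D (φ x)) (hφ : HasStrictFDerivAt φ φ' x) :
    HasLogDerivAt (fun y => f (φ y)) (D ∘L φ') x :=
  HasStrictFDerivAt.comp x hf hφ

theorem mul [FiniteDimensional ℝ M] {f f' : E → unitary M} {D D' : E →L[ℝ] LieAlg M} {x : E}
    (hf : HasLogDerivAt f D x) (hf' : HasLogDerivAt f' D' x) :
    HasLogDerivAt (fun y => f y * f' y) (D + (Ad (f x)).toContinuousLinearMap ∘L D') x := by
  refine (HasStrictFDerivAt.mul' hf hf').congr_fderiv (ContinuousLinearMap.ext fun y => ?_)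
  have hf1 (z : M) : star (f x : M) * (f x * z) = z := by
    rw [← mul_assoc, Unitary.coe_star_mul_self, one_mul]
  simp [coe_Ad, mul_assoc, hf1, add_comm]

theorem inv [FiniteDimensional ℝ M] [ContinuousStar M] {f : E → unitary M} {D : E →L[ℝ] LieAlg M}
    {x : E} (hf : HasLogDerivAt f D x) :
    HasLogDerivAt (fun y => (f y)⁻¹) (-((Ad (f x)⁻¹).toContinuousLinearMap ∘L D)) x := by
  refine (HasStrictFDerivAt.star hf).congr_fderiv (ContinuousLinearMap.ext fun y => ?_)
  simp [coe_Ad, mul_assoc, star_coe, ← Unitary.star_eq_inv]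

theorem unique {f : E → unitary M} {D D' : E →L[ℝ] LieAlg M} {x : E}
    (h : HasLogDerivAt f D x) (h' : HasLogDerivAt f D' x) : D = D' := by
  ext y
  have hy : (D y : M) * f x = D' y * f x :=
    DFunLike.congr_fun (h.hasFDerivAt.unique h'.hasFDerivAt) y
  exact (Unitary.toUnits (f x)).mul_left_inj.1 hy

/-- The skew part is a chart at `1` whose derivative there is the identity. -/
theorem skewPart [ContinuousStar M] {f : E → unitary M} {D : E →L[ℝ] LieAlg M} {x : E}
    (hf : HasLogDerivAt f D x) (hx : f x = 1) :
    HasStrictFDerivAt (fun y => UnitarySlice.skewPart (f y : M)) D x := by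
  refine (UnitarySlice.skewPart.hasStrictFDerivAt.comp x hf).congr_fderiv ?_
  ext y
  simp [hx, skewPart_coe]

end HasLogDerivAt

end LogDeriv

/-! ### The exponential map -/

section Exp

variable {M : Type*} [NormedRing M] [NormedAlgebra ℝ M] [StarRing M] [StarModule ℝ M]
  [ContinuousStar M] [CompleteSpace M]

/-- The exponential map of the unitary group. -/
noncomputable def expUnitary (x : LieAlg M) : unitary M :=
  ⟨NormedSpace.exp (x : M),
    letI := NormedAlgebra.restrictScalars ℚ ℝ M
    NormedSpace.exp_mem_unitary_of_mem_skewAdjoint x.2⟩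

theorem expUnitary_zero : expUnitary (0 : LieAlg M) = 1 :=
  Subtype.ext (by simp [expUnitary])

theorem continuous_expUnitary : Continuous (expUnitary (M := M)) :=
  letI := NormedAlgebra.restrictScalars ℚ ℝ M
  (NormedSpace.exp_continuous.comp continuous_subtype_val).subtype_mk _

theorem hasLogDerivAt_expUnitary :
    HasLogDerivAt (expUnitary (M := M)) (ContinuousLinearMap.id ℝ (LieAlg M)) 0 := by
  have h : HasStrictFDerivAt (NormedSpace.exp : M → M) (1 : M →L[ℝ] M) ((LieAlg M).subtypeL 0) := by
    simpa using hasStrictFDerivAt_exp_zero (𝕂 := ℝ) (𝔸 := M)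
  refine (h.comp 0 (LieAlg M).subtypeL.hasStrictFDerivAt).congr_fderiv ?_
  ext x
  simp [expUnitary_zero]

end Exp

end UnitarySlice

/-! ### Derivatives of words in a tuple of unitary elements -/

namespace UnitarySlice

section Words

variable {M : Type*} [NormedRing M] [NormedAlgebra ℝ M] [StarRing M] [StarModule ℝ M]
  [ContinuousStar M] [CompleteSpace M] {I : Type*}

/-- The exponential coordinates of tuples of unitary elements around the tuple `A`. -/
noncomputable def tuple (A : I → unitary M) (u : I → LieAlg M) (i : I) : unitary M :=
  expUnitary (u i) * A i

theorem tuple_zero (A : I → unitary M) : tuple A 0 = A := by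
  ext i
  simp [tuple, expUnitary_zero]

theorem continuous_tuple (A : I → unitary M) : Continuous (tuple A) :=
  continuous_pi fun i =>
    (continuous_expUnitary.comp (continuous_apply i)).mul continuous_const

variable [FiniteDimensional ℝ M] [Fintype I]

theorem hasLogDerivAt_tuple (A : I → unitary M) (i : I) :
    HasLogDerivAt (fun u => tuple A u i) (ContinuousLinearMap.proj i) 0 := by
  have hexp := HasLogDerivAt.comp (φ := fun u : I → LieAlg M => u i) (x := 0)
    hasLogDerivAt_expUnitary
    (ContinuousLinearMap.proj (R := ℝ) (φ := fun _ : I => LieAlg M) i).hasStrictFDerivAt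
  exact (hexp.mul (.const (A i) 0)).congr_deriv fun u => by simp

theorem exists_hasLogDerivAt_lift_tuple (A : I → unitary M) (w : FreeGroup I) :
    ∃ D, HasLogDerivAt (fun u => FreeGroup.lift (tuple A u) w) D 0 := by
  induction w using FreeGroup.induction_on with
  | C1 => exact ⟨0, by simpa using .const 1 0⟩
  | of i => exact ⟨_, by simpa using hasLogDerivAt_tuple A i⟩
  | inv_of i hi =>
    obtain ⟨D, hD⟩ := hi
    exact ⟨_, by simpa using hD.inv⟩
  | mul v w hv hw =>
    obtain ⟨D, hD⟩ := hv
    obtain ⟨D', hD'⟩ := hw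
    exact ⟨_, by simpa using hD.mul hD'⟩

/-- The logarithmic derivative at `A` of the map that evaluates the word `w` at a tuple. -/
noncomputable def wordDeriv (A : I → unitary M) (w : FreeGroup I) :
    (I → LieAlg M) →L[ℝ] LieAlg M :=
  (exists_hasLogDerivAt_lift_tuple A w).choose

theorem hasLogDerivAt_lift_tuple (A : I → unitary M) (w : FreeGroup I) :
    HasLogDerivAt (fun u => FreeGroup.lift (tuple A u) w) (wordDeriv A w) 0 :=
  (exists_hasLogDerivAt_lift_tuple A w).choose_spec

theorem isFoxDerivative_wordDeriv (A : I → unitary M) :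
    IsFoxDerivative (Ad.comp (FreeGroup.lift A)) fun w => (wordDeriv A w).toLinearMap where
  map_mul v w x := by
    have h := (hasLogDerivAt_lift_tuple A v).mul (hasLogDerivAt_lift_tuple A w)
    simp only [← map_mul] at h
    rw [(hasLogDerivAt_lift_tuple A (v * w)).unique h, tuple_zero]
    rfl
  map_of i x := by
    have h := hasLogDerivAt_lift_tuple A (FreeGroup.of i)
    simp only [FreeGroup.lift_apply_of] at h
    rw [h.unique (hasLogDerivAt_tuple A i)]
    rfl

end Words

section Duality

variable {M : Type*} [NormedRing M] [NormedAlgebra ℝ M] [StarRing M] [StarModule ℝ M]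
  [ContinuousStar M] [FiniteDimensional ℝ M] {I : Type*}

/-- The trace form represents the functional by an element commuting with the tuple; that element is
a scalar, and the trace of a skew-adjoint element vanishes. -/
theorem eq_zero_of_forall_Ad_eq {A : I → unitary M}
    (hA : Subalgebra.centralizer ℝ (range fun i => (A i : M)) = ⊥) {T : M →ₗ[ℝ] ℝ}
    (hT : IsStarTrace T) {ξ : Module.Dual ℝ (LieAlg M)} (hξ : ∀ i x, ξ (Ad (A i) x) = ξ x) :
    ξ = 0 := by
  let traceForm : M →ₗ[ℝ] Module.Dual ℝ M := (LinearMap.mul ℝ M).compr₂ T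
  have htraceForm : Function.Injective traceForm := (injective_iff_map_eq_zero traceForm).2
    fun z hz => hT.nondegenerate fun x => LinearMap.congr_fun hz x
  obtain ⟨z, hz⟩ : ∃ z, traceForm z = ξ ∘ₗ skewPart.toLinearMap :=
    (LinearMap.injective_iff_surjective_of_finrank_eq_finrank
      (Subspace.dual_finrank_eq (K := ℝ) (V := M)).symm).1 htraceForm _
  replace hz (x : M) : T (z * x) = ξ (skewPart x) := LinearMap.congr_fun hz x
  have hcomm (i : I) : (A i : M) * z = z * A i := by
    have h : star (A i : M) * z * A i = z := by
      refine sub_eq_zero.1 (hT.nondegenerate fun x => ?_)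
      have hx : T (z * (A i * x * star (A i : M))) = T (z * x) := by
        rw [hz, hz, skewPart_conj, hξ]
      rw [sub_mul, map_sub, ← hx, sub_eq_zero, mul_assoc, mul_assoc, hT.mul_comm]
      simp only [mul_assoc]
    conv_lhs => rw [← h]
    rw [mul_assoc, ← mul_assoc, Unitary.mul_star_self_of_mem (A i).2, one_mul]
  obtain ⟨t, rfl⟩ := exists_smul_one_eq_of_centralizer_eq_bot hA hcomm
  ext x
  have hskew : T x = -T x := by
    conv_lhs => rw [← hT.star, star_coe, map_neg]
  rw [← skewPart_coe x, ← hz, smul_one_mul, map_smul, self_eq_neg.1 hskew, smul_zero,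
    LinearMap.zero_apply]

theorem wordDeriv_surfaceRelator_surjective [CompleteSpace M] {g : ℕ}
    {A : Fin g × Bool → unitary M}
    (hA : Subalgebra.centralizer ℝ (range fun i => (A i : M)) = ⊥) {T : M →ₗ[ℝ] ℝ}
    (hT : IsStarTrace T) : Function.Surjective (wordDeriv A (surfaceRelator g)) := by
  change Function.Surjective (wordDeriv A (surfaceRelator g)).toLinearMap
  rw [← LinearMap.range_eq_top]
  by_contra hne
  obtain ⟨ξ, hξ0, hξ⟩ := Submodule.exists_le_ker_of_lt_top _ (lt_top_iff_ne_top.2 hne)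
  refine hξ0 (eq_zero_of_forall_Ad_eq hA hT fun i x => ?_)
  simpa using (isFoxDerivative_wordDeriv A).invariant_of_map_surfaceRelator
    (fun u => hξ ⟨u, rfl⟩) i x

end Duality

end UnitarySlice

/-! ### Local slices -/

/-- A parametrization `tup` of a piece of a `G`-space, restricted to the open set `N` of parameters,
is a local slice if it meets each orbit at most once and the orbits through the points near a point
of it fill a neighbourhood of that point. -/
structure IsLocalSlice (G : Type*) {E Y : Type*} [TopologicalSpace E] [TopologicalSpace Y]
    [SMul G Y] (tup : E → Y) (N : Set E) : Prop where
  isOpen : IsOpen N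
  continuous : Continuous tup
  eq_of_smul_eq {u u' : E} (hu : u ∈ N) (hu' : u' ∈ N) (g : G) (h : g • tup u = tup u') : u = u'
  orbits_mem_nhds {u : E} (hu : u ∈ N) {W : Set E} (hW : W ∈ 𝓝 u) :
    {y | ∃ u' ∈ W, ∃ g : G, g • tup u' = y} ∈ 𝓝 (tup u)

theorem IsLocalSlice.inter {G E Y : Type*} [TopologicalSpace E] [TopologicalSpace Y] [SMul G Y]
    {tup : E → Y} {N N' : Set E} (h : IsLocalSlice G tup N) (hN' : IsOpen N') :
    IsLocalSlice G tup (N ∩ N') where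
  isOpen := h.isOpen.inter hN'
  continuous := h.continuous
  eq_of_smul_eq hu hu' := h.eq_of_smul_eq hu.1 hu'.1
  orbits_mem_nhds hu := h.orbits_mem_nhds hu.1

/-- The inverse function theorem for a map into a space `Y` that is seen through injective local
coordinates `κ`, whose range need not be known to be open. -/
theorem exists_injOn_and_image_mem_nhds {Z F Y : Type*} [NormedAddCommGroup Z] [NormedSpace ℝ Z]
    [CompleteSpace Z] [NormedAddCommGroup F] [NormedSpace ℝ F] [TopologicalSpace Y]
    {Θ : Z → Y} {κ : Y → F} (hΘ : Continuous Θ) (hκ : Continuous κ) {U : Set Y} (hU : IsOpen U)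
    (hκU : InjOn κ U) {z₀ : Z} (hz₀ : Θ z₀ ∈ U) {D : Z ≃L[ℝ] F}
    (hD : HasStrictFDerivAt (κ ∘ Θ) (D : Z →L[ℝ] F) z₀) :
    ∃ V, IsOpen V ∧ z₀ ∈ V ∧ InjOn Θ V ∧ ∀ z ∈ V, ∀ S ∈ 𝓝 z, Θ '' S ∈ 𝓝 (Θ z) := by
  let e := hD.toOpenPartialHomeomorph (κ ∘ Θ)
  refine ⟨e.source ∩ Θ ⁻¹' U, e.open_source.inter (hU.preimage hΘ),
    ⟨hD.mem_toOpenPartialHomeomorph_source, hz₀⟩,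
    fun z hz z' hz' h => e.injOn hz.1 hz'.1 (congrArg κ h), fun z hz S hS => ?_⟩
  have himage : e '' (S ∩ Θ ⁻¹' U) ∈ 𝓝 (κ (Θ z)) := by
    change _ ∈ 𝓝 (e z)
    rw [← e.map_nhds_eq hz.1]
    exact image_mem_map (inter_mem hS ((hU.preimage hΘ).mem_nhds hz.2))
  filter_upwards [hκ.continuousAt.preimage_mem_nhds himage, hU.mem_nhds hz.2]
  rintro y ⟨z', ⟨hz'S, hz'U⟩, hz'⟩ hyU
  exact ⟨z', hz'S, hκU hz'U hyU hz'⟩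

namespace UnitarySlice

variable {M : Type*} [NormedRing M] [NormedAlgebra ℝ M] [StarRing M] [StarModule ℝ M]
  [ContinuousStar M] {I : Type*} {A : I → unitary M}

section Coord

/-- The skew-adjoint parts of the quotients of two tuples: coordinates of `a` near `A`. -/
noncomputable def coord (A a : I → unitary M) (i : I) : LieAlg M :=
  skewPart ((a i * (A i)⁻¹ : unitary M) : M)

theorem continuous_coord (A : I → unitary M) : Continuous (coord A) :=
  continuous_pi fun i => skewPart.continuous.comp (continuous_subtype_val.comp
    ((continuous_apply i).mul continuous_const))

theorem exists_injOn_coord [Finite I] (A : I → unitary M) :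
    ∃ U : Set (I → unitary M), IsOpen U ∧ A ∈ U ∧ InjOn (coord A) U := by
  obtain ⟨U, hU, h1, hinj⟩ := exists_injOn_skewPart (M := M)
  refine ⟨⋂ i, {a | a i * (A i)⁻¹ ∈ U}, isOpen_iInter_of_finite fun i =>
    hU.preimage ((continuous_apply i).mul continuous_const), by simpa using fun _ => h1,
    fun a ha b hb hab => funext fun i => mul_right_cancel (b := (A i)⁻¹) ?_⟩
  exact hinj (mem_iInter.1 ha i) (mem_iInter.1 hb i) (congrFun hab i)

end Coord

section Commutant

omit [ContinuousStar M] in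
theorem coboundary_Ad_injective
    (hA : Subalgebra.centralizer ℝ (range fun i => (A i : M)) = ⊥) :
    Function.Injective (coboundary (Ad.comp (FreeGroup.lift A))) := by
  refine (injective_iff_map_eq_zero _).2 fun x hx => ?_
  have hcomm (i : I) : (A i : M) * x = x * A i := by
    have hAd : x - Ad (A i) x = 0 := by simpa [coboundary_apply] using congrFun hx i
    have h : (x : M) = A i * x * star (A i : M) := congrArg Subtype.val (sub_eq_zero.1 hAd)
    conv_rhs => rw [h]
    rw [mul_assoc, Unitary.star_mul_self_of_mem (A i).2, mul_one]
  obtain ⟨t, ht⟩ := exists_smul_one_eq_of_centralizer_eq_bot hA hcomm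
  have hstar : star (x : M) = x := by rw [← ht, star_smul, star_trivial, star_one]
  have : IsAddTorsionFree M := .of_isTorsionFree ℝ M
  exact Subtype.ext (self_eq_neg.1 (hstar.symm.trans (star_coe x)))

variable [FiniteDimensional ℝ M]

omit [StarModule ℝ M] [ContinuousStar M] in
theorem exists_tendsto_norm_inv_smul [Nontrivial M]
    (hA : Subalgebra.centralizer ℝ (range fun i => (A i : M)) = ⊥) {α : Type*} {l : Ultrafilter α}
    {a b : α → I → unitary M} {h : α → unitary M} (ha : Tendsto a l (𝓝 A))
    (hb : Tendsto b l (𝓝 A)) (hab : ∀ᶠ p in (l : Filter α), ∀ i, b p i = h p * a p i * (h p)⁻¹) :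
    ∃ t : ℝ, t ≠ 0 ∧ Tendsto (fun p => ‖(h p : M)‖⁻¹ • (h p : M)) l (𝓝 (t • 1)) := by
  have : ProperSpace M := FiniteDimensional.proper ℝ M
  have hmem (p : α) : ‖(h p : M)‖⁻¹ • (h p : M) ∈ Metric.sphere (0 : M) 1 := by
    have : ‖(h p : M)‖ ≠ 0 := norm_ne_zero_iff.2 (Unitary.toUnits (h p)).ne_zero
    simp [norm_smul, this]
  obtain ⟨z, hz, hlim⟩ := (isCompact_sphere (0 : M) 1).ultrafilter_le_nhds
    (l.map fun p => ‖(h p : M)‖⁻¹ • (h p : M))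
    (le_principal_iff.2 (mem_map.2 (Eventually.of_forall hmem)))
  replace hlim : Tendsto (fun p => ‖(h p : M)‖⁻¹ • (h p : M)) l (𝓝 z) := hlim
  have hcoord (i : I) : Continuous fun a : I → unitary M => (a i : M) :=
    continuous_subtype_val.comp (continuous_apply i)
  have hcomm (i : I) : (A i : M) * z = z * A i := by
    refine tendsto_nhds_unique_of_eventuallyEq ((((hcoord i).tendsto A).comp hb).mul hlim)
      (hlim.mul (((hcoord i).tendsto A).comp ha)) ?_
    filter_upwards [hab] with p hp
    have hp' : b p i * h p = h p * a p i := by rw [hp i, inv_mul_cancel_right]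
    simpa using congrArg (‖(h p : M)‖⁻¹ • ·) (congrArg Subtype.val hp')
  obtain ⟨t, rfl⟩ := exists_smul_one_eq_of_centralizer_eq_bot hA hcomm
  refine ⟨t, ?_, hlim⟩
  rintro rfl
  simp at hz

/-- After normalization, a conjugating element subconverges to an element of the commutant, that is,
to a scalar; being unitary, it is then close to `1` or `-1`. -/
theorem tendsto_one_or_neg_tendsto_one
    (hA : Subalgebra.centralizer ℝ (range fun i => (A i : M)) = ⊥) {α : Type*} {l : Ultrafilter α}
    {a b : α → I → unitary M} {h : α → unitary M} (ha : Tendsto a l (𝓝 A))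
    (hb : Tendsto b l (𝓝 A)) (hab : ∀ᶠ p in (l : Filter α), ∀ i, b p i = h p * a p i * (h p)⁻¹) :
    Tendsto h l (𝓝 1) ∨ Tendsto (fun p => -h p) l (𝓝 1) := by
  cases subsingleton_or_nontrivial M
  · exact .inl (tendsto_const_nhds.congr fun p => Subsingleton.elim _ _)
  obtain ⟨t, ht, hlim⟩ := exists_tendsto_norm_inv_smul hA ha hb hab
  have hsq : Tendsto (fun p => ‖(h p : M)‖⁻¹ ^ 2) l (𝓝 (t ^ 2)) := by
    refine (isClosedEmbedding_smul_left (𝕜 := ℝ) (one_ne_zero (α := M))).tendsto_nhds_iff.2 ?_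
    simpa [smul_smul, Function.comp_def, pow_two] using hlim.star.mul hlim
  have hnorm : Tendsto (fun p => ‖(h p : M)‖) l (𝓝 |t|⁻¹) := by
    have := hsq.sqrt.inv₀ (by rw [Real.sqrt_sq_eq_abs]; exact abs_ne_zero.2 ht)
    simpa [Real.sqrt_sq_eq_abs, Real.sqrt_sq] using this
  have hh : Tendsto (fun p => (h p : M)) l (𝓝 ((|t|⁻¹ * t) • 1)) := by
    rw [← smul_smul]
    refine (hnorm.smul hlim).congr fun p => smul_inv_smul₀ ?_ _
    exact norm_ne_zero_iff.2 (Unitary.toUnits (h p)).ne_zero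
  rw [tendsto_subtype_rng, tendsto_subtype_rng]
  rcases ht.lt_or_gt with hneg | hpos
  · right
    simpa [abs_of_neg hneg, ht, inv_neg, Unitary.coe_neg] using hh.neg
  · left
    simpa [abs_of_pos hpos, ht] using hh

theorem eventually_mem_or_neg_mem
    (hA : Subalgebra.centralizer ℝ (range fun i => (A i : M)) = ⊥) {N : Set (unitary M)}
    (hN : N ∈ 𝓝 1) : ∀ᶠ p : (I → unitary M) × (I → unitary M) in 𝓝 (A, A),
      ∀ h, (∀ i, p.2 i = h * p.1 i * h⁻¹) → h ∈ N ∨ -h ∈ N := by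
  suffices H : ∀ᶠ q : ((I → unitary M) × (I → unitary M)) × unitary M in comap Prod.fst (𝓝 (A, A)),
      (∀ i, q.1.2 i = q.2 * q.1.1 i * q.2⁻¹) → q.2 ∈ N ∨ -q.2 ∈ N from
    (eventually_comap.1 H).mono fun p hp h => hp (p, h) rfl
  refine mem_iff_ultrafilter.2 fun l hl => Ultrafilter.eventually_imp.2 fun hconj => ?_
  have hlim := tendsto_comap.mono_left hl
  rcases tendsto_one_or_neg_tendsto_one hA ((continuous_fst.tendsto _).comp hlim)
    ((continuous_snd.tendsto _).comp hlim) hconj with h | h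
  · exact (h.eventually_mem hN).mono fun q => .inl
  · exact (h.eventually_mem hN).mono fun q => .inr

end Commutant

section Slice

variable [CompleteSpace M]

/-- The tuple with exponential coordinates `p.2`, conjugated by the exponential of `p.1`. -/
noncomputable def conjTuple (A : I → unitary M) (p : LieAlg M × (I → LieAlg M)) (i : I) :
    unitary M :=
  expUnitary p.1 * tuple A p.2 i * (expUnitary p.1)⁻¹

theorem conjTuple_zero_left (A : I → unitary M) (u : I → LieAlg M) :
    conjTuple A (0, u) = tuple A u := by
  ext i
  simp [conjTuple, expUnitary_zero]

theorem continuous_conjTuple (A : I → unitary M) : Continuous (conjTuple A) :=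
  continuous_pi fun i =>
    ((continuous_expUnitary.comp continuous_fst).mul
      ((continuous_apply i).comp ((continuous_tuple A).comp continuous_snd))).mul
    (continuous_expUnitary.comp continuous_fst).inv

theorem smul_tuple_eq_conjTuple {A : I → unitary M} {x : LieAlg M} {h : unitary M}
    (hx : expUnitary x = h ∨ expUnitary x = -h) (u : I → LieAlg M) :
    ConjAct.toConjAct h • tuple A u = conjTuple A (x, u) := by
  ext i
  rcases hx with hx | hx <;> simp [conjTuple, hx, ConjAct.toConjAct_smul]

variable [FiniteDimensional ℝ M]

theorem image_expUnitary_mem_nhds {N : Set (LieAlg M)} (hN : N ∈ 𝓝 0) :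
    expUnitary '' N ∈ 𝓝 (1 : unitary M) := by
  obtain ⟨U, hU, h1, hinj⟩ := exists_injOn_skewPart (M := M)
  have : CompleteSpace (LieAlg M) := FiniteDimensional.complete ℝ _
  obtain ⟨V, -, h0, -, hV⟩ := exists_injOn_and_image_mem_nhds (Θ := expUnitary (M := M))
    (D := ContinuousLinearEquiv.refl ℝ (LieAlg M)) continuous_expUnitary
    (skewPart.continuous.comp continuous_subtype_val) hU hinj (by rwa [expUnitary_zero])
    (hasLogDerivAt_expUnitary.skewPart expUnitary_zero)
  simpa only [expUnitary_zero] using hV 0 h0 N hN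

variable [Finite I]

theorem hasStrictFDerivAt_coord_conjTuple (A : I → unitary M) :
    HasStrictFDerivAt (coord A ∘ conjTuple A)
      ((coboundary (Ad.comp (FreeGroup.lift A))).toContinuousLinearMap.coprod
        (ContinuousLinearMap.id ℝ (I → LieAlg M))) 0 := by
  have := Fintype.ofFinite I
  refine hasStrictFDerivAt_pi'' fun i => ?_
  have hexp := HasLogDerivAt.comp (φ := (Prod.fst : LieAlg M × (I → LieAlg M) → LieAlg M)) (x := 0)
    hasLogDerivAt_expUnitary (ContinuousLinearMap.fst ℝ (LieAlg M) (I → LieAlg M)).hasStrictFDerivAt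
  have htuple := HasLogDerivAt.comp (φ := (Prod.snd : LieAlg M × (I → LieAlg M) → I → LieAlg M))
    (x := 0) (hasLogDerivAt_tuple A i)
    (ContinuousLinearMap.snd ℝ (LieAlg M) (I → LieAlg M)).hasStrictFDerivAt
  have h := ((hexp.mul htuple).mul hexp.inv).mul (.const (A i)⁻¹ 0)
  refine (h.skewPart ?_).congr_fderiv (ContinuousLinearMap.ext fun p => ?_)
  · simp [expUnitary_zero, tuple_zero]
  · simp [expUnitary_zero, tuple_zero, coboundary_apply]
    abel

variable {E : Type*} [NormedAddCommGroup E] [NormedSpace ℝ E]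

theorem hasStrictFDerivAt_coord_conjTuple_slice (D : (LieAlg M × E) ≃L[ℝ] (I → LieAlg M))
    (hD : ∀ x, D (x, 0) = coboundary (Ad.comp (FreeGroup.lift A)) x) :
    HasStrictFDerivAt (fun p : LieAlg M × E => coord A (conjTuple A (p.1, D (0, p.2))))
      (D : (LieAlg M × E) →L[ℝ] (I → LieAlg M)) 0 := by
  have := Fintype.ofFinite I
  let incl : (LieAlg M × E) →L[ℝ] (LieAlg M × (I → LieAlg M)) :=
    (ContinuousLinearMap.id ℝ _).prodMap
      (D.toContinuousLinearMap ∘L ContinuousLinearMap.inr ℝ (LieAlg M) E)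
  have h := hasStrictFDerivAt_coord_conjTuple A
  rw [← incl.map_zero] at h
  refine (HasStrictFDerivAt.comp (0 : LieAlg M × E) h incl.hasStrictFDerivAt).congr_fderiv
    (ContinuousLinearMap.ext fun p => ?_)
  simpa [incl, ← hD] using (D.map_add (p.1, 0) (0, p.2)).symm

theorem exists_isLocalSlice (hA : Subalgebra.centralizer ℝ (range fun i => (A i : M)) = ⊥)
    (D : (LieAlg M × E) ≃L[ℝ] (I → LieAlg M))
    (hD : ∀ x, D (x, 0) = coboundary (Ad.comp (FreeGroup.lift A)) x) :
    ∃ N : Set E, 0 ∈ N ∧ IsLocalSlice (ConjAct (unitary M)) (fun u => tuple A (D (0, u))) N := by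
  have := Fintype.ofFinite I
  let tup (u : E) := tuple A (D (0, u))
  have hincl : Continuous fun u : E => D (0, u) :=
    D.continuous.comp (continuous_const.prodMk continuous_id)
  have htup (u : E) : conjTuple A (0, D (0, u)) = tup u := conjTuple_zero_left A _
  have htup0 : tup 0 = A := by simp [tup, ← Prod.zero_eq_mk, tuple_zero]
  have hcont : Continuous tup := (continuous_tuple A).comp hincl
  have : CompleteSpace (LieAlg M × E) :=
    (D.isUniformEmbedding.isUniformInducing.completeSpace_congr D.surjective).2
      (FiniteDimensional.complete ℝ _)
  obtain ⟨U, hU, hAU, hinj⟩ := exists_injOn_coord A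
  obtain ⟨V, hVo, hV0, hVinj, hVimage⟩ := exists_injOn_and_image_mem_nhds
    ((continuous_conjTuple A).comp (continuous_fst.prodMk (hincl.comp continuous_snd)))
    (continuous_coord A) hU hinj
    (by simpa [htup, htup0] using hAU)
    (hasStrictFDerivAt_coord_conjTuple_slice D hD)
  obtain ⟨N₁, N₂, hN₁, h0N₁, hN₂, h0N₂, hNV⟩ := mem_nhds_prod_iff'.1 (hVo.mem_nhds hV0)
  obtain ⟨S₁, S₂, hS₁, hAS₁, hS₂, hAS₂, hS⟩ := mem_nhds_prod_iff'.1
    (eventually_mem_or_neg_mem hA (image_expUnitary_mem_nhds (hN₁.mem_nhds h0N₁)))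
  refine ⟨N₂ ∩ tup ⁻¹' (S₁ ∩ S₂), ⟨h0N₂, by rw [mem_preimage, htup0]; exact ⟨hAS₁, hAS₂⟩⟩,
    hN₂.inter ((hS₁.inter hS₂).preimage hcont), hcont, fun {u u'} hu hu' k huu' => ?_,
    fun {u} hu W hW => ?_⟩
  · obtain ⟨x, hxN, hx⟩ : ∃ x ∈ N₁, expUnitary x = ConjAct.ofConjAct k ∨
        expUnitary x = -ConjAct.ofConjAct k := by
      have hmem := hS (mk_mem_prod hu.2.1 hu'.2.2) (ConjAct.ofConjAct k)
        fun i => congrFun huu'.symm i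
      grind
    have h : conjTuple A (x, D (0, u)) = conjTuple A (0, D (0, u')) := by
      rw [htup, ← smul_tuple_eq_conjTuple hx]
      exact huu'
    exact congrArg Prod.snd
      (hVinj (hNV (mk_mem_prod hxN hu.1)) (hNV (mk_mem_prod h0N₁ hu'.1)) h)
  · have himage := hVimage (0, u) (hNV ⟨h0N₁, hu.1⟩) _ (prod_mem_nhds (hN₁.mem_nhds h0N₁) hW)
    simp only [Function.comp_apply, htup] at himage
    filter_upwards [himage]
    rintro _ ⟨⟨x, u'⟩, ⟨-, hu'⟩, rfl⟩
    exact ⟨u', hu', ConjAct.toConjAct (expUnitary x), smul_tuple_eq_conjTuple (.inl rfl) _⟩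

end Slice

end UnitarySlice

/-! ### Charts of orbit spaces -/

section OrbitSpace

variable {G E X Y D : Type*} [Group G] [TopologicalSpace E] [TopologicalSpace X]
  [TopologicalSpace Y] [TopologicalSpace D] [MulAction G Y] [ContinuousConstSMul G Y]

theorem IsLocalSlice.exists_isOpenEmbedding {tup : E → Y} {N : Set E} (h : IsLocalSlice G tup N)
    {ev : X → Y} (hev : IsInducing ev) (hrange : ∀ (k : G), ∀ y ∈ range ev, k • y ∈ range ev)
    {q : X → D} (hq : IsQuotientMap q) (hqq : ∀ x y, q x = q y ↔ ∃ k : G, k • ev x = ev y) :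
    ∃ σ : ↥(N ∩ tup ⁻¹' range ev) → D, IsOpenEmbedding σ ∧
      ∀ (x : X) (u : ↥(N ∩ tup ⁻¹' range ev)), ev x = tup u → σ u = q x := by
  choose s hs using fun u : ↥(N ∩ tup ⁻¹' range ev) => u.2.2
  have hσ (x : X) (u : ↥(N ∩ tup ⁻¹' range ev)) (k : G) (hu : k • tup u = ev x) :
      q (s u) = q x := (hqq _ _).2 ⟨k, by rwa [hs]⟩
  refine ⟨q ∘ s, .of_continuous_injective_isOpenMap ?_ (fun u u' huu' => ?_) ?_,
    fun x u hu => hσ x u 1 (by rw [one_smul, hu])⟩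
  · refine hq.continuous.comp (hev.continuous_iff.2 ?_)
    simpa only [Function.comp_def, hs] using h.continuous.comp continuous_subtype_val
  · obtain ⟨k, hk⟩ := (hqq _ _).1 huu'
    rw [hs, hs] at hk
    exact Subtype.ext (h.eq_of_smul_eq u.2.1 u'.2.1 k hk)
  · rintro _ ⟨O, hO, rfl⟩
    refine hq.isOpen_preimage.1 (isOpen_iff_mem_nhds.2 ?_)
    rintro x ⟨u, huO, hux⟩
    obtain ⟨k, hk⟩ := (hqq _ _).1 hux
    rw [hs, smul_eq_iff_eq_inv_smul] at hk
    have horbit := h.orbits_mem_nhds u.2.1 ((hO.inter h.isOpen).mem_nhds ⟨huO, u.2.1⟩)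
    rw [hk] at horbit
    filter_upwards [((continuous_const_smul k⁻¹).comp hev.continuous).continuousAt horbit]
    rintro x' ⟨u', hu', k', hk'⟩
    rw [Function.comp_apply, eq_inv_smul_iff, smul_smul] at hk'
    have hu'range : u' ∈ tup ⁻¹' range ev := by
      rw [mem_preimage, eq_inv_smul_iff.2 hk']
      exact hrange _ _ ⟨x', rfl⟩
    exact ⟨⟨u', hu'.2, hu'range⟩, hu'.1, hσ x' _ _ hk'⟩

end OrbitSpace

theorem isOpenEmbedding_snd_of_fst_eq {E L K : Type*} [TopologicalSpace E]
    [TopologicalSpace L] [TopologicalSpace K] (e : OpenPartialHomeomorph E (L × K)) {N S : Set E}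
    (hN : IsOpen N) (hNe : N ⊆ e.source) {c : L} (hS : ∀ u, u ∈ S ↔ u ∈ N ∧ (e u).1 = c) :
    IsOpenEmbedding fun u : S => (e u).2 := by
  have heq (u : S) : e u = (c, (e u).2) := Prod.ext ((hS u).1 u.2).2 rfl
  have hsource (u : S) : (u : E) ∈ e.source := hNe ((hS u).1 u.2).1
  refine .of_continuous_injective_isOpenMap ?_ (fun u u' huu' => ?_) ?_
  · exact continuous_snd.comp (e.continuousOn.comp_continuous continuous_subtype_val hsource)
  · refine Subtype.ext (e.injOn (hsource u) (hsource u') ?_)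
    rw [heq u, heq u']
    exact congrArg _ huu'
  · rintro _ ⟨O, hO, rfl⟩
    have hopen : IsOpen (e '' (O ∩ N)) :=
      e.isOpen_image_of_subset_source (hO.inter hN) (inter_subset_right.trans hNe)
    convert hopen.preimage (Continuous.prodMk_right c) using 1
    ext y
    constructor
    · rintro ⟨u, hu, rfl⟩
      exact ⟨u, ⟨hu, ((hS u).1 u.2).1⟩, heq u⟩
    · rintro ⟨u, ⟨huO, huN⟩, hu⟩
      exact ⟨⟨u, (hS u).2 ⟨huN, congrArg Prod.fst hu⟩⟩, huO, congrArg Prod.snd hu⟩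

theorem exists_continuousLinearEquiv_prod {V W : Type*} [NormedAddCommGroup V] [NormedSpace ℝ V]
    [NormedAddCommGroup W] [NormedSpace ℝ W] [FiniteDimensional ℝ W] {f : V →ₗ[ℝ] W}
    (hf : Function.Injective f) {m : ℕ} (hm : Module.finrank ℝ V + m = Module.finrank ℝ W) :
    ∃ D : (V × EuclideanSpace ℝ (Fin m)) ≃L[ℝ] W, ∀ v, D (v, 0) = f v := by
  have : FiniteDimensional ℝ V := .of_injective f hf
  obtain ⟨E, hE⟩ := Submodule.exists_isCompl f.range
  have hdim : Module.finrank ℝ (EuclideanSpace ℝ (Fin m)) = Module.finrank ℝ E := by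
    have := Submodule.finrank_add_eq_of_isCompl hE
    rw [LinearMap.finrank_range_of_inj hf] at this
    rw [finrank_euclideanSpace_fin]
    omega
  refine ⟨(((LinearEquiv.ofInjective f hf).prodCongr (LinearEquiv.ofFinrankEq _ _ hdim)).trans
    (Submodule.prodEquivOfIsCompl _ _ hE)).toContinuousLinearEquiv, fun v => ?_⟩
  simp

theorem exists_openPartialHomeomorph_fst_eq {E F : Type*} [NormedAddCommGroup E] [NormedSpace ℝ E]
    [FiniteDimensional ℝ E] [NormedAddCommGroup F] [NormedSpace ℝ F] [FiniteDimensional ℝ F]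
    {f : E → F} {f' : E →L[ℝ] F} {a : E} (hf : HasStrictFDerivAt f f' a) (hf' : f'.range = ⊤)
    {n : ℕ} (hn : Module.finrank ℝ F + n = Module.finrank ℝ E) :
    ∃ e : OpenPartialHomeomorph E (F × EuclideanSpace ℝ (Fin n)),
      a ∈ e.source ∧ ∀ u, (e u).1 = f u := by
  have : CompleteSpace E := FiniteDimensional.complete ℝ E
  have hdim : Module.finrank ℝ f'.ker = Module.finrank ℝ (EuclideanSpace ℝ (Fin n)) := by
    have := LinearMap.finrank_range_add_finrank_ker f'.toLinearMap
    rw [hf', finrank_top] at this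
    rw [finrank_euclideanSpace_fin]
    omega
  let κ := (ContinuousLinearEquiv.refl ℝ F).prodCongr (ContinuousLinearEquiv.ofFinrankEq hdim)
  exact ⟨(hf.implicitToOpenPartialHomeomorph f f' hf').transHomeomorph κ.toHomeomorph,
    hf.mem_implicitToOpenPartialHomeomorph_source hf', fun u => rfl⟩

theorem continuous_freeGroup_lift {I G : Type*} [Group G] [TopologicalSpace G]
    [IsTopologicalGroup G] (w : FreeGroup I) : Continuous fun a : I → G => FreeGroup.lift a w := by
  induction w using FreeGroup.induction_on with
  | C1 => simpa only [_root_.map_one] using continuous_const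
  | of i => simpa only [FreeGroup.lift_apply_of] using continuous_apply i
  | inv_of i hi =>
    simp only [_root_.map_inv]
    exact hi.inv
  | mul v w hv hw =>
    simp only [_root_.map_mul]
    exact hv.mul hw

theorem lift_toConjAct_smul {I G : Type*} [Group G] (k : ConjAct G) (a : I → G)
    (w : FreeGroup I) : FreeGroup.lift (k • a) w = k • FreeGroup.lift a w := by
  have h : FreeGroup.lift (k • a) =
      (MulAut.conj (ConjAct.ofConjAct k)).toMonoidHom.comp (FreeGroup.lift a) := by
    ext i
    simp [ConjAct.smul_def]
  rw [h]
  rfl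

namespace UnitarySlice

variable {M : Type*} [NormedRing M] [NormedAlgebra ℝ M] [StarRing M] [StarModule ℝ M]
  [ContinuousStar M] [CompleteSpace M] [FiniteDimensional ℝ M] {g : ℕ}
  {A : Fin g × Bool → unitary M} {T : M →ₗ[ℝ] ℝ}

/-- Near a tuple with trivial commutant, the surface relation is regular along a slice: the
derivative of the relator is onto, and it kills the tangent directions of the orbit. -/
theorem exists_chart_relation
    (hA : Subalgebra.centralizer ℝ (range fun i => (A i : M)) = ⊥) (hT : IsStarTrace T)
    (hrel : FreeGroup.lift A (surfaceRelator g) = 1)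
    {m n : ℕ} (hn : Module.finrank ℝ (LieAlg M) + n = m)
    (D : (LieAlg M × EuclideanSpace ℝ (Fin m)) ≃L[ℝ] (Fin g × Bool → LieAlg M))
    (hD : ∀ x, D (x, 0) = coboundary (Ad.comp (FreeGroup.lift A)) x) :
    ∃ (e : OpenPartialHomeomorph (EuclideanSpace ℝ (Fin m))
        (LieAlg M × EuclideanSpace ℝ (Fin n))) (N : Set (EuclideanSpace ℝ (Fin m))),
      IsOpen N ∧ 0 ∈ N ∧ N ⊆ e.source ∧ ∀ u ∈ N,
        FreeGroup.lift (tuple A (D (0, u))) (surfaceRelator g) = 1 ↔ (e u).1 = 0 := by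
  let relMap (u : EuclideanSpace ℝ (Fin m)) : unitary M :=
    FreeGroup.lift (tuple A (D (0, u))) (surfaceRelator g)
  let incl : EuclideanSpace ℝ (Fin m) →L[ℝ] (Fin g × Bool → LieAlg M) :=
    D.toContinuousLinearMap ∘L ContinuousLinearMap.inr ℝ (LieAlg M) (EuclideanSpace ℝ (Fin m))
  have hcont : Continuous relMap :=
    (continuous_freeGroup_lift _).comp ((continuous_tuple A).comp incl.continuous)
  have hrel0 : relMap 0 = 1 := by simp [relMap, ← Prod.zero_eq_mk, tuple_zero, hrel]
  have hlog : HasLogDerivAt relMap (wordDeriv A (surfaceRelator g) ∘L incl) 0 := by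
    have h := hasLogDerivAt_lift_tuple A (surfaceRelator g)
    rw [← incl.map_zero] at h
    exact h.comp incl.hasStrictFDerivAt
  have hsurj : (wordDeriv A (surfaceRelator g) ∘L incl).range = ⊤ := by
    refine LinearMap.range_eq_top.2 fun y => ?_
    obtain ⟨w, rfl⟩ := wordDeriv_surfaceRelator_surjective hA hT y
    obtain ⟨⟨x, u⟩, rfl⟩ := D.surjective w
    have hx : wordDeriv A (surfaceRelator g) (D (x, 0)) = 0 := by
      simpa [hD, hrel] using (isFoxDerivative_wordDeriv A).map_coboundary (surfaceRelator g) x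
    have hsplit : D (x, u) = D (x, 0) + incl u := by simp [incl, ← D.map_add]
    refine ⟨u, ?_⟩
    change wordDeriv A (surfaceRelator g) (incl u) = _
    rw [hsplit, map_add, hx, zero_add]
  obtain ⟨e, he0, he⟩ := exists_openPartialHomeomorph_fst_eq (hlog.skewPart hrel0) hsurj
    (hn.trans finrank_euclideanSpace_fin.symm)
  obtain ⟨U, hU, h1U, hinj⟩ := exists_injOn_skewPart (M := M)
  refine ⟨e, e.source ∩ relMap ⁻¹' U, e.open_source.inter (hU.preimage hcont),
    ⟨he0, by rwa [mem_preimage, hrel0]⟩, inter_subset_left, fun u hu => ?_⟩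
  have h := hinj.eq_iff hu.2 h1U
  simp only [OneMemClass.coe_one, skewPart_one, ← he] at h
  exact h.symm

theorem exists_chart_orbitSpace (hT : IsStarTrace T) {X Q : Type*} [TopologicalSpace X]
    [TopologicalSpace Q] {ev : X → Fin g × Bool → unitary M} (hev : IsInducing ev)
    (hrange : range ev = {a | FreeGroup.lift a (surfaceRelator g) = 1})
    {q : X → Q} (hq : IsQuotientMap q)
    (hqq : ∀ x y, q x = q y ↔ ∃ k : ConjAct (unitary M), k • ev x = ev y) {x₀ : X}
    (hx₀ : Subalgebra.centralizer ℝ (range fun i => (ev x₀ i : M)) = ⊥) {n : ℕ}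
    (hn : n + 2 * Module.finrank ℝ (LieAlg M) = 2 * g * Module.finrank ℝ (LieAlg M)) :
    ∃ e : OpenPartialHomeomorph Q (EuclideanSpace ℝ (Fin n)), q x₀ ∈ e.source := by
  have hdim : Module.finrank ℝ (LieAlg M) + (Module.finrank ℝ (LieAlg M) + n) =
      Module.finrank ℝ (Fin g × Bool → LieAlg M) := by
    rw [Module.finrank_pi_fintype, Finset.sum_const, Finset.card_univ, Fintype.card_prod,
      Fintype.card_fin, Fintype.card_bool, smul_eq_mul, mul_comm g 2]
    omega
  obtain ⟨D, hD⟩ := exists_continuousLinearEquiv_prod (coboundary_Ad_injective hx₀) hdim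
  obtain ⟨N, h0N, hN⟩ := exists_isLocalSlice hx₀ D hD
  have hmem (a : Fin g × Bool → unitary M) :
      a ∈ range ev ↔ FreeGroup.lift a (surfaceRelator g) = 1 := by rw [hrange]; rfl
  obtain ⟨e, N', hN', h0N', hN'e, he⟩ :=
    exists_chart_relation hx₀ hT ((hmem _).1 ⟨x₀, rfl⟩) rfl D hD
  obtain ⟨σ, hσ, hσq⟩ := (hN.inter hN').exists_isOpenEmbedding hev
    (fun k a ha => (hmem _).2 (by rw [lift_toConjAct_smul, (hmem _).1 ha, smul_one])) hq hqq
  have htup0 : tuple (ev x₀) (D (0, 0)) = ev x₀ := by rw [← Prod.zero_eq_mk, map_zero, tuple_zero]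
  let u₀ : ↥(N ∩ N' ∩ (fun u => tuple (ev x₀) (D (0, u))) ⁻¹' range ev) :=
    ⟨0, ⟨h0N, h0N'⟩, x₀, htup0.symm⟩
  have hτ := isOpenEmbedding_snd_of_fst_eq e (hN.isOpen.inter hN') (inter_subset_right.trans hN'e)
    (c := 0) (S := N ∩ N' ∩ (fun u => tuple (ev x₀) (D (0, u))) ⁻¹' range ev)
    fun u => and_congr_right fun hu => (hmem _).trans (he u hu.2)
  have : Nonempty ↥(N ∩ N' ∩ (fun u => tuple (ev x₀) (D (0, u))) ⁻¹' range ev) := ⟨u₀⟩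
  refine ⟨(hσ.toOpenPartialHomeomorph σ).symm.trans (hτ.toOpenPartialHomeomorph _), ?_⟩
  rw [← hσq x₀ u₀ htup0.symm]
  simp

end UnitarySlice

/-! ### The Hermitian form -/

namespace SpOneOne

theorem rmul_rmul (v : Vec) (a b : ℍ[ℝ]) : rmul (rmul v a) b = rmul v (a * b) :=
  funext fun _ => mul_assoc _ _ _

theorem rmul_one (v : Vec) : rmul v 1 = v := funext fun _ => mul_one _

theorem rmul_zero (v : Vec) : rmul v 0 = 0 := funext fun _ => mul_zero _

theorem rmul_coe (v : Vec) (r : ℝ) : rmul v (r : ℍ[ℝ]) = r • v :=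
  funext fun i => Quaternion.mul_coe_eq_smul r (v i)

theorem rmul_ne_zero {v : Vec} (hv : v ≠ 0) {q : ℍ[ℝ]} (hq : q ≠ 0) : rmul v q ≠ 0 :=
  fun h => hv (funext fun i => (mul_eq_zero.1 (congrFun h i)).resolve_right hq)

theorem right_ne_zero_of_rmul {v : Vec} {c : ℍ[ℝ]} (h : rmul v c ≠ 0) : c ≠ 0 := by
  rintro rfl
  exact h (rmul_zero v)

theorem rmul_left_cancel {v w : Vec} {c : ℍ[ℝ]} (hc : c ≠ 0) (h : rmul v c = rmul w c) :
    v = w :=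
  funext fun i => mul_right_cancel₀ hc (congrFun h i)

theorem rmul_right_cancel {v : Vec} (hv : v ≠ 0) {a b : ℍ[ℝ]} (h : rmul v a = rmul v b) :
    a = b := by
  obtain ⟨i, hi⟩ := Function.ne_iff.1 hv
  exact mul_left_cancel₀ hi (congrFun h i)

theorem mulVec_rmul (m : Matrix (Fin 2) (Fin 2) ℍ[ℝ]) (v : Vec) (q : ℍ[ℝ]) :
    m *ᵥ rmul v q = rmul (m *ᵥ v) q :=
  Matrix.mulVec_smul m (MulOpposite.op q) v

theorem act_rmul (A : Sp11) (v : Vec) (q : ℍ[ℝ]) : act A (rmul v q) = rmul (act A v) q :=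
  mulVec_rmul _ v q

theorem act_mul (A B : Sp11) (v : Vec) : act (A * B) v = act A (act B v) :=
  (Matrix.mulVec_mulVec v A.val.val B.val.val).symm

theorem act_one (v : Vec) : act 1 v = v := Matrix.one_mulVec v

theorem act_add (A : Sp11) (v w : Vec) : act A (v + w) = act A v + act A w :=
  Matrix.mulVec_add _ v w

theorem act_inv_act (A : Sp11) (v : Vec) : act A⁻¹ (act A v) = v := by
  rw [← act_mul, inv_mul_cancel, act_one]

theorem act_act_inv (A : Sp11) (v : Vec) : act A (act A⁻¹ v) = v := by
  rw [← act_mul, mul_inv_cancel, act_one]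

theorem act_ne_zero (A : Sp11) {v : Vec} (hv : v ≠ 0) : act A v ≠ 0 := fun h =>
  hv (toLin_injective A (h.trans (map_zero (toLin A)).symm))

theorem eigenvalue_ne_zero {A : Sp11} {v : Vec} {μ : ℍ[ℝ]} (hv : v ≠ 0)
    (h : act A v = rmul v μ) : μ ≠ 0 :=
  right_ne_zero_of_rmul (h ▸ act_ne_zero A hv)

theorem herm_act (A : Sp11) (z w : Vec) : herm (act A z) (act A w) = herm z w := A.2 z w

theorem star_herm (z w : Vec) : star (herm z w) = herm w z := by simp [herm, add_comm]

theorem herm_rmul_left (z w : Vec) (a : ℍ[ℝ]) : herm (rmul z a) w = herm z w * a := by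
  simp [herm, rmul, mul_assoc, add_mul]

theorem herm_rmul_right (z w : Vec) (a : ℍ[ℝ]) : herm z (rmul w a) = star a * herm z w := by
  simp [herm, rmul, mul_assoc, mul_add]

theorem herm_add_left (x y w : Vec) : herm (x + y) w = herm x w + herm y w := by
  simp only [herm, Pi.add_apply, mul_add]
  abel

theorem herm_add_right (x y w : Vec) : herm w (x + y) = herm w x + herm w y := by
  simp only [herm, Pi.add_apply, star_add, add_mul]
  abel

theorem herm_sub_left (x y w : Vec) : herm (x - y) w = herm x w - herm y w := by
  simp only [herm, Pi.sub_apply, mul_sub]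
  abel

theorem herm_smul_left (r : ℝ) (x w : Vec) : herm (r • x) w = r • herm x w := by simp [herm]

theorem herm_smul_right (r : ℝ) (x w : Vec) : herm w (r • x) = r • herm w x := by simp [herm]

theorem herm_self (v : Vec) : herm v v = ((herm v v).re : ℍ[ℝ]) :=
  Quaternion.star_eq_self.1 (star_herm v v)

theorem herm_self_rmul (v : Vec) (q : ℍ[ℝ]) :
    herm (rmul v q) (rmul v q) = ((Quaternion.normSq q * (herm v v).re : ℝ) : ℍ[ℝ]) := by
  rw [herm_rmul_left, herm_rmul_right, herm_self v, ← Quaternion.coe_commutes, mul_assoc,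
    Quaternion.star_mul_self, ← Quaternion.coe_mul, mul_comm, Quaternion.re_coe]

theorem exists_orthogonal_eq_rmul {z : Vec} (hz : z ≠ 0) :
    ∃ e, herm e e = -herm z z ∧ ∀ y, herm y z = 0 → ∃ c, y = rmul e c := by
  by_cases hz1 : z 1 = 0
  · have hz0 : z 0 ≠ 0 := fun hz0 => hz (by ext1 i; fin_cases i <;> assumption)
    refine ⟨z, by simp [herm, hz1], fun y hy => ⟨(z 0)⁻¹ * y 0, ?_⟩⟩
    have hy1 : y 1 = 0 := by simpa [herm, hz1, hz0] using hy
    ext1 i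
    fin_cases i <;> simp [rmul, hz0, hz1, hy1]
  · have hz1' : star (z 1) ≠ 0 := star_ne_zero.2 hz1
    refine ⟨![-((star (z 1))⁻¹ * (star (z 0) * z 1)), z 1], ?_, fun y hy => ⟨(z 1)⁻¹ * y 1, ?_⟩⟩
    · simp [herm, mul_inv_cancel_left₀ hz1', mul_assoc, inv_mul_cancel₀ hz1]
    · have hy0 : y 0 = -((star (z 1))⁻¹ * (star (z 0) * y 1)) := by
        rw [← mul_neg, eq_inv_mul_iff_mul_eq₀ hz1']
        exact eq_neg_of_add_eq_zero_left hy
      ext1 i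
      fin_cases i <;> simp [rmul, hy0, mul_assoc, mul_inv_cancel_left₀ hz1]

theorem eq_rmul_of_herm_eq_zero {v w : Vec} (hv : v ≠ 0) (hv0 : herm v v = 0)
    (h : herm w v = 0) : ∃ c, w = rmul v c := by
  obtain ⟨e, -, he⟩ := exists_orthogonal_eq_rmul hv
  obtain ⟨a, ha⟩ := he v hv0
  obtain ⟨b, hb⟩ := he w h
  have ha0 : a ≠ 0 := right_ne_zero_of_rmul (ha ▸ hv)
  exact ⟨a⁻¹ * b, by rw [hb, ha, rmul_rmul, mul_inv_cancel_left₀ ha0]⟩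

theorem re_herm_self_of_orthogonal {y z : Vec} (hy : y ≠ 0) (hz : z ≠ 0) (h : herm y z = 0) :
    ∃ t : ℝ, 0 < t ∧ (herm y y).re = -(t * (herm z z).re) := by
  obtain ⟨e, hez, he⟩ := exists_orthogonal_eq_rmul hz
  obtain ⟨c, rfl⟩ := he y h
  have hc := right_ne_zero_of_rmul hy
  refine ⟨Quaternion.normSq c,
    Quaternion.normSq_nonneg.lt_of_ne' (Quaternion.normSq_ne_zero.2 hc), ?_⟩
  rw [herm_self_rmul, Quaternion.re_coe, hez, Quaternion.re_neg, mul_neg]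

theorem ne_zero_of_re_herm_self_ne_zero {z : Vec} (hz : (herm z z).re ≠ 0) : z ≠ 0 := by
  rintro rfl
  simp [herm] at hz

theorem eq_rmul_add_rmul_of_orthogonal {x e : Vec} (hx : herm x x ≠ 0) (he : herm e e ≠ 0)
    (hex : herm e x = 0) (y : Vec) :
    y = rmul x ((herm x x)⁻¹ * herm y x) + rmul e ((herm e e)⁻¹ * herm y e) := by
  have hxe : herm x e = 0 := by rw [← star_herm, hex, star_zero]
  have hx0 : x ≠ 0 := by
    rintro rfl
    simp [herm] at hx
  obtain ⟨f, -, hf⟩ := exists_orthogonal_eq_rmul hx0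
  obtain ⟨a, rfl⟩ := hf e hex
  set d := y - (rmul x ((herm x x)⁻¹ * herm y x) +
    rmul (rmul f a) ((herm (rmul f a) (rmul f a))⁻¹ * herm y (rmul f a))) with hd
  have hdx : herm d x = 0 := by
    rw [hd, herm_sub_left, herm_add_left, herm_rmul_left, herm_rmul_left (rmul f a), hex,
      mul_inv_cancel_left₀ hx, zero_mul, add_zero, sub_self]
  have hde : herm d (rmul f a) = 0 := by
    rw [hd, herm_sub_left, herm_add_left, herm_rmul_left x, hxe, herm_rmul_left (rmul f a),
      mul_inv_cancel_left₀ he, zero_mul, zero_add, sub_self]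
  obtain ⟨b, hb⟩ := hf d hdx
  rw [herm_rmul_right, herm_rmul_left, mul_ne_zero_iff, mul_ne_zero_iff] at he
  rw [hb, herm_rmul_right, herm_rmul_left, mul_eq_zero, mul_eq_zero, or_iff_right he.1,
    or_iff_right he.2.1] at hde
  rwa [hde, rmul_zero, hd, sub_eq_zero] at hb

theorem herm_ne_zero_of_neg {x y : Vec} (hx : (herm x x).re < 0) (hy : (herm y y).re < 0) :
    herm x y ≠ 0 := fun h => by
  obtain ⟨t, ht, hty⟩ := re_herm_self_of_orthogonal (ne_zero_of_re_herm_self_ne_zero hx.ne)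
    (ne_zero_of_re_herm_self_ne_zero hy.ne) h
  linarith [mul_neg_of_pos_of_neg ht hy]

/-! ### Points of the projective line -/

theorem mk_eq_mk_iff {v w : Vec} (hv : v ≠ 0) (hw : w ≠ 0) :
    Projectivization.mk ℍ[ℝ]ᵐᵒᵖ v hv = Projectivization.mk ℍ[ℝ]ᵐᵒᵖ w hw ↔ ∃ q, rmul w q = v := by
  rw [Projectivization.mk_eq_mk_iff']
  exact ⟨fun ⟨a, ha⟩ => ⟨a.unop, ha⟩, fun ⟨q, hq⟩ => ⟨MulOpposite.op q, hq⟩⟩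

theorem exists_rep_eq {v : Vec} (hv : v ≠ 0) :
    ∃ q, q ≠ 0 ∧ (Projectivization.mk ℍ[ℝ]ᵐᵒᵖ v hv).rep = rmul v q := by
  obtain ⟨a, ha⟩ := Projectivization.exists_smul_eq_mk_rep ℍ[ℝ]ᵐᵒᵖ v hv
  exact ⟨(a : ℍ[ℝ]ᵐᵒᵖ).unop, by simp, ha.symm⟩

theorem mk_mem_hypSpace {v : Vec} (hv : v ≠ 0) :
    Projectivization.mk ℍ[ℝ]ᵐᵒᵖ v hv ∈ hypSpace ↔ (herm v v).re < 0 := by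
  obtain ⟨q, hq, h⟩ := exists_rep_eq hv
  have hpos : 0 < Quaternion.normSq q :=
    Quaternion.normSq_nonneg.lt_of_ne' (Quaternion.normSq_ne_zero.2 hq)
  change (herm _ _).re < 0 ↔ _
  rw [h, herm_self_rmul, Quaternion.re_coe, ← neg_pos, ← mul_neg, mul_pos_iff_of_pos_left hpos,
    neg_pos]

theorem mk_mem_bdry {v : Vec} (hv : v ≠ 0) :
    Projectivization.mk ℍ[ℝ]ᵐᵒᵖ v hv ∈ bdry ↔ herm v v = 0 := by
  obtain ⟨q, hq, h⟩ := exists_rep_eq hv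
  change herm _ _ = 0 ↔ _
  rw [h, herm_rmul_left, herm_rmul_right]
  simp [hq]

theorem move_mk (A : Sp11) {v : Vec} (hv : v ≠ 0) :
    move A (Projectivization.mk ℍ[ℝ]ᵐᵒᵖ v hv) =
      Projectivization.mk ℍ[ℝ]ᵐᵒᵖ (act A v) (act_ne_zero A hv) := rfl

theorem move_mk_eq_iff (A : Sp11) {v : Vec} (hv : v ≠ 0) :
    move A (Projectivization.mk ℍ[ℝ]ᵐᵒᵖ v hv) = Projectivization.mk ℍ[ℝ]ᵐᵒᵖ v hv ↔
      ∃ μ, act A v = rmul v μ := by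
  rw [move_mk, mk_eq_mk_iff]
  exact exists_congr fun _ => eq_comm

theorem move_mul (A B : Sp11) (p : HP1) : move (A * B) p = move A (move B p) := by
  induction p using Projectivization.ind with | _ v hv
  simp only [move_mk, act_mul]

theorem move_one (p : HP1) : move 1 p = p := by
  induction p using Projectivization.ind with | _ v hv
  simp only [move_mk, act_one]

theorem move_inv_move (A : Sp11) (p : HP1) : move A⁻¹ (move A p) = p := by
  rw [← move_mul, inv_mul_cancel, move_one]

theorem move_move_inv (A : Sp11) (p : HP1) : move A (move A⁻¹ p) = p := by
  rw [← move_mul, mul_inv_cancel, move_one]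

theorem move_injective (A : Sp11) : Function.Injective (move A) :=
  Function.LeftInverse.injective (move_inv_move A)

theorem move_inv_eq_iff {A : Sp11} {p q : HP1} : move A⁻¹ p = q ↔ p = move A q :=
  ⟨fun h => by rw [← h, move_move_inv], fun h => by rw [h, move_inv_move]⟩

theorem mem_image_move {A : Sp11} {S : Set HP1} {p : HP1} :
    p ∈ move A '' S ↔ move A⁻¹ p ∈ S := by
  rw [image_eq_preimage_of_inverse (move_inv_move A) (move_move_inv A)]
  rfl

theorem image_move_mul (A B : Sp11) (S : Set HP1) :
    move (A * B) '' S = move A '' (move B '' S) := by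
  simp only [image_image, move_mul]

theorem move_mem_bdry_iff {A : Sp11} {p : HP1} : move A p ∈ bdry ↔ p ∈ bdry := by
  induction p using Projectivization.ind with | _ v hv
  rw [move_mk, mk_mem_bdry, mk_mem_bdry, herm_act]

theorem move_mem_hypSpace_iff {A : Sp11} {p : HP1} : move A p ∈ hypSpace ↔ p ∈ hypSpace := by
  induction p using Projectivization.ind with | _ v hv
  rw [move_mk, mk_mem_hypSpace, mk_mem_hypSpace, herm_act]

theorem image_move_hypSpace (A : Sp11) : move A '' hypSpace = hypSpace :=
  Set.ext fun _ => mem_image_move.trans move_mem_hypSpace_iff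

end SpOneOne

/-! ### The adjoint and frames -/

namespace SpOneOne

/-- The adjoint of a matrix with respect to the Hermitian form. -/
def adj (m : Matrix (Fin 2) (Fin 2) ℍ[ℝ]) : Matrix (Fin 2) (Fin 2) ℍ[ℝ] :=
  !![star (m 1 1), star (m 0 1); star (m 1 0), star (m 0 0)]

theorem herm_mulVec_left (m : Matrix (Fin 2) (Fin 2) ℍ[ℝ]) (z w : Vec) :
    herm (m *ᵥ z) w = herm z (adj m *ᵥ w) := by
  simp only [herm, adj, Matrix.mulVec, dotProduct, Fin.sum_univ_two, Matrix.of_apply,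
    Matrix.cons_val', Matrix.cons_val_zero, Matrix.cons_val_one, Matrix.cons_val_fin_one,
    star_add, star_mul, star_star, mul_add, add_mul, mul_assoc]
  abel

theorem adj_mul (m n : Matrix (Fin 2) (Fin 2) ℍ[ℝ]) : adj (m * n) = adj n * adj m := by
  ext1 i j
  fin_cases i <;> fin_cases j <;> simp [adj, Matrix.mul_apply, Fin.sum_univ_two, add_comm]

theorem adj_adj (m : Matrix (Fin 2) (Fin 2) ℍ[ℝ]) : adj (adj m) = m := by
  ext1 i j
  fin_cases i <;> fin_cases j <;> simp [adj]

theorem adj_add (m n : Matrix (Fin 2) (Fin 2) ℍ[ℝ]) : adj (m + n) = adj m + adj n := by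
  ext1 i j
  fin_cases i <;> fin_cases j <;> simp [adj]

theorem adj_smul (r : ℝ) (m : Matrix (Fin 2) (Fin 2) ℍ[ℝ]) : adj (r • m) = r • adj m := by
  ext1 i j
  fin_cases i <;> fin_cases j <;> simp [adj]

theorem adj_sub (m n : Matrix (Fin 2) (Fin 2) ℍ[ℝ]) : adj (m - n) = adj m - adj n := by
  ext1 i j
  fin_cases i <;> fin_cases j <;> simp [adj]

theorem adj_diag (a b : ℍ[ℝ]) : adj !![a, 0; 0, b] = !![star b, 0; 0, star a] := by
  ext1 i j
  fin_cases i <;> fin_cases j <;> simp [adj]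

theorem eq_of_mulVec_eq {m n : Matrix (Fin 2) (Fin 2) ℍ[ℝ]} (h0 : m *ᵥ ![1, 0] = n *ᵥ ![1, 0])
    (h1 : m *ᵥ ![0, 1] = n *ᵥ ![0, 1]) : m = n := by
  ext1 i j
  fin_cases j
  · simpa [Matrix.mulVec, dotProduct] using congrFun h0 i
  · simpa [Matrix.mulVec, dotProduct] using congrFun h1 i

theorem act_ext {A B : Sp11} (h0 : act A ![1, 0] = act B ![1, 0])
    (h1 : act A ![0, 1] = act B ![0, 1]) : A = B :=
  Subtype.ext (Units.ext (eq_of_mulVec_eq h0 h1))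

theorem eq_of_herm_eq {x y : Vec} (h : ∀ z, herm z x = herm z y) : x = y := by
  ext1 i
  fin_cases i
  · simpa [herm] using h ![0, 1]
  · simpa [herm] using h ![1, 0]

theorem adj_mul_self (A : Sp11) : adj A.val.val * A.val.val = 1 :=
  Matrix.ext_iff_mulVec.2 fun w => eq_of_herm_eq fun z => by
    rw [← Matrix.mulVec_mulVec, ← herm_mulVec_left, Matrix.one_mulVec]
    exact A.2 z w

theorem adj_coe (A : Sp11) : adj A.val.val = A.val⁻¹.val :=
  (Units.inv_eq_of_mul_eq_one_left (adj_mul_self A)).symm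

/-- The element of `Sp(1,1)` given by a matrix that is inverse to its adjoint. -/
def ofAdjMulSelf (m : Matrix (Fin 2) (Fin 2) ℍ[ℝ]) (h : adj m * m = 1) (h' : m * adj m = 1) :
    Sp11 :=
  ⟨⟨m, adj m, h', h⟩, fun z w => by
    change herm (m *ᵥ z) (m *ᵥ w) = _
    rw [herm_mulVec_left, Matrix.mulVec_mulVec, h, Matrix.one_mulVec]⟩

theorem exists_act_eq {p q : Vec} (hp : herm p p = 0) (hq : herm q q = 0) (hpq : herm p q = 1) :
    ∃ F : Sp11, act F ![1, 0] = p ∧ act F ![0, 1] = q := by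
  have hqp : herm q p = 1 := by rw [← star_herm, hpq, star_one]
  have h : adj !![p 0, q 0; p 1, q 1] * !![p 0, q 0; p 1, q 1] = 1 := by
    ext1 i j
    fin_cases i <;> fin_cases j <;>
      simpa [adj, Matrix.mul_apply, Fin.sum_univ_two] using by assumption
  refine ⟨ofAdjMulSelf _ h (mul_eq_one_comm.1 h), ?_, ?_⟩ <;> ext1 i <;> fin_cases i <;>
    simp [act, ofAdjMulSelf, Matrix.mulVec, dotProduct]

theorem exists_frame {v w : Vec} (hv : herm v v = 0) (hw : herm w w = 0) (hwv : herm w v ≠ 0) :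
    ∃ F : Sp11, act F ![0, 1] = v ∧ ∃ c, c ≠ 0 ∧ act F ![1, 0] = rmul w c := by
  obtain ⟨F, h0, h1⟩ := exists_act_eq (p := rmul w (herm w v)⁻¹) (q := v)
    (by rw [herm_rmul_left, herm_rmul_right, hw, mul_zero, zero_mul]) hv
    (by rw [herm_rmul_left, mul_inv_cancel₀ hwv])
  exact ⟨F, h1, _, inv_ne_zero hwv, h0⟩

theorem diag_mulVec (a b : ℍ[ℝ]) (x : Vec) : !![a, 0; 0, b] *ᵥ x = ![a * x 0, b * x 1] := by
  ext1 i
  fin_cases i <;> simp [Matrix.mulVec, dotProduct]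

/-! ### Fixed points of hyperbolic elements -/

theorem star_mul_herm_mul_of_eigen {A : Sp11} {p q : Vec} {μ ν : ℍ[ℝ]} (hp : act A p = rmul p μ)
    (hq : act A q = rmul q ν) : star ν * herm p q * μ = herm p q := by
  have h := herm_act A p q
  rwa [hp, hq, herm_rmul_left, herm_rmul_right] at h

theorem norm_mul_norm_of_eigen {A : Sp11} {p q : Vec} {μ ν : ℍ[ℝ]} (hp : act A p = rmul p μ)
    (hq : act A q = rmul q ν) (hpq : herm p q ≠ 0) : ‖ν‖ * ‖μ‖ = 1 := by
  have h := congrArg norm (star_mul_herm_mul_of_eigen hp hq)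
  rw [norm_mul, norm_mul, norm_star, mul_right_comm] at h
  exact mul_right_cancel₀ (norm_ne_zero_iff.2 hpq) (h.trans (one_mul _).symm)

theorem act_rmul_of_eigen {A : Sp11} {v : Vec} {c μ : ℍ[ℝ]} (hc : c ≠ 0)
    (h : act A v = rmul v μ) : act A (rmul v c) = rmul (rmul v c) (c⁻¹ * μ * c) := by
  rw [act_rmul, h, rmul_rmul, rmul_rmul, mul_assoc, mul_inv_cancel_left₀ hc]

theorem mul_eq_mul_of_eigen {A : Sp11} {v : Vec} {c μ ν : ℍ[ℝ]} (hv : v ≠ 0)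
    (h : act A v = rmul v μ) (h' : act A (rmul v c) = rmul (rmul v c) ν) : μ * c = c * ν := by
  rw [act_rmul, h, rmul_rmul, rmul_rmul] at h'
  exact rmul_right_cancel hv h'

theorem norm_eq_of_eigen {A : Sp11} {v : Vec} {c μ ν : ℍ[ℝ]} (hv : v ≠ 0) (hc : c ≠ 0)
    (h : act A v = rmul v μ) (h' : act A (rmul v c) = rmul (rmul v c) ν) : ‖μ‖ = ‖ν‖ := by
  have e := congrArg norm (mul_eq_mul_of_eigen hv h h')
  rw [norm_mul, norm_mul, mul_comm] at e
  exact mul_left_cancel₀ (norm_ne_zero_iff.2 hc) e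

theorem IsAttracting.exists_eq_rmul {A : Sp11} {v v' : Vec} (h : IsAttracting A v)
    (h' : IsAttracting A v') : ∃ c, v' = rmul v c := by
  obtain ⟨hv, hv0, μ, hμ, e⟩ := h
  obtain ⟨-, -, μ', hμ', e'⟩ := h'
  refine eq_rmul_of_herm_eq_zero hv hv0 (not_not.1 fun hne => ?_)
  exact (mul_lt_one_of_nonneg_of_lt_one_left (norm_nonneg μ) hμ hμ'.le).ne
    (norm_mul_norm_of_eigen e' e hne)

theorem IsRepelling.exists_eq_rmul {A : Sp11} {v v' : Vec} (h : IsRepelling A v)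
    (h' : IsRepelling A v') : ∃ c, v' = rmul v c := by
  obtain ⟨hv, hv0, μ, hμ, e⟩ := h
  obtain ⟨-, -, μ', hμ', e'⟩ := h'
  refine eq_rmul_of_herm_eq_zero hv hv0 (not_not.1 fun hne => ?_)
  exact (one_lt_mul_of_lt_of_le hμ hμ'.le).ne' (norm_mul_norm_of_eigen e' e hne)

theorem IsRepelling.herm_ne_zero {A : Sp11} {v w : Vec} (hw : IsRepelling A w)
    (hv : IsAttracting A v) : herm w v ≠ 0 := by
  intro h
  obtain ⟨hv, hv0, μ, hμ, e⟩ := hv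
  obtain ⟨hw, -, ν, hν, e'⟩ := hw
  obtain ⟨c, rfl⟩ := eq_rmul_of_herm_eq_zero hv hv0 h
  exact (hμ.trans hν).ne (norm_eq_of_eigen hv (right_ne_zero_of_rmul hw) e e')

theorem exists_conj_eq_diag {A : Sp11} {v w : Vec} (hv : IsAttracting A v)
    (hw : IsRepelling A w) : ∃ (F : Sp11) (μ ν : ℍ[ℝ]), act F ![0, 1] = v ∧
      (F⁻¹ * A * F).val.val = !![ν, 0; 0, μ] ∧ ‖μ‖ < 1 ∧ 1 < ‖ν‖ := by
  obtain ⟨F, rfl, c, hc, h0⟩ := exists_frame hv.2.1 hw.2.1 (hw.herm_ne_zero hv)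
  obtain ⟨-, -, μ, hμ, e⟩ := hv
  obtain ⟨hw, -, ν, hν, e'⟩ := hw
  have e'' := act_rmul_of_eigen hc e'
  refine ⟨F, μ, c⁻¹ * ν * c, rfl, eq_of_mulVec_eq ?_ ?_, hμ, ?_⟩
  · change act (F⁻¹ * A * F) ![1, 0] = _
    rw [act_mul, act_mul, h0, e'', ← h0, act_rmul, act_inv_act, diag_mulVec]
    ext1 i
    fin_cases i <;> simp [rmul]
  · change act (F⁻¹ * A * F) ![0, 1] = _
    rw [act_mul, act_mul, e, act_rmul, act_inv_act, diag_mulVec]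
    ext1 i
    fin_cases i <;> simp [rmul]
  · rwa [← norm_eq_of_eigen hw hc e' e'']

theorem exists_imaginary_commute (μ : ℍ[ℝ]) : ∃ z : ℍ[ℝ], z ≠ 0 ∧ z.re = 0 ∧ Commute μ z := by
  by_cases h : μ.im = 0
  · refine ⟨⟨0, 1, 0, 0⟩, fun h0 => one_ne_zero (congrArg QuaternionAlgebra.imI h0), rfl, ?_⟩
    rw [← Quaternion.re_add_im μ, h, add_zero]
    exact Quaternion.coe_commutes _ _
  · refine ⟨μ.im, h, Quaternion.re_im μ, ?_⟩
    nth_rw 1 [← Quaternion.re_add_im μ]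
    exact (show Commute _ _ from Quaternion.coe_commutes _ _).add_left (Commute.refl _)

theorem mk_ne_mk {v w : Vec} (hv : v ≠ 0) (hw : w ≠ 0) (hw0 : herm w w = 0)
    (hvw : herm v w ≠ 0) :
    Projectivization.mk ℍ[ℝ]ᵐᵒᵖ v hv ≠ Projectivization.mk ℍ[ℝ]ᵐᵒᵖ w hw := fun h => by
  obtain ⟨c, rfl⟩ := (mk_eq_mk_iff hv hw).1 h
  exact hvw (by rw [herm_rmul_left, hw0, zero_mul])

theorem IsHyperbolic.eq_or_eq_or_eq {A : Sp11} (hA : IsHyperbolic A) {p q r : HP1}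
    (hp : p ∈ bdry ∧ move A p = p) (hq : q ∈ bdry ∧ move A q = q)
    (hr : r ∈ bdry ∧ move A r = r) : p = q ∨ r = p ∨ r = q := by
  obtain ⟨a, b, -, hS⟩ := ncard_eq_two.1 hA
  simp only [Set.ext_iff, mem_ofPred_eq, mem_insert_iff, mem_singleton_iff] at hS
  rcases (hS p).1 hp with rfl | rfl <;> rcases (hS q).1 hq with rfl | rfl <;>
    rcases (hS r).1 hr with rfl | rfl <;> tauto

theorem exists_null_eigen_of_eigen {A : Sp11} {p q : Vec} {μ : ℍ[ℝ]} (hp0 : herm p p = 0)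
    (hq0 : herm q q = 0) (hpq : herm p q = 1) (hp : act A p = rmul p μ)
    (hq : act A q = rmul q μ) :
    ∃ x, herm x x = 0 ∧ herm x p ≠ 0 ∧ herm x q ≠ 0 ∧ act A x = rmul x μ := by
  have hqp : herm q p = 1 := by rw [← star_herm, hpq, star_one]
  obtain ⟨z, hz, hz_re, hz_comm⟩ := exists_imaginary_commute μ
  have hxp : herm (rmul p z + q) p = 1 := by
    rw [herm_add_left, herm_rmul_left, hp0, zero_mul, zero_add, hqp]
  have hxq : herm (rmul p z + q) q = z := by
    rw [herm_add_left, herm_rmul_left, hq0, hpq, one_mul, add_zero]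
  refine ⟨rmul p z + q, ?_, hxp.trans_ne one_ne_zero, hxq.trans_ne hz, ?_⟩
  · rw [herm_add_right, herm_rmul_right, hxp, hxq, mul_one, Quaternion.star_eq_two_re_sub, hz_re,
      mul_zero, Quaternion.coe_zero, zero_sub, neg_add_cancel]
  · rw [act_add, act_rmul, hp, hq, rmul_rmul, hz_comm.eq]
    ext1 i
    simp [rmul, add_mul, mul_assoc]

theorem IsHyperbolic.norm_ne_one {A : Sp11} (hA : IsHyperbolic A) {p q : Vec} {μ ν : ℍ[ℝ]}
    (hp0 : herm p p = 0) (hq0 : herm q q = 0) (hpq : herm p q = 1) (hp : act A p = rmul p ν)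
    (hq : act A q = rmul q μ) : ‖μ‖ ≠ 1 := by
  intro hμ
  have hμ_star : star μ * μ = 1 := by
    rw [Quaternion.star_mul_self, Quaternion.normSq_eq_norm_mul_self, hμ, mul_one,
      Quaternion.coe_one]
  obtain rfl : ν = μ := by
    have h := star_mul_herm_mul_of_eigen hp hq
    rw [hpq, mul_one, ← hμ_star] at h
    exact mul_left_cancel₀ (left_ne_zero_of_mul_eq_one hμ_star) h
  obtain ⟨x, hx0, hxp, hxq, hx⟩ := exists_null_eigen_of_eigen hp0 hq0 hpq hp hq
  have ne_zero {u w : Vec} (h : herm u w ≠ 0) : u ≠ 0 := by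
    rintro rfl
    simp [herm] at h
  have hpq' : herm p q ≠ 0 := hpq ▸ one_ne_zero
  have hqp' : herm q p ≠ 0 := by
    rw [← star_herm, hpq, star_one]
    exact one_ne_zero
  rcases hA.eq_or_eq_or_eq
    ⟨(mk_mem_bdry (ne_zero hpq')).2 hp0, (move_mk_eq_iff A _).2 ⟨ν, hp⟩⟩
    ⟨(mk_mem_bdry (ne_zero hqp')).2 hq0, (move_mk_eq_iff A _).2 ⟨ν, hq⟩⟩
    ⟨(mk_mem_bdry (ne_zero hxp)).2 hx0, (move_mk_eq_iff A _).2 ⟨ν, hx⟩⟩ with h | h | h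
  exacts [mk_ne_mk _ _ hq0 hpq' h, mk_ne_mk _ _ hp0 hxp h, mk_ne_mk _ _ hq0 hxq h]

theorem IsHyperbolic.exists_attracting_repelling {A : Sp11} (hA : IsHyperbolic A) :
    ∃ v w, IsAttracting A v ∧ IsRepelling A w := by
  obtain ⟨P, Q, hPQ, hS⟩ := ncard_eq_two.1 hA
  have hP : P ∈ {p | p ∈ bdry ∧ move A p = p} := hS ▸ mem_insert P {Q}
  have hQ : Q ∈ {p | p ∈ bdry ∧ move A p = p} := hS ▸ mem_insert_of_mem P rfl
  induction P using Projectivization.ind with | _ v hv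
  induction Q using Projectivization.ind with | _ w hw
  obtain ⟨hv0, hμ⟩ := hP
  obtain ⟨hw0, hν⟩ := hQ
  rw [mk_mem_bdry] at hv0 hw0
  obtain ⟨μ, hμ⟩ := (move_mk_eq_iff A hv).1 hμ
  obtain ⟨ν, hν⟩ := (move_mk_eq_iff A hw).1 hν
  have hwv : herm w v ≠ 0 := fun h => by
    obtain ⟨c, hc⟩ := eq_rmul_of_herm_eq_zero hv hv0 h
    exact hPQ ((mk_eq_mk_iff hw hv).2 ⟨c, hc.symm⟩).symm
  have hμν := norm_mul_norm_of_eigen hν hμ hwv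
  have hμ1 : ‖μ‖ ≠ 1 := by
    refine hA.norm_ne_one (p := rmul w (herm w v)⁻¹) ?_ hv0 ?_
      (act_rmul_of_eigen (inv_ne_zero hwv) hν) hμ
    · rw [herm_rmul_left, herm_rmul_right, hw0, mul_zero, zero_mul]
    · rw [herm_rmul_left, mul_inv_cancel₀ hwv]
  rcases hμ1.lt_or_gt with hlt | hgt
  · refine ⟨v, w, ⟨hv, hv0, μ, hlt, hμ⟩, ⟨hw, hw0, ν, ?_, hν⟩⟩
    nlinarith [norm_nonneg μ, norm_nonneg ν]
  · refine ⟨w, v, ⟨hw, hw0, ν, ?_, hν⟩, ⟨hv, hv0, μ, hgt, hμ⟩⟩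
    nlinarith [norm_nonneg μ, norm_nonneg ν]

end SpOneOne

/-! ### The commutant of an irreducible pair -/

namespace SpOneOne

theorem IsTotallyGeodesic.image_move {S : Set HP1} (hS : IsTotallyGeodesic S) (F : Sp11) :
    IsTotallyGeodesic (move F '' S) := by
  refine ⟨image_move_hypSpace F ▸ image_mono hS.1, ?_⟩
  rintro x y z hx hy hz r a b hxS hyS hxy rfl hzh
  rw [mem_image_move, move_mk] at hxS hyS ⊢
  refine hS.2 _ _ _ _ _ _ r a b hxS hyS ((herm_act F⁻¹ x y).trans hxy) ?_ ?_
  · simp only [act, Matrix.mulVec_add, Matrix.mulVec_smul]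
  · rwa [mk_mem_hypSpace, herm_act, ← mk_mem_hypSpace hz]

theorem IsIrreduciblePair.conj {A B : Sp11} (h : IsIrreduciblePair A B) (F : Sp11) :
    IsIrreduciblePair (F⁻¹ * A * F) (F⁻¹ * B * F) := by
  have fixed {X : Sp11} {p : HP1} (hp : move (F⁻¹ * X * F) p = p) :
      move X (move F p) = move F p := by
    rwa [mul_assoc, move_mul, move_inv_eq_iff, move_mul] at hp
  have invariant {X : Sp11} {S : Set HP1} (hS : move (F⁻¹ * X * F) '' S = S) :
      move X '' (move F '' S) = move F '' S := by
    nth_rw 2 [← hS]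
    rw [← image_move_mul, ← image_move_mul, mul_assoc F⁻¹, mul_inv_cancel_left]
  refine ⟨fun ⟨p, hp, hA, hB⟩ => h.1 ⟨move F p, ?_, fixed hA, fixed hB⟩,
    fun ⟨S, hne, hS, hgeo, hA, hB⟩ => h.2 ⟨move F '' S, hne.image _, fun heq => hS ?_,
      hgeo.image_move F, invariant hA, invariant hB⟩⟩
  · rwa [mem_union, move_mem_hypSpace_iff, move_mem_bdry_iff]
  · exact (move_injective F).image_injective (heq.trans (image_move_hypSpace F).symm)

/-- The set of negative lines with a lift that satisfies the condition `C`. It produces the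
invariant totally geodesic subspaces that irreducibility excludes. -/
def cutOut (C : Vec → Prop) : Set HP1 :=
  {p | ∃ (v : Vec) (hv : v ≠ 0), p = Projectivization.mk ℍ[ℝ]ᵐᵒᵖ v hv ∧ (herm v v).re < 0 ∧ C v}

section CutOut

variable {C : Vec → Prop}

theorem mk_mem_cutOut (hC : ∀ v q, q ≠ 0 → C v → C (rmul v q)) {v : Vec} (hv : v ≠ 0) :
    Projectivization.mk ℍ[ℝ]ᵐᵒᵖ v hv ∈ cutOut C ↔ (herm v v).re < 0 ∧ C v := by
  refine ⟨?_, fun h => ⟨v, hv, rfl, h⟩⟩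
  rintro ⟨w, hw, h, hneg, hCw⟩
  refine ⟨by rwa [← mk_mem_hypSpace hv, h, mk_mem_hypSpace], ?_⟩
  obtain ⟨q, rfl⟩ := (mk_eq_mk_iff _ _).1 h
  exact hC _ _ (right_ne_zero_of_rmul hv) hCw

theorem image_move_cutOut {A : Sp11} (hC : ∀ v q, q ≠ 0 → C v → C (rmul v q))
    (hA : ∀ v, C (act A v) ↔ C v) : move A '' cutOut C = cutOut C := by
  ext p
  induction p using Projectivization.ind with | _ v hv
  rw [mem_image_move, move_mk, mk_mem_cutOut hC, mk_mem_cutOut hC, herm_act, ← hA, act_act_inv]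

theorem isTotallyGeodesic_cutOut (hC : ∀ v q, q ≠ 0 → C v → C (rmul v q))
    (hgeo : ∀ (x y : Vec) (r a b : ℝ), (herm x x).re < 0 → (herm y y).re < 0 → C x → C y →
      herm x y = (r : ℍ[ℝ]) → C (a • x + b • y)) : IsTotallyGeodesic (cutOut C) := by
  refine ⟨?_, ?_⟩
  · rintro _ ⟨v, hv, rfl, hneg, -⟩
    exact (mk_mem_hypSpace _).2 hneg
  · rintro x y z hx hy hz r a b hxS hyS hxy rfl hzh
    rw [mk_mem_cutOut hC] at hxS hyS ⊢
    exact ⟨(mk_mem_hypSpace _).1 hzh, hgeo x y r a b hxS.1 hyS.1 hxS.2 hyS.2 hxy⟩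

theorem IsIrreduciblePair.cond_of_cond {A B : Sp11} (h : IsIrreduciblePair A B)
    (hC : ∀ v q, q ≠ 0 → C v → C (rmul v q)) (hA : ∀ v, C (act A v) ↔ C v)
    (hB : ∀ v, C (act B v) ↔ C v)
    (hgeo : ∀ (x y : Vec) (r a b : ℝ), (herm x x).re < 0 → (herm y y).re < 0 → C x → C y →
      herm x y = (r : ℍ[ℝ]) → C (a • x + b • y))
    {x y : Vec} (hx : (herm x x).re < 0) (hCx : C x) (hy : (herm y y).re < 0) : C y := by
  have hy0 : y ≠ 0 := ne_zero_of_re_herm_self_ne_zero hy.ne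
  have hcut : cutOut C = hypSpace := not_not.1 fun hne => h.2
    ⟨cutOut C, ⟨_, x, ne_zero_of_re_herm_self_ne_zero hx.ne, rfl, hx, hCx⟩, hne,
      isTotallyGeodesic_cutOut hC hgeo, image_move_cutOut hC hA, image_move_cutOut hC hB⟩
  exact ((mk_mem_cutOut hC hy0).1 (hcut ▸ (mk_mem_hypSpace hy0).2 hy)).2

end CutOut

section SelfAdjoint

variable {s : Matrix (Fin 2) (Fin 2) ℍ[ℝ]}

theorem mulVec_act_of_commute {A : Sp11} (h : Commute s A.val.val) (v : Vec) :
    s *ᵥ act A v = act A (s *ᵥ v) := by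
  rw [act, act, Matrix.mulVec_mulVec, Matrix.mulVec_mulVec, h.eq]

theorem commute_adj {A : Sp11} (h : Commute s A.val.val) : Commute (adj s) A.val.val := by
  have e : A.val⁻¹.val * adj s = adj s * A.val⁻¹.val := by
    rw [← adj_coe, ← adj_mul, ← adj_mul, h.eq]
  exact (Units.commute_iff_inv_mul_cancel_assoc.2 (by
    rw [← mul_assoc, e, mul_assoc, Units.inv_mul, mul_one])).symm

theorem re_herm_mulVec_eq_zero (hs : adj s = s) {c : ℝ} (hc : c ≠ 0) (hsq : s * s = -(c • 1))
    {x y : Vec} (hx : herm x x ≠ 0) (hsx : herm (s *ᵥ x) x = 0) (hsy : herm (s *ᵥ y) y = 0)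
    {r : ℝ} (hr : r ≠ 0) (hxy : herm x y = (r : ℍ[ℝ])) : (herm y (s *ᵥ x)).re = 0 := by
  have sym (v w : Vec) : herm (s *ᵥ v) w = herm v (s *ᵥ w) := by rw [herm_mulVec_left, hs]
  have herm_sq (v : Vec) : herm (s *ᵥ v) (s *ᵥ x) = -(c • herm v x) := by
    rw [sym, Matrix.mulVec_mulVec, hsq, ← neg_smul, Matrix.smul_mulVec, Matrix.one_mulVec,
      herm_smul_right, neg_smul]
  have hyx : herm y x = (r : ℍ[ℝ]) := by rw [← star_herm, hxy, Quaternion.star_coe]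
  have he : herm (s *ᵥ x) (s *ᵥ x) ≠ 0 := herm_sq x ▸ neg_ne_zero.2 (smul_ne_zero hc hx)
  have key : herm (s *ᵥ y) y = 0 := hsy
  nth_rw 2 [eq_rmul_add_rmul_of_orthogonal hx he hsx y] at key
  rw [herm_add_right, herm_rmul_right, herm_rmul_right, herm_sq, herm_sq, hyx, sym y x,
    herm_self x] at key
  have hn : (herm x x).re ≠ 0 := fun h => hx (by rw [herm_self, h, Quaternion.coe_zero])
  generalize (herm x x).re = n at key hn
  generalize herm y (s *ᵥ x) = h at key ⊢
  have expand : star ((n : ℍ[ℝ])⁻¹ * r) * h + star ((-(c • (n : ℍ[ℝ])))⁻¹ * h) * -(c • (r : ℍ[ℝ])) =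
      (r / n) • (h + star h) := by
    rw [← Quaternion.coe_smul, ← Quaternion.coe_smul, ← Quaternion.coe_neg, ← Quaternion.coe_neg,
      ← Quaternion.coe_inv, ← Quaternion.coe_inv, ← Quaternion.coe_mul, Quaternion.star_coe,
      star_mul, Quaternion.star_coe, mul_assoc, ← Quaternion.coe_mul,
      Quaternion.coe_mul_eq_smul, Quaternion.mul_coe_eq_smul, smul_add, smul_eq_mul, smul_eq_mul]
    congr 2 <;> field_simp
  rw [expand, smul_eq_zero, or_iff_right (div_ne_zero hr hn), Quaternion.self_add_star',
    ← Quaternion.coe_zero, Quaternion.coe_inj] at key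
  linarith

theorem IsIrreduciblePair.herm_mulVec_self_eq_zero {A B : Sp11} (h : IsIrreduciblePair A B)
    (hs : adj s = s) (hA : Commute s A.val.val) (hB : Commute s B.val.val) {c : ℝ} (hc : c ≠ 0)
    (hsq : s * s = -(c • 1)) {x y : Vec} (hx : (herm x x).re < 0) (hsx : herm (s *ᵥ x) x = 0)
    (hy : (herm y y).re < 0) : herm (s *ᵥ y) y = 0 := by
  refine h.cond_of_cond (C := fun v => herm (s *ᵥ v) v = 0) (fun v q _ hv => ?_) (fun v => ?_)
    (fun v => ?_) (fun x y r a b hx hy hsx hsy hxy => ?_) hx hsx hy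
  · rw [mulVec_rmul, herm_rmul_left, herm_rmul_right, hv, mul_zero, zero_mul]
  · rw [mulVec_act_of_commute hA, herm_act]
  · rw [mulVec_act_of_commute hB, herm_act]
  · have hr : r ≠ 0 := by
      rintro rfl
      exact herm_ne_zero_of_neg hx hy (hxy.trans Quaternion.coe_zero)
    have hre := re_herm_mulVec_eq_zero hs hc hsq
      (fun h0 => hx.ne (by rw [h0, Quaternion.re_zero])) hsx hsy hr hxy
    have hsum : herm (s *ᵥ x) y + herm (s *ᵥ y) x = 0 := by
      rw [herm_mulVec_left s y, hs, ← star_herm, Quaternion.star_add_self', hre, mul_zero,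
        Quaternion.coe_zero]
    simp only [Matrix.mulVec_add, Matrix.mulVec_smul, herm_add_left, herm_add_right,
      herm_smul_left, herm_smul_right, hsx, hsy, smul_zero, add_zero, zero_add]
    rw [smul_comm, ← smul_add, ← smul_add, add_comm, hsum, smul_zero, smul_zero]

theorem IsIrreduciblePair.exists_mulVec_eq_rmul {A B : Sp11} (h : IsIrreduciblePair A B)
    (hs : adj s = -s) (hA : Commute s A.val.val) (hB : Commute s B.val.val)
    {x y : Vec} (hx : (herm x x).re < 0) (hsx : ∃ a, s *ᵥ x = rmul x a)
    (hy : (herm y y).re < 0) : ∃ a, s *ᵥ y = rmul y a := by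
  have eigenvalue_eq {x y : Vec} {a b : ℍ[ℝ]} {r : ℝ} (hr : r ≠ 0) (hxa : s *ᵥ x = rmul x a)
      (hyb : s *ᵥ y = rmul y b) (hxy : herm x y = (r : ℍ[ℝ])) : a = -star b := by
    have e : herm (s *ᵥ x) y = -herm x (s *ᵥ y) := by
      rw [herm_mulVec_left, hs, Matrix.neg_mulVec, ← neg_one_smul ℝ, herm_smul_right,
        neg_one_smul]
    rw [hxa, hyb, herm_rmul_left, herm_rmul_right, hxy, ← neg_mul,
      ← Quaternion.coe_commutes r (-star b)] at e
    exact mul_left_cancel₀ (fun h0 => hr (Quaternion.coe_injective h0)) e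
  have invariant {A : Sp11} (hA : Commute s A.val.val) (v : Vec) :
      (∃ a, s *ᵥ act A v = rmul (act A v) a) ↔ ∃ a, s *ᵥ v = rmul v a := by
    refine exists_congr fun a => ?_
    rw [mulVec_act_of_commute hA, ← act_rmul]
    exact (toLin_injective A).eq_iff
  refine h.cond_of_cond (C := fun v => ∃ a, s *ᵥ v = rmul v a) ?_ (invariant hA) (invariant hB)
    ?_ hx hsx hy
  · rintro v q hq ⟨a, ha⟩
    exact ⟨q⁻¹ * a * q, by rw [mulVec_rmul, ha, rmul_rmul, rmul_rmul, mul_assoc,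
      mul_inv_cancel_left₀ hq]⟩
  · rintro x y r t u hx hy ⟨a, ha⟩ ⟨b, hb⟩ hxy
    have hr : r ≠ 0 := by
      rintro rfl
      exact herm_ne_zero_of_neg hx hy (hxy.trans Quaternion.coe_zero)
    have hab : a = b :=
      (eigenvalue_eq hr ha hb hxy).trans (eigenvalue_eq hy.ne hb hb (herm_self y)).symm
    refine ⟨b, ?_⟩
    rw [Matrix.mulVec_add, Matrix.mulVec_smul, Matrix.mulVec_smul, ha, hb, hab]
    ext1 i
    simp [rmul, add_mul]

end SelfAdjoint

theorem exists_imaginary_mul_ne {p : ℍ[ℝ]} (hp : p.im ≠ 0) :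
    ∃ w : ℍ[ℝ], w.re = 0 ∧ p * w ≠ w * p := by
  by_contra! hcon
  simp only [Quaternion.ext_iff, Quaternion.re_mul, Quaternion.imI_mul, Quaternion.imJ_mul,
    Quaternion.imK_mul] at hcon
  obtain ⟨-, -, hiJ, hiK⟩ := hcon ⟨0, 1, 0, 0⟩ rfl
  obtain ⟨-, -, -, hjK⟩ := hcon ⟨0, 0, 1, 0⟩ rfl
  refine hp (Quaternion.ext p.im 0 ?_ ?_ ?_ ?_) <;> simp <;> linarith

theorem im_mul_im (p : ℍ[ℝ]) : p.im * p.im = -((Quaternion.normSq p.im : ℝ) : ℍ[ℝ]) := by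
  rw [← Quaternion.self_mul_star, Quaternion.star_im, mul_neg, neg_neg]

theorem eq_diag_of_commute_diag {m : Matrix (Fin 2) (Fin 2) ℍ[ℝ]} {μ ν : ℍ[ℝ]} (h : ‖μ‖ < ‖ν‖)
    (hm : Commute m !![ν, 0; 0, μ]) : m = !![m 0 0, 0; 0, m 1 1] := by
  have eq_zero {x a b : ℍ[ℝ]} (hab : ‖a‖ ≠ ‖b‖) (hx : x * a = b * x) : x = 0 := by
    by_contra hne
    have e := congrArg norm hx
    rw [norm_mul, norm_mul, mul_comm] at e
    exact hab (mul_right_cancel₀ (norm_ne_zero_iff.2 hne) e)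
  have e01 : m 0 1 * μ = ν * m 0 1 := by
    simpa [Matrix.mul_apply] using congrFun (congrFun hm.eq 0) 1
  have e10 : m 1 0 * ν = μ * m 1 0 := by
    simpa [Matrix.mul_apply] using congrFun (congrFun hm.eq 1) 0
  have h01 := eq_zero h.ne e01
  have h10 := eq_zero h.ne' e10
  ext1 i j
  fin_cases i <;> fin_cases j
  exacts [rfl, h01, h10, rfl]

section Diagonal

variable {A B : Sp11} {μ ν : ℍ[ℝ]} {z : Matrix (Fin 2) (Fin 2) ℍ[ℝ]}

theorem IsIrreduciblePair.im_eq_zero_of_commute_diag (hirr : IsIrreduciblePair A B) {q : ℍ[ℝ]}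
    (hA : Commute !![q.im, 0; 0, -q.im] A.val.val)
    (hB : Commute !![q.im, 0; 0, -q.im] B.val.val) : q.im = 0 := by
  by_contra hq
  have hadj : adj !![q.im, 0; 0, -q.im] = !![q.im, 0; 0, -q.im] := by
    rw [adj_diag, star_neg, Quaternion.star_im, neg_neg]
  have hsq : !![q.im, 0; 0, -q.im] * !![q.im, 0; 0, -q.im] =
      -(Quaternion.normSq q.im • (1 : Matrix (Fin 2) (Fin 2) ℍ[ℝ])) := by
    ext1 i j
    fin_cases i <;> fin_cases j <;>
      simp [Matrix.mul_apply, im_mul_im, ← Quaternion.coe_mul_eq_smul]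
  have h := hirr.herm_mulVec_self_eq_zero hadj hA hB (Quaternion.normSq_ne_zero.2 hq) hsq
    (x := ![-1, 1]) (y := ![-1 + q.im, 1]) (by simp [herm])
    (by simp [herm]) (by simp [herm])
  have expand : herm (!![q.im, 0; 0, -q.im] *ᵥ ![-1 + q.im, 1]) ![-1 + q.im, 1] =
      2 * (q.im * q.im) := by
    simp only [diag_mulVec, herm, Matrix.cons_val_zero, Matrix.cons_val_one, star_one, star_add,
      star_neg, Quaternion.star_im]
    noncomm_ring
  rw [expand, two_mul, ← two_smul ℝ] at h
  exact smul_ne_zero two_ne_zero (mul_ne_zero hq hq) h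

theorem IsIrreduciblePair.eq_smul_one_of_adj_eq (hirr : IsIrreduciblePair A B)
    (hdiag : A.val.val = !![ν, 0; 0, μ]) (hμν : ‖μ‖ < ‖ν‖) (hz : adj z = z)
    (hA : Commute z A.val.val) (hB : Commute z B.val.val) : ∃ r : ℝ, z = r • 1 := by
  obtain ⟨p, t, rfl⟩ : ∃ p t, z = !![p, 0; 0, t] :=
    ⟨_, _, eq_diag_of_commute_diag hμν (hdiag ▸ hA)⟩
  obtain rfl : star p = t := by
    simpa using congrFun (congrFun ((adj_diag p t).symm.trans hz) 1) 1
  have hsub : !![p, 0; 0, star p] - p.re • (1 : Matrix (Fin 2) (Fin 2) ℍ[ℝ]) =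
      !![p.im, 0; 0, -p.im] := by
    have him : p - p.re • 1 = p.im := by
      rw [← Quaternion.coe_mul_eq_smul, mul_one, Quaternion.sub_re_self]
    have him' : star p - p.re • 1 = -p.im := by
      rw [← Quaternion.star_im, ← him, star_sub, ← Quaternion.coe_mul_eq_smul, mul_one,
        Quaternion.star_coe]
    ext1 i j
    fin_cases i <;> fin_cases j <;> simp [him, him']
  have hp : p.im = 0 := hirr.im_eq_zero_of_commute_diag
    (hsub ▸ hA.sub_left ((Commute.one_left _).smul_left _))
    (hsub ▸ hB.sub_left ((Commute.one_left _).smul_left _))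
  refine ⟨p.re, sub_eq_zero.1 (hsub.trans ?_)⟩
  ext1 i j
  fin_cases i <;> fin_cases j <;> simp [hp]

theorem IsIrreduciblePair.not_commute_diag_coe (hirr : IsIrreduciblePair A B)
    (hdiag : A.val.val = !![ν, 0; 0, μ]) {r : ℝ} (hr : r ≠ 0) :
    ¬ Commute !![(r : ℍ[ℝ]), 0; 0, -(r : ℍ[ℝ])] B.val.val := by
  intro hB
  have h01 : (r : ℍ[ℝ]) * B.val.val 0 1 = B.val.val 0 1 * -(r : ℍ[ℝ]) := by
    simpa [Matrix.mul_apply] using congrFun (congrFun hB.eq 0) 1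
  have hB01 : B.val.val 0 1 = 0 := by
    rw [mul_neg, Quaternion.mul_coe_eq_smul, Quaternion.coe_mul_eq_smul, eq_neg_iff_add_eq_zero,
      ← smul_add, ← two_smul ℝ, smul_smul] at h01
    exact (smul_eq_zero.1 h01).resolve_left (mul_ne_zero hr two_ne_zero)
  have h0 : (![0, 1] : Vec) ≠ 0 := fun h => one_ne_zero (congrFun h 1)
  refine hirr.1 ⟨Projectivization.mk ℍ[ℝ]ᵐᵒᵖ ![0, 1] h0, Or.inr ((mk_mem_bdry h0).2 ?_),
    (move_mk_eq_iff A h0).2 ⟨μ, ?_⟩, (move_mk_eq_iff B h0).2 ⟨B.val.val 1 1, ?_⟩⟩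
  · simp [herm]
  · rw [act, hdiag, diag_mulVec]
    ext1 i
    fin_cases i <;> simp [rmul]
  · ext1 i
    fin_cases i <;> simp [act, Matrix.mulVec, dotProduct, rmul, hB01]

theorem IsIrreduciblePair.not_commute_diag_imaginary (hirr : IsIrreduciblePair A B) {p : ℍ[ℝ]}
    (hp : p.re = 0) (hp' : p.im ≠ 0) (hA : Commute !![p, 0; 0, p] A.val.val) :
    ¬ Commute !![p, 0; 0, p] B.val.val := by
  intro hB
  have hstar : star p = -p := by ext <;> simp [hp]
  obtain ⟨w, hw, hpw⟩ := exists_imaginary_mul_ne hp'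
  have hadj : adj !![p, 0; 0, p] = -!![p, 0; 0, p] := by
    rw [adj_diag, hstar]
    ext1 i j
    fin_cases i <;> fin_cases j <;> simp
  obtain ⟨a, ha⟩ := hirr.exists_mulVec_eq_rmul hadj hA hB (x := ![-1, 1]) (y := ![-1 + w, 1])
    (by simp [herm]) ⟨p, by rw [diag_mulVec]; ext1 i; fin_cases i <;> simp [rmul]⟩
    (by simp [herm, hw])
  rw [diag_mulVec] at ha
  obtain rfl : p = a := by simpa [rmul] using congrFun ha 1
  have h0 : p * (-1 + w) = (-1 + w) * p := by simpa [rmul] using congrFun ha 0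
  exact hpw (by simpa [mul_add, add_mul] using h0)

theorem IsIrreduciblePair.eq_zero_of_adj_eq_neg (hirr : IsIrreduciblePair A B)
    (hdiag : A.val.val = !![ν, 0; 0, μ]) (hμν : ‖μ‖ < ‖ν‖) (hz : adj z = -z)
    (hA : Commute z A.val.val) (hB : Commute z B.val.val) : z = 0 := by
  obtain ⟨r, hr⟩ := hirr.eq_smul_one_of_adj_eq hdiag hμν (z := z * z)
    (by rw [adj_mul, hz, neg_mul_neg]) (hA.mul_left hA) (hB.mul_left hB)
  obtain ⟨p, t, rfl⟩ : ∃ p t, z = !![p, 0; 0, t] :=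
    ⟨_, _, eq_diag_of_commute_diag hμν (hdiag ▸ hA)⟩
  obtain rfl : t = -star p := by
    have h := congrFun (congrFun ((adj_diag p t).symm.trans hz) 1) 1
    exact (neg_eq_iff_eq_neg.2 (by simpa using h)).symm
  have hpp : p * p = r := by
    rw [← mul_one (r : ℍ[ℝ]), Quaternion.coe_mul_eq_smul]
    simpa [Matrix.mul_apply] using congrFun (congrFun hr 0) 0
  by_cases him : p.im = 0
  · have hpre : p = (p.re : ℍ[ℝ]) := by
      nth_rw 1 [← Quaternion.re_add_im p, him, add_zero]
    generalize p.re = s at hpre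
    subst hpre
    rw [Quaternion.star_coe] at hB ⊢
    obtain rfl : s = 0 := not_not.1 fun hs => hirr.not_commute_diag_coe hdiag hs hB
    ext1 i j
    fin_cases i <;> fin_cases j <;> simp
  · have hre : p.re = 0 := by
      have h : (2 * p.re) • p.im = (p * p).im := by ext <;> simp <;> ring
      rw [hpp, Quaternion.im_coe, smul_eq_zero] at h
      linarith [h.resolve_right him]
    have hstar : -star p = p := by ext <;> simp [hre]
    rw [hstar] at hA hB
    exact (hirr.not_commute_diag_imaginary hre him hA hB).elim

end Diagonal

theorem IsIrreduciblePair.eq_smul_one_of_commute_diag {A B : Sp11} {μ ν : ℍ[ℝ]}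
    {z : Matrix (Fin 2) (Fin 2) ℍ[ℝ]} (hirr : IsIrreduciblePair A B)
    (hdiag : A.val.val = !![ν, 0; 0, μ]) (hμν : ‖μ‖ < ‖ν‖) (hA : Commute z A.val.val)
    (hB : Commute z B.val.val) : ∃ r : ℝ, z = r • 1 := by
  have hA' := commute_adj hA
  have hB' := commute_adj hB
  obtain ⟨r, hr⟩ := hirr.eq_smul_one_of_adj_eq hdiag hμν (z := z + adj z)
    (by rw [adj_add, adj_adj, add_comm]) (hA.add_left hA') (hB.add_left hB')
  have h0 := hirr.eq_zero_of_adj_eq_neg hdiag hμν (z := z - adj z)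
    (by rw [adj_sub, adj_adj, neg_sub]) (hA.sub_left hA') (hB.sub_left hB')
  refine ⟨r / 2, ?_⟩
  rw [← sub_eq_zero.1 h0, ← two_smul ℝ] at hr
  rw [div_eq_inv_mul, mul_smul, ← hr, smul_smul, inv_mul_cancel₀ two_ne_zero, one_smul]

theorem IsIrreduciblePair.eq_smul_one_of_commute {A B : Sp11} {z : Matrix (Fin 2) (Fin 2) ℍ[ℝ]}
    (hirr : IsIrreduciblePair A B) (hhyp : IsHyperbolic A) (hA : Commute z A.val.val)
    (hB : Commute z B.val.val) : ∃ r : ℝ, z = r • 1 := by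
  obtain ⟨v, w, hv, hw⟩ := hhyp.exists_attracting_repelling
  obtain ⟨F, μ, ν, -, hdiag, hμ, hν⟩ := exists_conj_eq_diag hv hw
  have conj_commute {X : Sp11} (hX : Commute z X.val.val) :
      Commute (F.val⁻¹.val * z * F.val.val) (F⁻¹ * X * F).val.val := by
    have h := congrArg (fun m => F.val⁻¹.val * m * F.val.val) hX.eq
    simpa [Commute, SemiconjBy, mul_assoc] using h
  obtain ⟨r, hr⟩ := (hirr.conj F).eq_smul_one_of_commute_diag hdiag (hμ.trans hν)
    (conj_commute hA) (conj_commute hB)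
  refine ⟨r, ?_⟩
  have h := congrArg (fun m => F.val.val * m * F.val⁻¹.val) hr
  simpa [mul_assoc] using h

end SpOneOne

/-! ### `Sp(1,1)` as a unitary group -/

namespace SpOneOne

section Trace

variable {ι : Type*} [Fintype ι] {m n : Matrix ι ι ℍ[ℝ]}

theorem re_sum (f : ι → ℍ[ℝ]) : (∑ i, f i).re = ∑ i, (f i).re :=
  map_sum (QuaternionAlgebra.reₗ _ _ _) f _

theorem re_mul_comm (p q : ℍ[ℝ]) : (p * q).re = (q * p).re := by
  simp only [Quaternion.re_mul]
  ring

theorem re_trace_mul_comm (m n : Matrix ι ι ℍ[ℝ]) : (m * n).trace.re = (n * m).trace.re := by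
  simp only [Matrix.trace, Matrix.diag_apply, Matrix.mul_apply, re_sum]
  rw [Finset.sum_comm]
  exact Finset.sum_congr rfl fun i _ => Finset.sum_congr rfl fun j _ => re_mul_comm _ _

theorem eq_zero_of_re_trace_mul (h : ∀ n, (m * n).trace.re = 0) : m = 0 := by
  have hsum : ∑ i, ∑ j, Quaternion.normSq (m i j) = 0 := by
    simpa [Matrix.trace, Matrix.mul_apply, Quaternion.self_mul_star, re_sum] using h mᴴ
  ext1 i j
  refine Quaternion.normSq_eq_zero.1 ?_
  have hi := (Finset.sum_eq_zero_iff_of_nonneg fun i _ =>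
    Finset.sum_nonneg fun j _ => Quaternion.normSq_nonneg).1 hsum i (Finset.mem_univ _)
  exact (Finset.sum_eq_zero_iff_of_nonneg fun j _ => Quaternion.normSq_nonneg).1 hi j
    (Finset.mem_univ _)

end Trace

theorem re_trace_adj (m : Matrix (Fin 2) (Fin 2) ℍ[ℝ]) : (adj m).trace.re = m.trace.re := by
  simp [adj, Matrix.trace_fin_two, add_comm]

theorem adj_eq_neg_iff {m : Matrix (Fin 2) (Fin 2) ℍ[ℝ]} : adj m = -m ↔
    (m 0 1).re = 0 ∧ (m 1 0).re = 0 ∧ m 1 1 = -star (m 0 0) := by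
  rw [← Matrix.ext_iff]
  simp only [adj, Fin.forall_fin_two, Matrix.neg_apply, Matrix.of_apply, Matrix.cons_val_zero,
    Matrix.cons_val_one, Quaternion.star_eq_neg]
  constructor
  · rintro ⟨⟨-, h01⟩, h10, h11⟩
    exact ⟨h01, h10, by rw [h11, neg_neg]⟩
  · rintro ⟨h01, h10, h11⟩
    exact ⟨⟨by simp [h11], h01⟩, h10, by rw [h11, neg_neg]⟩

attribute [local instance] Matrix.linftyOpNormedRing Matrix.linftyOpNormedAlgebra

/-- The algebra of quaternionic `2 × 2` matrices with the adjoint of the Hermitian form of signature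
`(1,1)` as its star. It is a type synonym because matrices already carry the conjugate transpose. -/
def FormMatrix : Type := Matrix (Fin 2) (Fin 2) ℍ[ℝ]

noncomputable instance : NormedRing FormMatrix :=
  inferInstanceAs (NormedRing (Matrix (Fin 2) (Fin 2) ℍ[ℝ]))

noncomputable instance : NormedAlgebra ℝ FormMatrix :=
  inferInstanceAs (NormedAlgebra ℝ (Matrix (Fin 2) (Fin 2) ℍ[ℝ]))

instance : FiniteDimensional ℝ FormMatrix :=
  inferInstanceAs (FiniteDimensional ℝ (Matrix (Fin 2) (Fin 2) ℍ[ℝ]))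

instance : CompleteSpace FormMatrix := FiniteDimensional.complete ℝ _

instance : StarRing FormMatrix where
  star := adj
  star_involutive := adj_adj
  star_mul := adj_mul
  star_add := adj_add

instance : StarModule ℝ FormMatrix where
  star_smul := adj_smul

instance : ContinuousStar FormMatrix where
  continuous_star :=
    (starLinearEquiv ℝ (A := FormMatrix)).toLinearMap.continuous_of_finiteDimensional

/-- `Sp(1,1)` is the unitary group of the algebra with involution `FormMatrix`. -/
noncomputable def unitaryEquiv : Sp11 ≃ₜ* unitary FormMatrix where
  toFun A := ⟨A.val.val, adj_mul_self A, by
    exact mul_eq_one_comm (M := Matrix (Fin 2) (Fin 2) ℍ[ℝ]).1 (adj_mul_self A)⟩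
  invFun u := ofAdjMulSelf u.1 u.2.1 u.2.2
  left_inv _ := Subtype.ext (Units.ext rfl)
  right_inv _ := rfl
  map_mul' _ _ := rfl
  continuous_toFun := (Units.continuous_val.comp continuous_subtype_val).subtype_mk _
  continuous_invFun := Continuous.subtype_mk (Units.continuous_iff.2
    ⟨continuous_subtype_val, (continuous_star (R := FormMatrix)).comp continuous_subtype_val⟩) _

/-- The real part of the trace. -/
noncomputable def reTrace : FormMatrix →ₗ[ℝ] ℝ :=
  (QuaternionAlgebra.reₗ (-1 : ℝ) 0 (-1)).comp (Matrix.traceLinearMap (Fin 2) ℝ ℍ[ℝ])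

theorem isStarTrace_reTrace : UnitarySlice.IsStarTrace reTrace where
  mul_comm := re_trace_mul_comm
  star := re_trace_adj
  nondegenerate := eq_zero_of_re_trace_mul

/-- The imaginary quaternion with given coordinates. -/
def imag (x : Fin 3 → ℝ) : ℍ[ℝ] := ⟨0, x 0, x 1, x 2⟩

/-- Coordinates on the Lie algebra of `Sp(1,1)`. -/
noncomputable def lieAlgEquiv :
    UnitarySlice.LieAlg FormMatrix ≃ₗ[ℝ] ℍ[ℝ] × (Fin 3 → ℝ) × (Fin 3 → ℝ) where
  toFun m := (m.1 0 0, ![(m.1 0 1).imI, (m.1 0 1).imJ, (m.1 0 1).imK],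
    ![(m.1 1 0).imI, (m.1 1 0).imJ, (m.1 1 0).imK])
  map_add' m n := by
    refine Prod.ext rfl (Prod.ext ?_ ?_) <;> ext i <;> fin_cases i <;> rfl
  map_smul' r m := by
    refine Prod.ext rfl (Prod.ext ?_ ?_) <;> ext i <;> fin_cases i <;> rfl
  invFun x := ⟨(!![x.1, imag x.2.1; imag x.2.2, -star x.1] : Matrix (Fin 2) (Fin 2) ℍ[ℝ]),
    adj_eq_neg_iff.2 ⟨rfl, rfl, rfl⟩⟩
  left_inv m := by
    obtain ⟨h01, h10, h11⟩ := adj_eq_neg_iff.1 m.2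
    refine Subtype.ext (Matrix.ext fun i j => ?_)
    fin_cases i <;> fin_cases j
    exacts [rfl, Quaternion.ext _ _ h01.symm rfl rfl rfl, Quaternion.ext _ _ h10.symm rfl rfl rfl,
      h11.symm]
  right_inv x := by
    refine Prod.ext rfl (Prod.ext ?_ ?_) <;> ext i <;> fin_cases i <;> rfl

theorem finrank_lieAlg : Module.finrank ℝ (UnitarySlice.LieAlg FormMatrix) = 10 := by
  rw [lieAlgEquiv.finrank_eq, Module.finrank_prod, Module.finrank_prod,
    Quaternion.finrank_eq_four, Module.finrank_fin_fun]

end SpOneOne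

/-! ### Representations of surface groups -/

namespace SpOneOne

theorem IsLoxodromic.inv {A : Sp11} (h : IsLoxodromic A) : IsLoxodromic A⁻¹ := by
  refine ⟨?_, ?_⟩
  · have hfix (p : HP1) : move A⁻¹ p = p ↔ move A p = p := move_inv_eq_iff.trans eq_comm
    simpa only [IsHyperbolic, hfix] using h.1
  · rintro _ ⟨v, hv, e⟩ r rfl
    have hr : r ≠ 0 := by
      rintro rfl
      exact act_ne_zero A⁻¹ hv (by rw [e, rmul_coe, zero_smul])
    have hv' : v = rmul (act A v) (r : ℍ[ℝ]) := by rw [← act_rmul, ← e, act_act_inv]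
    refine h.2 ((r⁻¹ : ℝ) : ℍ[ℝ]) ⟨v, hv, ?_⟩ r⁻¹ rfl
    conv_rhs => rw [hv', rmul_rmul, ← Quaternion.coe_mul, mul_inv_cancel₀ hr, Quaternion.coe_one,
      rmul_one]

theorem IsHyperbolic.conj {A : Sp11} (h : IsHyperbolic A) (k : Sp11) :
    IsHyperbolic (k * A * k⁻¹) := by
  have hfix : {p | p ∈ bdry ∧ move (k * A * k⁻¹) p = p} =
      move k '' {p | p ∈ bdry ∧ move A p = p} := by
    ext p
    rw [mem_image_move, mem_ofPred_eq, mem_ofPred_eq, move_mem_bdry_iff, mul_assoc, move_mul,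
      move_mul, eq_comm, ← move_inv_eq_iff, eq_comm]
  rw [IsHyperbolic, hfix, ncard_image_of_injective _ (move_injective k)]
  exact h

theorem IsLoxodromic.conj {A : Sp11} (h : IsLoxodromic A) (k : Sp11) :
    IsLoxodromic (k * A * k⁻¹) := by
  refine ⟨h.1.conj k, ?_⟩
  rintro μ ⟨v, hv, e⟩ r hr
  rw [act_mul, act_mul] at e
  exact h.2 μ ⟨act k⁻¹ v, act_ne_zero _ hv, by rw [← act_inv_act k (act A _), e, act_rmul]⟩ r hr

theorem IsLoxodromic.inv_conj {A : Sp11} (h : IsLoxodromic A) (k : Sp11) :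
    IsLoxodromic (k⁻¹ * A * k) := by
  simpa only [inv_inv] using h.conj k⁻¹

section Presentation

variable {g : ℕ} (P : CurveSystem g)

theorem CurveSystem.bdryLoop_mul (v : Fin (2 * g - 2)) :
    P.bdryLoop (v, 0) * P.bdryLoop (v, 1) * P.bdryLoop (v, 2) = 1 :=
  PresentedGroup.one_of_mem (rels := P.rels) (Or.inl (Or.inl ⟨v, rfl⟩))

theorem CurveSystem.crossing_mul (j : Fin (3 * g - 3)) :
    P.crossing j * P.bdryLoop (P.sides (j, true)) * (P.crossing j)⁻¹ *
      P.bdryLoop (P.sides (j, false)) = 1 :=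
  PresentedGroup.one_of_mem (rels := P.rels) (Or.inl (Or.inr ⟨j, rfl⟩))

variable {P}

theorem CurveSystem.crossing_eq_one {j : Fin (3 * g - 3)} (hj : j ∈ P.tree) : P.crossing j = 1 :=
  PresentedGroup.one_of_mem (rels := P.rels) (Or.inr ⟨j, hj, rfl⟩)

theorem map_crossing_conj {G : Type*} [Group G] (σ : P.Grp →* G) (j : Fin (3 * g - 3)) :
    σ (P.crossing j) * σ (P.bdryLoop (P.sides (j, true))) * (σ (P.crossing j))⁻¹ =
      (σ (P.bdryLoop (P.sides (j, false))))⁻¹ :=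
  eq_inv_of_mul_eq_one_left (by
    simp only [← map_mul, ← map_inv, P.crossing_mul, map_one])

/-- The conditions of `IsGeometric` on the images of the curves and of the three-holed spheres,
without discreteness and faithfulness. -/
def IsNondegenerate (σ : P.Grp →* Sp11) : Prop :=
  (∀ j, IsLoxodromic (σ (P.bdryLoop (P.sides (j, false))))) ∧
    ∀ v, IsIrreduciblePair (σ (P.bdryLoop (v, 0))) (σ (P.bdryLoop (v, 1)))

theorem IsNondegenerate.isLoxodromic {σ : P.Grp →* Sp11} (h : IsNondegenerate σ)
    (x : Fin (2 * g - 2) × Fin 3) : IsLoxodromic (σ (P.bdryLoop x)) := by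
  obtain ⟨⟨j, b⟩, rfl⟩ := P.sides.surjective x
  cases b
  case false => exact h.1 j
  case true =>
    have hconj := (h.1 j).inv.inv_conj (σ (P.crossing j))
    rwa [← map_crossing_conj, ← mul_assoc, ← mul_assoc, inv_mul_cancel, one_mul,
      inv_mul_cancel_right] at hconj

end Presentation

section DeformationSpace

variable {g : ℕ}

theorem repClass_eq_iff {Γ : Type} [Group Γ] {ρ ρ' : Γ →* Sp11} :
    repClass ρ = repClass ρ' ↔ ∃ h : Sp11, ∀ x, ρ' x = h * ρ x * h⁻¹ := Quotient.eq

/-- The values of a representation on the standard generators, as points of a unitary group. -/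
noncomputable def genValues (ρ : RepSpace (SurfaceGroup g)) (i : Fin g × Bool) :
    unitary FormMatrix :=
  unitaryEquiv ((show SurfaceGroup g →* Sp11 from ρ) (PresentedGroup.of i))

theorem unitaryEquiv_map_mk (ρ : SurfaceGroup g →* Sp11) (w : FreeGroup (Fin g × Bool)) :
    unitaryEquiv (ρ (PresentedGroup.mk _ w)) = FreeGroup.lift (genValues ρ) w := by
  have hhom : (unitaryEquiv.toMonoidHom.comp ρ).comp (PresentedGroup.mk _) =
      FreeGroup.lift (genValues ρ) :=
    FreeGroup.ext_hom _ _ fun i => by rw [FreeGroup.lift_apply_of]; rfl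
  exact DFunLike.congr_fun hhom w

theorem isInducing_genValues : IsInducing (genValues (g := g)) := by
  have hcont : Continuous (genValues (g := g)) := continuous_pi fun i =>
    unitaryEquiv.continuous.comp
      ((continuous_apply (PresentedGroup.of i)).comp continuous_induced_dom)
  refine ⟨le_antisymm hcont.le_induced (continuous_iff_le_induced.1 ?_)⟩
  let _ := TopologicalSpace.induced (genValues (g := g)) inferInstance
  refine continuous_pi fun x => ?_
  obtain ⟨w, rfl⟩ := PresentedGroup.mk_surjective _ x
  have heval : (fun ρ : SurfaceGroup g →* Sp11 => ρ (PresentedGroup.mk _ w)) =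
      fun ρ => unitaryEquiv.symm (FreeGroup.lift (genValues ρ) w) :=
    funext fun ρ => by rw [← unitaryEquiv_map_mk, ContinuousMulEquiv.symm_apply_apply]
  exact heval ▸ unitaryEquiv.symm.continuous.comp
    ((continuous_freeGroup_lift w).comp continuous_induced_dom)

theorem range_genValues :
    range (genValues (g := g)) = {a | FreeGroup.lift a (surfaceRelator g) = 1} := by
  ext a
  constructor
  · rintro ⟨ρ, rfl⟩
    change SurfaceGroup g →* Sp11 at ρ
    have hrel : PresentedGroup.mk _ (surfaceRelator g) = (1 : SurfaceGroup g) :=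
      PresentedGroup.one_of_mem rfl
    exact (unitaryEquiv_map_mk ρ _).symm.trans (by rw [hrel, map_one, map_one])
  · intro ha
    refine ⟨unitaryEquiv.symm.toMonoidHom.comp (PresentedGroup.toGroup (f := a) ?_), ?_⟩
    · rintro r rfl
      exact ha
    · funext i
      exact (unitaryEquiv.apply_symm_apply _).trans (PresentedGroup.toGroup.of _)

theorem repClass_eq_iff_genValues {ρ ρ' : SurfaceGroup g →* Sp11} :
    repClass ρ = repClass ρ' ↔
      ∃ k : ConjAct (unitary FormMatrix), k • genValues ρ = genValues ρ' := by
  have hconj (h : Sp11) : (∀ x, ρ' x = h * ρ x * h⁻¹) ↔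
      ConjAct.toConjAct (unitaryEquiv h) • genValues ρ = genValues ρ' := by
    constructor
    · refine fun H => funext fun i => ?_
      simp only [genValues, H, Pi.smul_apply, ConjAct.toConjAct_smul, map_mul, map_inv]
    · intro H
      have hhom : ρ' = (MulAut.conj h).toMonoidHom.comp ρ := PresentedGroup.ext fun i =>
        unitaryEquiv.injective (by
          simpa [genValues, ConjAct.toConjAct_smul] using (congrFun H i).symm)
      exact fun x => by rw [hhom]; rfl
  rw [repClass_eq_iff, exists_congr hconj]
  exact ((ConjAct.toConjAct.surjective.comp unitaryEquiv.surjective).exists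
    (p := fun k => k • genValues ρ = genValues ρ')).symm

theorem commute_of_commute_genValues {ρ : SurfaceGroup g →* Sp11} {z : FormMatrix}
    (hz : ∀ i, Commute z (genValues ρ i)) (x : SurfaceGroup g) :
    Commute z (unitaryEquiv (ρ x)) := by
  have hx : x ∈ Subgroup.closure (range PresentedGroup.of) := by
    rw [PresentedGroup.closure_range_of]
    trivial
  induction hx using Subgroup.closure_induction with
  | mem x hx =>
    obtain ⟨i, rfl⟩ := hx
    exact hz i
  | one => simp
  | mul x y _ _ hx hy => simpa using hx.mul_right hy
  | inv x _ hx =>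
    rw [map_inv, map_inv]
    exact Commute.units_inv_right (u := Unitary.toUnits (unitaryEquiv (ρ x))) hx

theorem centralizer_range_genValues {ρ : SurfaceGroup g →* Sp11} {x y : SurfaceGroup g}
    (hirr : IsIrreduciblePair (ρ x) (ρ y)) (hhyp : IsHyperbolic (ρ x)) :
    Subalgebra.centralizer ℝ (range fun i => (genValues ρ i : FormMatrix)) = ⊥ := by
  refine eq_bot_iff.2 fun z hz => ?_
  have hcomm (i) : Commute z (genValues ρ i) :=
    ((Subalgebra.mem_centralizer_iff ℝ).1 hz _ ⟨i, rfl⟩).symm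
  obtain ⟨r, rfl⟩ := hirr.eq_smul_one_of_commute hhyp (commute_of_commute_genValues hcomm x)
    (commute_of_commute_genValues hcomm y)
  exact Algebra.mem_bot.2 ⟨r, Algebra.algebraMap_eq_smul_one (A := FormMatrix) r⟩

theorem exists_chart_deformationSpace (hg : 0 < g) {ρ : SurfaceGroup g →* Sp11}
    {x y : SurfaceGroup g} (hirr : IsIrreduciblePair (ρ x) (ρ y)) (hhyp : IsHyperbolic (ρ x)) :
    ∃ e : OpenPartialHomeomorph (DeformationSpace (SurfaceGroup g))
      (EuclideanSpace ℝ (Fin (20 * g - 20))), repClass ρ ∈ e.source :=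
  UnitarySlice.exists_chart_orbitSpace isStarTrace_reTrace isInducing_genValues range_genValues
    (q := fun ρ : RepSpace (SurfaceGroup g) => repClass ρ) isQuotientMap_quotient_mk'
    (fun _ _ => repClass_eq_iff_genValues) (centralizer_range_genValues hirr hhyp)
    (by rw [finrank_lieAlg]; omega)

end DeformationSpace

end SpOneOne

/-! ### Quaternions and complex numbers -/

namespace SpOneOne

theorem exists_mul_eq_mul_I {z : ℍ[ℝ]} (hz : z.re = 0) :
    ∃ q : ℍ[ℝ], q ≠ 0 ∧ z * q = q * (‖z‖ • ((Complex.I : ℂ) : ℍ[ℝ])) := by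
  set i : ℍ[ℝ] := ((Complex.I : ℂ) : ℍ[ℝ]) with hi
  have hii : i * i = -1 := by ext <;> simp [hi]
  have hzz : z * z = ((-(‖z‖ * ‖z‖) : ℝ) : ℍ[ℝ]) := by
    rw [← sq, Quaternion.sq_eq_neg_normSq.2 hz, Quaternion.normSq_eq_norm_mul_self,
      Quaternion.coe_neg]
  -- `‖z‖ - z i` intertwines `z` with `‖z‖ i`; it vanishes only for `z = -‖z‖ i`, where `j` does.
  by_cases h : (‖z‖ : ℍ[ℝ]) - z * i = 0
  · obtain ⟨j, h0, hI, hJ, hK⟩ : ∃ j : ℍ[ℝ], j.re = 0 ∧ j.imI = 0 ∧ j.imJ = 1 ∧ j.imK = 0 :=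
      ⟨⟨0, 0, 1, 0⟩, rfl, rfl, rfl, rfl⟩
    have hj : j ≠ 0 := fun h => by simp [h] at hJ
    have hji : i * j = -(j * i) := by ext <;> simp [hi, h0, hI, hJ, hK]
    have hz_eq : z = -(‖z‖ • i) := by
      rw [← Quaternion.coe_mul_eq_smul, sub_eq_zero.1 h, mul_assoc, hii, mul_neg_one, neg_neg]
    refine ⟨j, hj, ?_⟩
    nth_rw 1 [hz_eq]
    rw [neg_mul, smul_mul_assoc, hji, mul_smul_comm, smul_neg, neg_neg]
  · refine ⟨_, h, ?_⟩
    rw [mul_sub, ← mul_assoc, hzz, sub_mul, mul_smul_comm, mul_smul_comm, mul_assoc z, hii,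
      Quaternion.mul_coe_eq_smul, Quaternion.coe_mul_eq_smul, Quaternion.coe_mul_eq_smul,
      smul_smul, mul_neg_one, smul_neg, neg_smul, sub_neg_eq_add, sub_neg_eq_add, add_comm]

theorem exists_mul_eq_mul_coe {μ : ℍ[ℝ]} (hμ : ∀ r : ℝ, μ ≠ (r : ℍ[ℝ])) :
    ∃ (q : ℍ[ℝ]ˣ) (l : ℂ), 0 < l.im ∧ μ * q = q * (l : ℍ[ℝ]) := by
  have him : μ.im ≠ 0 := fun h => hμ μ.re (by rw [← Quaternion.re_add_im μ, h]; simp)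
  obtain ⟨q, hq, hμq⟩ := exists_mul_eq_mul_I (Quaternion.re_im μ)
  refine ⟨Units.mk0 q hq, ⟨μ.re, ‖μ.im‖⟩, norm_pos_iff.2 him, ?_⟩
  have hl : (((⟨μ.re, ‖μ.im‖⟩ : ℂ)) : ℍ[ℝ]) = μ.re + ‖μ.im‖ • ((Complex.I : ℂ) : ℍ[ℝ]) := by
    ext <;> simp
  rw [hl, Units.val_mk0, mul_add, ← hμq, ← Quaternion.coe_commutes, ← add_mul,
    Quaternion.re_add_im]

theorem exists_mul_I_mul_star {z : ℍ[ℝ]} (hz : z.re = 0) (hz0 : z ≠ 0) :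
    ∃ q : ℍ[ℝ], q ≠ 0 ∧ q * ((Complex.I : ℂ) : ℍ[ℝ]) * star q = z := by
  obtain ⟨q, hq, hzq⟩ := exists_mul_eq_mul_I hz
  have hn : Quaternion.normSq q ≠ 0 := Quaternion.normSq_ne_zero.2 hq
  have hr : ‖z‖ ≠ 0 := norm_ne_zero_iff.2 hz0
  set s := √(‖z‖ / Quaternion.normSq q)
  have hs : s * s = ‖z‖ / Quaternion.normSq q :=
    Real.mul_self_sqrt (div_nonneg (norm_nonneg z) Quaternion.normSq_nonneg)
  have hs0 : s ≠ 0 := fun h => div_ne_zero hr hn (by rw [← hs, h, mul_zero])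
  have hqI : q * ((Complex.I : ℂ) : ℍ[ℝ]) = ‖z‖⁻¹ • (z * q) := by
    rw [hzq, mul_smul_comm, smul_smul, inv_mul_cancel₀ hr, one_smul]
  refine ⟨s • q, smul_ne_zero hs0 hq, ?_⟩
  rw [Quaternion.star_smul, smul_mul_assoc, smul_mul_assoc, mul_smul_comm, smul_smul, hqI,
    smul_mul_assoc, smul_smul, mul_assoc z, Quaternion.self_mul_star, Quaternion.mul_coe_eq_smul,
    smul_smul, hs]
  convert one_smul ℝ z using 2
  field_simp

theorem exists_unit_sq_eq (c : ℂ) : ∃ u : ℂ, ‖u‖ = 1 ∧ ‖c‖ * u ^ 2 = c := by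
  refine ⟨Complex.exp ((c.arg / 2 : ℝ) * Complex.I), Complex.norm_exp_ofReal_mul_I _, ?_⟩
  rw [← Complex.exp_nat_mul]
  convert Complex.norm_mul_exp_arg_mul_I c using 3
  push_cast
  ring

theorem exists_conj_imK_eq_zero {y : ℍ[ℝ]} (hy : y.re = 0) :
    ∃ w y' : ℍ[ℝ], w ≠ 0 ∧ w * ((Complex.I : ℂ) : ℍ[ℝ]) * star w = ((Complex.I : ℂ) : ℍ[ℝ]) ∧
      y'.re = 0 ∧ y'.imK = 0 ∧ 0 ≤ y'.imJ ∧ w * y' * star w = y := by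
  obtain ⟨u, hu, huc⟩ := exists_unit_sq_eq ⟨y.imJ, y.imK⟩
  generalize hr : ‖(⟨y.imJ, y.imK⟩ : ℂ)‖ = r at huc
  have hu1 : u.re * u.re + u.im * u.im = 1 := by
    rw [← Complex.normSq_apply, Complex.normSq_eq_norm_sq, hu, one_pow]
  have hJ : r * (u.re * u.re - u.im * u.im) = y.imJ := by
    simpa [sq] using congrArg Complex.re huc
  have hK : r * (u.re * u.im + u.im * u.re) = y.imK := by
    simpa [sq] using congrArg Complex.im huc
  obtain ⟨y', h0, hI', hJ', hK'⟩ : ∃ y' : ℍ[ℝ], y'.re = 0 ∧ y'.imI = y.imI ∧ y'.imJ = r ∧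
    y'.imK = 0 := ⟨⟨0, y.imI, r, 0⟩, rfl, rfl, rfl, rfl⟩
  refine ⟨u, y', ?_, ?_, h0, hK', hJ' ▸ hr ▸ norm_nonneg _, ?_⟩
  · intro h
    have hre : u.re = 0 := congrArg QuaternionAlgebra.re h
    have him : u.im = 0 := congrArg QuaternionAlgebra.imI h
    simp [hre, him] at hu1
  · ext <;> simp
    · ring
    · linear_combination hu1
  · ext <;> simp [h0, hI', hJ', hK', hy]
    · ring
    · linear_combination y.imI * hu1
    · linear_combination hJ
    · linear_combination hK

theorem exists_simultaneous_normal_form {z y : ℍ[ℝ]} (hz : z.re = 0) (hz0 : z ≠ 0)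
    (hy : y.re = 0) :
    ∃ q y' : ℍ[ℝ], q ≠ 0 ∧ q * ((Complex.I : ℂ) : ℍ[ℝ]) * star q = z ∧
      y'.re = 0 ∧ y'.imK = 0 ∧ 0 ≤ y'.imJ ∧ q * y' * star q = y := by
  obtain ⟨q, hq, hqz⟩ := exists_mul_I_mul_star hz hz0
  have hre : (q⁻¹ * y * star q⁻¹).re = 0 := by
    have hy' : star y = -y := by rw [Quaternion.star_eq_two_re_sub, hy]; simp
    have h : star (q⁻¹ * y * star q⁻¹) = -(q⁻¹ * y * star q⁻¹) := by
      rw [star_mul, star_mul, star_star, hy', neg_mul, mul_neg, mul_assoc]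
    exact Quaternion.star_eq_neg.1 h
  obtain ⟨w, y', hw, hwI, h0, hK, hJ, hwy⟩ := exists_conj_imK_eq_zero hre
  have hmul (x : ℍ[ℝ]) : q * w * x * star (q * w) = q * (w * x * star w) * star q := by
    simp only [star_mul, mul_assoc]
  refine ⟨q * w, y', mul_ne_zero hq hw, by rw [hmul, hwI, hqz], h0, hK, hJ, ?_⟩
  rw [hmul, hwy, mul_assoc, mul_assoc, ← star_mul, mul_inv_cancel₀ hq, star_one, mul_one,
    mul_inv_cancel_left₀ hq]

/-! ### Normal forms of pairs -/

theorem IsAttracting.rmul {A : Sp11} {v : Vec} (h : IsAttracting A v) {c : ℍ[ℝ]} (hc : c ≠ 0) :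
    IsAttracting A (rmul v c) := by
  obtain ⟨hv, hv0, μ, hμ, e⟩ := h
  have e' := act_rmul_of_eigen hc e
  exact ⟨rmul_ne_zero hv hc, by rw [herm_rmul_left, herm_rmul_right, hv0, mul_zero, zero_mul], _,
    (norm_eq_of_eigen hv hc e e').symm.trans_lt hμ, e'⟩

theorem IsRepelling.rmul {A : Sp11} {v : Vec} (h : IsRepelling A v) {c : ℍ[ℝ]} (hc : c ≠ 0) :
    IsRepelling A (rmul v c) := by
  obtain ⟨hv, hv0, μ, hμ, e⟩ := h
  have e' := act_rmul_of_eigen hc e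
  exact ⟨rmul_ne_zero hv hc, by rw [herm_rmul_left, herm_rmul_right, hv0, mul_zero, zero_mul], _,
    hμ.trans_eq (norm_eq_of_eigen hv hc e e'), e'⟩

theorem act_conj_eq_iff (A F : Sp11) (v : Vec) (μ : ℍ[ℝ]) :
    act (F⁻¹ * A * F) v = rmul v μ ↔ act A (act F v) = rmul (act F v) μ := by
  rw [act_mul, act_mul, ← (toLin_injective F).eq_iff]
  change act F (act F⁻¹ _) = act F _ ↔ _
  rw [act_act_inv, act_rmul]

theorem act_ne_zero_iff (F : Sp11) (v : Vec) : act F v ≠ 0 ↔ v ≠ 0 :=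
  (map_ne_zero_iff (toLin F) (toLin_injective F))

theorem isAttracting_conj_iff (A F : Sp11) (v : Vec) :
    IsAttracting (F⁻¹ * A * F) v ↔ IsAttracting A (act F v) := by
  simp only [IsAttracting, act_conj_eq_iff, act_ne_zero_iff, herm_act]

theorem isRepelling_conj_iff (A F : Sp11) (v : Vec) :
    IsRepelling (F⁻¹ * A * F) v ↔ IsRepelling A (act F v) := by
  simp only [IsRepelling, act_conj_eq_iff, act_ne_zero_iff, herm_act]

theorem IsIrreduciblePair.herm_ne_zero {A B : Sp11} (h : IsIrreduciblePair A B) {x y : Vec}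
    {μ ν : ℍ[ℝ]} (hx : x ≠ 0) (hx0 : herm x x = 0) (hAx : act A x = rmul x μ) (hy : y ≠ 0)
    (hBy : act B y = rmul y ν) : herm y x ≠ 0 := by
  intro h0
  obtain ⟨c, rfl⟩ := eq_rmul_of_herm_eq_zero hx hx0 h0
  have hc := right_ne_zero_of_rmul hy
  have hBx := act_rmul_of_eigen (inv_ne_zero hc) hBy
  rw [rmul_rmul, mul_inv_cancel₀ hc, rmul_one] at hBx
  exact h.1 ⟨Projectivization.mk ℍ[ℝ]ᵐᵒᵖ x hx, Or.inr ((mk_mem_bdry hx).2 hx0),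
    (move_mk_eq_iff A hx).2 ⟨μ, hAx⟩, (move_mk_eq_iff B hx).2 ⟨_, hBx⟩⟩

theorem exists_act_diag {l : ℍ[ℝ]} (hl : l ≠ 0) :
    ∃ D : Sp11, act D ![1, 0] = rmul ![1, 0] l ∧ act D ![0, 1] = rmul ![0, 1] (star l)⁻¹ ∧
      ∀ z, act D ![z, 1] = rmul ![l * z * star l, 1] (star l)⁻¹ := by
  have hl' : star l ≠ 0 := star_ne_zero.2 hl
  obtain ⟨D, h0, h1⟩ := exists_act_eq (p := rmul ![1, 0] l) (q := rmul ![0, 1] (star l)⁻¹)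
    (by simp [herm, rmul]) (by simp [herm, rmul]) (by simp [herm, rmul, hl])
  refine ⟨D, h0, h1, fun z => ?_⟩
  have hz : ![z, 1] = rmul ![1, 0] z + ![0, 1] := by
    ext1 i
    fin_cases i <;> simp [rmul]
  rw [hz, act_add, act_rmul, h0, h1]
  ext1 i
  fin_cases i <;> simp [rmul, mul_assoc, hl']

theorem exists_rmul_eq_standard {x : Vec} (hx0 : herm x x = 0) (h1 : x 1 ≠ 0) :
    ∃ z c : ℍ[ℝ], z.re = 0 ∧ c ≠ 0 ∧ rmul x c = ![z, 1] := by
  have hx : rmul x (x 1)⁻¹ = ![x 0 * (x 1)⁻¹, 1] := by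
    ext1 i
    fin_cases i <;> simp [rmul, h1]
  refine ⟨_, _, ?_, inv_ne_zero h1, hx⟩
  have hz := herm_self_rmul x (x 1)⁻¹
  rw [hx, hx0, Quaternion.re_zero, mul_zero] at hz
  have hz' : star (x 0 * (x 1)⁻¹) = -(x 0 * (x 1)⁻¹) :=
    eq_neg_of_add_eq_zero_right (by simpa [herm] using hz)
  exact Quaternion.star_eq_neg.1 hz'

theorem IsIrreduciblePair.exists_conj_standard {A B : Sp11} (h : IsIrreduciblePair A B)
    (hA : IsHyperbolic A) (hB : IsHyperbolic B) :
    ∃ (F : Sp11) (z y : ℍ[ℝ]), z.re = 0 ∧ z ≠ 0 ∧ y.re = 0 ∧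
      IsAttracting (F⁻¹ * A * F) ![0, 1] ∧ IsRepelling (F⁻¹ * A * F) ![1, 0] ∧
      IsAttracting (F⁻¹ * B * F) ![z, 1] ∧ IsRepelling (F⁻¹ * B * F) ![y, 1] := by
  obtain ⟨v, w, hv, hw⟩ := hA.exists_attracting_repelling
  obtain ⟨F, rfl, c, hc, hw'⟩ := exists_frame hv.2.1 hw.2.1 (hw.herm_ne_zero hv)
  replace hw := hw.rmul hc
  rw [← hw', ← isRepelling_conj_iff] at hw
  rw [← isAttracting_conj_iff] at hv
  replace h := h.conj F
  replace hB := hB.conj F⁻¹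
  rw [inv_inv] at hB
  obtain ⟨p, q, hp, hq⟩ := hB.exists_attracting_repelling
  have ne_infty {x : Vec} {μ : ℍ[ℝ]} (hx : x ≠ 0) (hBx : act (F⁻¹ * B * F) x = rmul x μ) :
      x 1 ≠ 0 := by
    obtain ⟨h1, h2, _, -, h3⟩ := hw
    simpa [herm] using h.herm_ne_zero h1 h2 h3 hx hBx
  obtain ⟨z, a, hz, ha, ez⟩ := exists_rmul_eq_standard hp.2.1 (ne_infty hp.1 hp.2.2.choose_spec.2)
  obtain ⟨y, b, hy, hb, ey⟩ := exists_rmul_eq_standard hq.2.1 (ne_infty hq.1 hq.2.2.choose_spec.2)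
  have hz' : IsAttracting (F⁻¹ * B * F) ![z, 1] := ez ▸ hp.rmul ha
  refine ⟨F, z, y, hz, ?_, hy, hv, hw, hz', ey ▸ hq.rmul hb⟩
  obtain ⟨h1, h2, _, -, h3⟩ := hv
  simpa [herm] using h.herm_ne_zero h1 h2 h3 hz'.1 hz'.2.2.choose_spec.2

theorem IsIrreduciblePair.exists_isNormalized {A B : Sp11} (h : IsIrreduciblePair A B)
    (hA : IsHyperbolic A) (hB : IsHyperbolic B) :
    ∃ F : Sp11, IsNormalized (F⁻¹ * A * F) (F⁻¹ * B * F) := by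
  obtain ⟨F, z, y, hz, hz0, hy, hAa, hAr, hBa, hBr⟩ := h.exists_conj_standard hA hB
  obtain ⟨q, y', hq, hqz, h0, hK, hJ, hqy⟩ := exists_simultaneous_normal_form hz hz0 hy
  obtain ⟨D, D_infty, D_zero, D_std⟩ := exists_act_diag hq
  have hq' : (star q)⁻¹ ≠ 0 := inv_ne_zero (star_ne_zero.2 hq)
  have hconj (X : Sp11) : (F * D)⁻¹ * X * (F * D) = D⁻¹ * (F⁻¹ * X * F) * D := by group
  refine ⟨F * D, y', h0, hK, hJ, ?_, ?_, ?_, ?_⟩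
  · rw [hconj, isAttracting_conj_iff, D_zero]
    exact hAa.rmul hq'
  · rw [hconj, isRepelling_conj_iff, D_infty]
    exact hAr.rmul hq
  · rw [hconj, isAttracting_conj_iff, D_std, hqz]
    exact hBa.rmul hq'
  · rw [hconj, isRepelling_conj_iff, D_std, hqy]
    exact hBr.rmul hq'

/-! ### Projective points and twist-bends -/

theorem exists_isStandard_rmul {x : Vec} (hx : x ≠ 0) : ∃ c, c ≠ 0 ∧ IsStandard (rmul x c) := by
  by_cases h1 : x 1 = 0
  · have h0 : x 0 ≠ 0 := fun h0 => hx (by ext1 i; fin_cases i <;> assumption)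
    refine ⟨(x 0)⁻¹, inv_ne_zero h0, Or.inr ?_⟩
    ext1 i
    fin_cases i <;> simp [rmul, h0, h1]
  · exact ⟨(x 1)⁻¹, inv_ne_zero h1, Or.inl (mul_inv_cancel₀ h1)⟩

theorem IsStandard.eq_of_rmul {v w : Vec} (hv : IsStandard v) (hw : IsStandard w) {c : ℍ[ℝ]}
    (h : w = rmul v c) : w = v := by
  have h0 : w 0 = v 0 * c := congrFun h 0
  have h1 : w 1 = v 1 * c := congrFun h 1
  rcases hv with hv | rfl <;> rcases hw with hw | rfl
  · rw [h, show c = 1 by rw [← hw, h1, hv, one_mul], rmul_one]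
  · rw [hv, one_mul] at h1
    simp [← h1] at h0
  · simp [hw] at h1
  · rfl

theorem IsAttracting.eq_of_isStandard {A : Sp11} {v w : Vec} (hv : IsAttracting A v)
    (hv' : IsStandard v) (hw : IsAttracting A w) (hw' : IsStandard w) : w = v := by
  obtain ⟨c, hc⟩ := hv.exists_eq_rmul hw
  exact hv'.eq_of_rmul hw' hc

theorem IsLoxodromic.exists_isProjectivePoint {A : Sp11} (hA : IsLoxodromic A) :
    ∃ k, IsProjectivePoint A k := by
  obtain ⟨v, -, hv, -⟩ := hA.1.exists_attracting_repelling
  obtain ⟨c, hc, hst⟩ := exists_isStandard_rmul hv.1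
  replace hv := hv.rmul hc
  obtain ⟨μ, -, e⟩ := hv.2.2
  obtain ⟨q, l, hl, hq⟩ := exists_mul_eq_mul_coe (hA.2 μ ⟨_, hv.1, e⟩)
  exact ⟨q, _, q, l, hv, hst, hl, rfl, by rw [act_rmul, e, rmul_rmul, rmul_rmul _ (q : ℍ[ℝ]), hq]⟩

theorem IsAttracting.act {A K : Sp11} {v : Vec} (hv : IsAttracting A v) (hK : K * A = A * K) :
    IsAttracting A (act K v) := by
  rwa [← isAttracting_conj_iff, mul_assoc, ← hK, inv_mul_cancel_left]

theorem IsRepelling.act {A K : Sp11} {v : Vec} (hv : IsRepelling A v) (hK : K * A = A * K) :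
    IsRepelling A (act K v) := by
  rwa [← isRepelling_conj_iff, mul_assoc, ← hK, inv_mul_cancel_left]

theorem exists_mul_eq_mul_coe_of_ne_zero {ν : ℍ[ℝ]} (hν : ν ≠ 0) (q₀ : ℍ[ℝ]ˣ) :
    ∃ (q : ℍ[ℝ]ˣ) (l : ℂ), 0 ≤ l.im ∧ l ≠ 0 ∧ ν * q = q * (l : ℍ[ℝ]) ∧
      (l.im = 0 → q = q₀) := by
  by_cases hr : ∃ r : ℝ, ν = (r : ℍ[ℝ])
  · obtain ⟨r, rfl⟩ := hr
    refine ⟨q₀, (r : ℂ), (Complex.ofReal_im r).ge, ?_, ?_, fun _ => rfl⟩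
    · intro h
      rw [Complex.ofReal_eq_zero.1 h] at hν
      exact hν Quaternion.coe_zero
    · rw [Quaternion.coe_commutes, Quaternion.coeComplex_coe]
  · obtain ⟨q, l, hl, hq⟩ := exists_mul_eq_mul_coe (not_exists.1 hr)
    refine ⟨q, l, hl.le, ?_, hq, fun h => absurd h hl.ne'⟩
    rintro rfl
    exact hl.false

theorem IsLoxodromic.exists_isTwistBend {A K : Sp11} (hA : IsLoxodromic A) (hK : K * A = A * K) :
    ∃ κ, IsTwistBend A K κ := by
  obtain ⟨k, v, q₀, μ, hv, hst, hμ, rfl, e⟩ := hA.exists_isProjectivePoint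
  obtain ⟨ν, hν⟩ := hv.exists_eq_rmul (hv.act hK)
  obtain ⟨q, l, hl, hl0, hq, hq₀⟩ :=
    exists_mul_eq_mul_coe_of_ne_zero (eigenvalue_ne_zero hv.1 hν) q₀
  refine ⟨⟨‖l‖, l.arg, q⟩, hK, norm_pos_iff.2 hl0, Complex.arg_nonneg_iff.2 hl,
    Complex.arg_le_pi l, ⟨v, q, hv, hst, rfl, ?_⟩, fun hsin => ⟨v, q, μ, hv, hst, hμ, rfl, ?_⟩⟩
  · rw [Complex.norm_mul_exp_arg_mul_I, act_rmul, hν, rmul_rmul, rmul_rmul, hq]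
  · rw [hq₀ (by rw [← Complex.norm_mul_sin_arg, show Real.sin l.arg = 0 from hsin, mul_zero]), e]

end SpOneOne

/-! ### The real trace -/

namespace SpOneOne

theorem cpart_add (p q : ℍ[ℝ]) : cpart (p + q) = cpart p + cpart q := by
  apply Complex.ext <;> simp [cpart]

theorem jpart_add (p q : ℍ[ℝ]) : jpart (p + q) = jpart p + jpart q := by
  apply Complex.ext <;> simp [jpart, add_comm]

theorem cpart_mul (p q : ℍ[ℝ]) :
    cpart (p * q) = cpart p * cpart q - star (jpart p) * jpart q := by
  apply Complex.ext <;> simp [cpart, jpart] <;> ring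

theorem jpart_mul (p q : ℍ[ℝ]) :
    jpart (p * q) = jpart p * cpart q + star (cpart p) * jpart q := by
  apply Complex.ext <;> simp [cpart, jpart] <;> ring

theorem complexify_mul (M N : Matrix (Fin 2) (Fin 2) ℍ[ℝ]) :
    complexify (M * N) = complexify M * complexify N := by
  rw [complexify, complexify, complexify, Matrix.fromBlocks_multiply]
  congr 1 <;> ext1 i j <;>
    simp only [Matrix.map_apply, Matrix.neg_apply, Matrix.add_apply, Matrix.mul_apply,
      Fin.sum_univ_two, cpart_add, jpart_add, cpart_mul, jpart_mul, star_add, star_sub, star_mul',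
      star_star] <;> ring

theorem charpoly_complexify_conj (A F : Sp11) :
    (complexify (F⁻¹ * A * F).val.val).charpoly = (complexify A.val.val).charpoly := by
  change (complexify ((F⁻¹ * A).val.val * F.val.val)).charpoly = _
  rw [complexify_mul, Matrix.charpoly_mul_comm, ← complexify_mul]
  change (complexify (F * (F⁻¹ * A)).val.val).charpoly = _
  rw [mul_inv_cancel_left]

theorem complexify_diag (a b : ℂ) : complexify !![(a : ℍ[ℝ]), 0; 0, (b : ℍ[ℝ])] =
    Matrix.diagonal (Sum.elim ![a, b] ![star a, star b]) := by
  ext1 i j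
  rcases i with i | i <;> rcases j with j | j <;> fin_cases i <;> fin_cases j <;>
    apply Complex.ext <;> simp [complexify, cpart, jpart, Matrix.diagonal]

open Polynomial in
theorem charpoly_complexify {A : Sp11} {v w : Vec} {l : ℂ} (hv : IsAttracting A v)
    (hw : IsRepelling A w) (hl : act A v = rmul v (l : ℍ[ℝ])) :
    (complexify A.val.val).charpoly =
      (X - C (star l)⁻¹) * (X - C l) * ((X - C l⁻¹) * (X - C (star l))) := by
  obtain ⟨F, μ, ν, rfl, hd, -, -⟩ := exists_conj_eq_diag hv hw
  have hμ : act (F⁻¹ * A * F) ![0, 1] = rmul ![0, 1] μ := by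
    rw [act, hd, diag_mulVec]
    ext1 i
    fin_cases i <;> simp [rmul]
  obtain rfl : μ = (l : ℍ[ℝ]) := rmul_right_cancel hv.1 <| by
    rw [← hl, ← act_rmul, ← hμ, act_mul, act_mul, act_act_inv]
  have hstar : star (l : ℍ[ℝ]) = ((star l : ℂ) : ℍ[ℝ]) := by ext <;> simp
  have hl0 : star l ≠ 0 := star_ne_zero.2 fun h =>
    eigenvalue_ne_zero hv.1 hl (by rw [h, Quaternion.coeComplex_zero])
  have hν : star (l : ℍ[ℝ]) * ν = 1 := by
    have h := adj_mul_self (F⁻¹ * A * F)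
    rw [hd, adj_diag] at h
    simpa [Matrix.mul_apply] using congrFun₂ h 0 0
  obtain rfl : ν = (((star l)⁻¹ : ℂ) : ℍ[ℝ]) := by
    refine mul_left_cancel₀ (star_ne_zero.2 (eigenvalue_ne_zero hv.1 hl)) (hν.trans ?_)
    rw [hstar, ← Quaternion.coeComplex_mul, mul_inv_cancel₀ hl0, Quaternion.coeComplex_one]
  rw [← charpoly_complexify_conj A F, hd, complexify_diag, Matrix.charpoly_diagonal,
    Fintype.prod_sum_type, Fin.prod_univ_two, Fin.prod_univ_two]
  simp only [Sum.elim_inl, Sum.elim_inr, Matrix.cons_val_zero, Matrix.cons_val_one, star_inv₀,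
    star_star]

open Polynomial in
theorem coeff_prod_linear {R : Type*} [CommRing R] (a b c d : R) :
    ((X - C a) * (X - C b) * ((X - C c) * (X - C d))).coeff 3 = -(a + b + c + d) ∧
    ((X - C a) * (X - C b) * ((X - C c) * (X - C d))).coeff 2 =
      a * b + c * d + (a + b) * (c + d) := by
  have e : (X - C a) * (X - C b) * ((X - C c) * (X - C d)) = X ^ 4 + C (-(a + b + c + d)) * X ^ 3 +
      C (a * b + c * d + (a + b) * (c + d)) * X ^ 2 +
      C (-(a * b * (c + d) + c * d * (a + b))) * X + C (a * b * (c * d)) := by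
    simp only [C_add, C_mul, C_neg]
    ring
  rw [e]
  constructor <;> simp only [coeff_add, coeff_C_mul, coeff_X_pow, coeff_X, coeff_C] <;> norm_num

theorem realTrace_eq {A : Sp11} {v w : Vec} {l : ℂ} (hv : IsAttracting A v) (hw : IsRepelling A w)
    (hl : act A v = rmul v (l : ℍ[ℝ])) :
    realTrace A = (2 * l.re + 2 * (l.re / Complex.normSq l),
      Complex.normSq l + 1 / Complex.normSq l + 4 * (l.re ^ 2 / Complex.normSq l)) := by
  have hl0 : Complex.normSq l ≠ 0 := fun h => eigenvalue_ne_zero hv.1 hl <| by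
    rw [Complex.normSq_eq_zero.1 h, Quaternion.coeComplex_zero]
  obtain ⟨h3, h2⟩ := coeff_prod_linear (star l)⁻¹ l l⁻¹ (star l)
  rw [realTrace, charpoly_complexify hv hw hl, h3, h2]
  refine Prod.ext ?_ ?_
  · simp [Complex.inv_re, Complex.normSq_conj]
    ring
  · simp [Complex.inv_re, Complex.inv_im, Complex.normSq_conj]
    field_simp
    rw [Complex.normSq_apply l]
    ring

theorem normSq_mem_Ioo_of_isAttracting {A : Sp11} {v : Vec} {l : ℂ} (hv : IsAttracting A v)
    (hl : act A v = rmul v (l : ℍ[ℝ])) : Complex.normSq l ∈ Ioo 0 1 := by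
  obtain ⟨hv0, -, μ, hμ, e⟩ := hv
  obtain rfl := rmul_right_cancel hv0 (e.symm.trans hl)
  have hnorm : ‖(l : ℍ[ℝ])‖ * ‖(l : ℍ[ℝ])‖ = Complex.normSq l := by
    rw [← Quaternion.normSq_eq_norm_mul_self, Quaternion.normSq_def', Complex.normSq_apply]
    simp [sq]
  have hpos := norm_pos_iff.2 (eigenvalue_ne_zero hv0 hl)
  rw [← hnorm]
  constructor <;> nlinarith

theorem eq_of_add_eq_of_mul_eq {R : Type*} [CommRing R] [PartialOrder R] [IsDomain R]
    {s t s' t' : R} (hadd : s + t = s' + t') (hmul : s * t = s' * t') (h : t' < s) : s = s' := by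
  have hprod : (s - s') * (s - t') = 0 := by linear_combination s * hadd - hmul
  exact sub_eq_zero.1 ((mul_eq_zero.1 hprod).resolve_right (sub_ne_zero.2 h.ne'))

theorem injOn_add_one_div : InjOn (fun m : ℝ => m + 1 / m) (Ioo 0 1) := by
  rintro m ⟨hm, hm1⟩ n ⟨hn, hn1⟩ h
  have hprod : (m - n) * (m * n - 1) = 0 := by
    field_simp at h
    linear_combination h
  exact sub_eq_zero.1 ((mul_eq_zero.1 hprod).resolve_right (by nlinarith))

-- Put `T = n + 1 / n + 2` and `U = 4 x ^ 2 / n`. The two equations fix `T U` and `T + U`, and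
-- `U < 4 < T` tells the two roots apart.
theorem eq_of_trace_eq {x n x' n' : ℝ} (hn : n ∈ Ioo 0 1) (hn' : n' ∈ Ioo 0 1) (hx' : x' ^ 2 < n')
    (ha : 2 * x + 2 * (x / n) = 2 * x' + 2 * (x' / n'))
    (hb : n + 1 / n + 4 * (x ^ 2 / n) = n' + 1 / n' + 4 * (x' ^ 2 / n')) : x = x' ∧ n = n' := by
  have hmul {m y : ℝ} (hm : m ∈ Ioo 0 1) :
      (m + 1 / m + 2) * (4 * (y ^ 2 / m)) = (2 * y + 2 * (y / m)) ^ 2 := by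
    have := hm.1.ne'
    field_simp
    ring
  have hlt : 4 * (x' ^ 2 / n') < n + 1 / n + 2 := by
    have h4 : n + 1 / n + 2 - 4 = (n - 1) ^ 2 / n := by
      have := hn.1.ne'
      field_simp
      ring
    have h0 : 0 ≤ (n - 1) ^ 2 / n := div_nonneg (sq_nonneg _) hn.1.le
    linarith [(div_lt_one hn'.1).2 hx']
  have hsum : n + 1 / n + 2 = n' + 1 / n' + 2 :=
    eq_of_add_eq_of_mul_eq (t := 4 * (x ^ 2 / n)) (by linear_combination hb)
      (by rw [hmul hn, hmul hn', ha]) hlt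
  obtain rfl := injOn_add_one_div hn hn' (add_right_cancel hsum)
  have hpos := hn.1
  refine ⟨?_, rfl⟩
  field_simp at ha
  exact ha

/-! ### Elements are determined by their parameters -/

theorem eq_of_act_eq {A A' : Sp11} {v w : Vec} {ν ν' : ℍ[ℝ]} (hv : herm v v = 0)
    (hw : herm w w = 0) (hwv : herm w v ≠ 0) (h : act A v = act A' v)
    (hν : act A w = rmul w ν) (hν' : act A' w = rmul w ν') : A = A' := by
  have e : herm w (act A v) * ν = herm w v := by rw [← herm_rmul_left, ← hν, herm_act]
  have e' : herm w (act A v) * ν' = herm w v := by rw [← herm_rmul_left, ← hν', h, herm_act]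
  obtain rfl : ν = ν' := mul_left_cancel₀ (left_ne_zero_of_mul (e ▸ hwv)) (e.trans e'.symm)
  obtain ⟨F, h1, c, -, h0⟩ := exists_frame hv hw hwv
  refine mul_right_cancel (b := F) (act_ext ?_ ?_)
  · rw [act_mul, act_mul, h0, act_rmul, act_rmul, hν, hν']
  · rw [act_mul, act_mul, h1, h]

theorem act_eq_of_mk_eq {A A' : Sp11} {v : Vec} {q q' : ℍ[ℝ]ˣ} {l : ℂ}
    (hq : (q : CP1) = (q' : CP1)) (h : act A (rmul v q) = rmul (rmul v q) (l : ℍ[ℝ]))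
    (h' : act A' (rmul v q') = rmul (rmul v q') (l : ℍ[ℝ])) : act A v = act A' v := by
  obtain ⟨c, hc⟩ := QuotientGroup.eq.1 hq
  have hcq : (q' : ℍ[ℝ]) = q * ((c : ℂ) : ℍ[ℝ]) :=
    congrArg Units.val (inv_mul_eq_iff_eq_mul.1 hc.symm)
  refine rmul_left_cancel q'.ne_zero ?_
  rw [← act_rmul, ← act_rmul, h', hcq, ← rmul_rmul, act_rmul, h, rmul_rmul _ (l : ℍ[ℝ]),
    rmul_rmul _ ((c : ℂ) : ℍ[ℝ]), ← Quaternion.coeComplex_mul, mul_comm, Quaternion.coeComplex_mul]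

theorem eq_of_realTrace_eq {A A' : Sp11} {v w : Vec} (hv : IsAttracting A v)
    (hv' : IsAttracting A' v) (hw : IsRepelling A w) (hw' : IsRepelling A' w) (hst : IsStandard v)
    (htr : realTrace A = realTrace A') {k : CP1} (hk : IsProjectivePoint A k)
    (hk' : IsProjectivePoint A' k) : A = A' := by
  obtain ⟨u, q, l, hu, hust, hl, rfl, e⟩ := hk
  obtain ⟨u', q', l', hu', hust', hl', hqq, e'⟩ := hk'
  obtain rfl := hv.eq_of_isStandard hst hu hust
  obtain rfl := hv'.eq_of_isStandard hst hu' hust'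
  rw [realTrace_eq (hv.rmul q.ne_zero) hw e, realTrace_eq (hv'.rmul q'.ne_zero) hw' e',
    Prod.mk.injEq] at htr
  have hlt : l'.re ^ 2 < Complex.normSq l' := by
    rw [Complex.normSq_apply]
    nlinarith
  obtain ⟨hre, hn⟩ := eq_of_trace_eq (normSq_mem_Ioo_of_isAttracting (hv.rmul q.ne_zero) e)
    (normSq_mem_Ioo_of_isAttracting (hv'.rmul q'.ne_zero) e') hlt htr.1 htr.2
  obtain rfl : l = l' := by
    refine Complex.ext hre ?_
    rw [Complex.normSq_apply, Complex.normSq_apply, hre] at hn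
    nlinarith
  obtain ⟨-, hw0, ν, -, hν⟩ := id hw
  obtain ⟨-, -, ν', -, hν'⟩ := hw'
  exact eq_of_act_eq hv.2.1 hw0 (hw.herm_ne_zero hv) (act_eq_of_mk_eq hqq e e') hν hν'

theorem IsTwistBend.unique {A K K' : Sp11} (hA : IsHyperbolic A) {κ : TwistBend}
    (h : IsTwistBend A K κ) (h' : IsTwistBend A K' κ) : K = K' := by
  obtain ⟨-, w, -, hw⟩ := hA.exists_attracting_repelling
  obtain ⟨hc, -, -, -, ⟨v, q, hv, hst, hk, e⟩, -⟩ := h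
  obtain ⟨hc', -, -, -, ⟨v', q', hv', hst', hk', e'⟩, -⟩ := h'
  obtain rfl := hv.eq_of_isStandard hst hv' hst'
  obtain ⟨ν, hν⟩ := hw.exists_eq_rmul (hw.act hc)
  obtain ⟨ν', hν'⟩ := hw.exists_eq_rmul (hw.act hc')
  exact eq_of_act_eq hv.2.1 hw.2.1 (hw.herm_ne_zero hv)
    (act_eq_of_mk_eq (hk.symm.trans hk') e e') hν hν'

theorem IsCrossRatio.exists_eq_conj {A B : Sp11} {X : ℍ[ℝ]} (hX : IsCrossRatio A B X)
    {z₁ z₂ z₃ z₄ : Vec} (h₁ : IsAttracting A z₁) (h₂ : IsRepelling A z₂) (h₃ : IsAttracting B z₃)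
    (h₄ : IsRepelling B z₄) : ∃ c, c ≠ 0 ∧ X = c * crossRatio z₁ z₂ z₃ z₄ * c⁻¹ := by
  obtain ⟨u₁, u₂, u₃, u₄, k₁, k₂, k₃, k₄, rfl⟩ := hX
  obtain ⟨c₁, rfl⟩ := h₁.exists_eq_rmul k₁
  obtain ⟨c₂, rfl⟩ := h₂.exists_eq_rmul k₂
  obtain ⟨c₃, rfl⟩ := h₃.exists_eq_rmul k₃
  obtain ⟨c₄, rfl⟩ := h₄.exists_eq_rmul k₄
  have n₂ := star_ne_zero.2 (right_ne_zero_of_rmul k₂.1)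
  have n₃ := right_ne_zero_of_rmul k₃.1
  have n₄ := right_ne_zero_of_rmul k₄.1
  refine ⟨star c₁, star_ne_zero.2 (right_ne_zero_of_rmul k₁.1), ?_⟩
  simp only [crossRatio, herm_rmul_left, herm_rmul_right, mul_inv_rev, mul_assoc,
    mul_inv_cancel_left₀ n₃, inv_mul_cancel_left₀ n₂, mul_inv_cancel_left₀ n₄]

theorem crossRatio_normalized (z y : ℍ[ℝ]) :
    crossRatio ![0, 1] ![1, 0] ![z, 1] ![y, 1] = z * y⁻¹ := by
  simp [crossRatio, herm]

theorem re_conj {c x : ℍ[ℝ]} (hc : c ≠ 0) : (c * x * c⁻¹).re = x.re := by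
  rw [re_mul_comm, ← mul_assoc, inv_mul_cancel₀ hc, one_mul]

theorem norm_conj {𝕜 : Type*} [NormedDivisionRing 𝕜] {c x : 𝕜} (hc : c ≠ 0) :
    ‖c * x * c⁻¹‖ = ‖x‖ := by
  rw [norm_mul, norm_mul, norm_inv, mul_right_comm, mul_inv_cancel₀ (norm_ne_zero_iff.2 hc),
    one_mul]

theorem eq_of_crossRatio_eq {y y' : ℍ[ℝ]} (hy : y.re = 0) (hyK : y.imK = 0) (hyJ : 0 ≤ y.imJ)
    (hy' : y'.re = 0) (hyK' : y'.imK = 0) (hyJ' : 0 ≤ y'.imJ)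
    (hre : (((Complex.I : ℂ) : ℍ[ℝ]) * y⁻¹).re = (((Complex.I : ℂ) : ℍ[ℝ]) * y'⁻¹).re)
    (hnorm : ‖((Complex.I : ℂ) : ℍ[ℝ]) * y⁻¹‖ = ‖((Complex.I : ℂ) : ℍ[ℝ]) * y'⁻¹‖) : y = y' := by
  have hI : ((Complex.I : ℂ) : ℍ[ℝ]) ≠ 0 := fun h => by
    simpa using congrArg QuaternionAlgebra.imI h
  rw [norm_mul, norm_mul, norm_inv, norm_inv] at hnorm
  replace hnorm : ‖y‖ = ‖y'‖ := inv_injective (mul_left_cancel₀ (norm_ne_zero_iff.2 hI) hnorm)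
  rcases eq_or_ne y 0 with rfl | h0
  · rw [norm_zero] at hnorm
    exact (norm_eq_zero.1 hnorm.symm).symm
  have hsq : Quaternion.normSq y = Quaternion.normSq y' := by
    rw [Quaternion.normSq_eq_norm_mul_self, Quaternion.normSq_eq_norm_mul_self, hnorm]
  have himI : y.imI = y'.imI := by
    rw [Quaternion.inv_def, Quaternion.inv_def, ← hsq, mul_smul_comm, mul_smul_comm] at hre
    simpa [h0] using hre
  rw [Quaternion.normSq_def', Quaternion.normSq_def', hy, hy', hyK, hyK', himI] at hsq
  exact Quaternion.ext _ _ (hy.trans hy'.symm) himI (by nlinarith) (hyK.trans hyK'.symm)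

theorem IsPairCoord.unique {A B A' B' : Sp11} {c : PairCoord} (h : IsPairCoord A B c)
    (h' : IsPairCoord A' B' c) : A = A' ∧ B = B' := by
  obtain ⟨⟨y, hy, hyK, hyJ, a₁, a₂, a₃, a₄⟩, tA, tB, ⟨X, hX, hre, habs⟩, pA, pB⟩ := h
  obtain ⟨⟨y', hy', hyK', hyJ', b₁, b₂, b₃, b₄⟩, tA', tB', ⟨X', hX', hre', habs'⟩, pA', pB'⟩ := h'
  obtain ⟨d, hd, rfl⟩ := hX.exists_eq_conj a₁ a₂ a₃ a₄
  obtain ⟨d', hd', rfl⟩ := hX'.exists_eq_conj b₁ b₂ b₃ b₄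
  rw [crossRatio_normalized, re_conj hd] at hre
  rw [crossRatio_normalized, re_conj hd'] at hre'
  rw [crossRatio_normalized, norm_conj hd] at habs
  rw [crossRatio_normalized, norm_conj hd'] at habs'
  obtain rfl := eq_of_crossRatio_eq hy hyK hyJ hy' hyK' hyJ' (hre.symm.trans hre')
    (habs.symm.trans habs')
  exact ⟨eq_of_realTrace_eq a₁ b₁ a₂ b₂ (Or.inl rfl) (tA.symm.trans tA') pA pA',
    eq_of_realTrace_eq a₃ b₃ a₄ b₄ (Or.inl rfl) (tB.symm.trans tB') pB pB'⟩

end SpOneOne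

/-! ### Fenchel–Nielsen coordinates -/

namespace SpOneOne

section GraphOfGroups

variable {g : ℕ} {P : CurveSystem g} {G : Type*} [Group G] (σ : P.Grp →* G)
  (F : Fin (2 * g - 2) → G)

/-- The image of a boundary loop, conjugated by the frame `F v` of its three-holed sphere. -/
def peripheral (x : Fin (2 * g - 2) × Fin 3) : G := (F x.1)⁻¹ * σ (P.bdryLoop x) * F x.1

/-- The element that glues the two framed three-holed sphere groups along the `j`-th curve. -/
def gluing (j : Fin (3 * g - 3)) : G :=
  (F (P.sides (j, false)).1)⁻¹ * σ (P.crossing j) * F (P.sides (j, true)).1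

theorem peripheral_two (v : Fin (2 * g - 2)) :
    peripheral σ F (v, 2) = (peripheral σ F (v, 0) * peripheral σ F (v, 1))⁻¹ := by
  simp only [peripheral, eq_inv_of_mul_eq_one_right (P.bdryLoop_mul v), map_inv, map_mul]
  group

theorem gluing_conj (j : Fin (3 * g - 3)) :
    gluing σ F j * peripheral σ F (P.sides (j, true)) * (gluing σ F j)⁻¹ =
      (peripheral σ F (P.sides (j, false)))⁻¹ := by
  simp only [gluing, peripheral, mul_inv_rev, inv_inv, ← map_crossing_conj σ j]
  group

variable {σ F} {σ' : P.Grp →* G} {F' : Fin (2 * g - 2) → G}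

theorem inv_mul_mul_eq_iff {a b k s t : G} :
    a⁻¹ * s * b = (k * a)⁻¹ * t * (k * b) ↔ t = k * s * k⁻¹ := by
  constructor
  · intro h
    calc t = k * a * ((k * a)⁻¹ * t * (k * b)) * (k * b)⁻¹ := by group
      _ = k * s * k⁻¹ := by
        rw [← h]
        group
  · rintro rfl
    group

theorem peripheral_conj {k : G} (hk : ∀ x, σ' x = k * σ x * k⁻¹) :
    peripheral σ' (fun v => k * F v) = peripheral σ F :=
  funext fun _ => (inv_mul_mul_eq_iff.2 (hk _)).symm

theorem gluing_conj_frame {k : G} (hk : ∀ x, σ' x = k * σ x * k⁻¹) :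
    gluing σ' (fun v => k * F v) = gluing σ F :=
  funext fun _ => (inv_mul_mul_eq_iff.2 (hk _)).symm

theorem exists_frame_eq_mul (hglue : gluing σ F = gluing σ' F') : ∃ k, ∀ v, F' v = k * F v := by
  have hconst (v w : Fin (2 * g - 2)) : F' v * (F v)⁻¹ = F' w * (F w)⁻¹ := by
    induction P.connected v w with
    | rel v w hvw =>
      obtain ⟨j, hj, rfl, rfl⟩ := hvw
      have h := congrFun hglue j
      rw [gluing, gluing, P.crossing_eq_one hj, map_one, map_one, mul_one, mul_one] at h
      calc F' (P.sides (j, false)).1 * (F (P.sides (j, false)).1)⁻¹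
          = F' (P.sides (j, false)).1 * ((F (P.sides (j, false)).1)⁻¹ *
              F (P.sides (j, true)).1) * (F (P.sides (j, true)).1)⁻¹ := by group
        _ = F' (P.sides (j, true)).1 * (F (P.sides (j, true)).1)⁻¹ := by
          rw [h]
          group
    | refl v => rfl
    | symm v w _ ih => exact ih.symm
    | trans u v w _ _ ih ih' => exact ih.trans ih'
  have hpos : 0 < 2 * g - 2 := P.card_tree ▸ Nat.succ_pos _
  exact ⟨F' ⟨0, hpos⟩ * (F ⟨0, hpos⟩)⁻¹, fun v => by rw [hconst _ v, inv_mul_cancel_right]⟩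

theorem exists_conj_of_peripheral_eq (hper : peripheral σ F = peripheral σ' F')
    (hglue : gluing σ F = gluing σ' F') : ∃ k : G, ∀ x, σ' x = k * σ x * k⁻¹ := by
  obtain ⟨k, hk⟩ := exists_frame_eq_mul hglue
  obtain rfl : F' = fun v => k * F v := funext hk
  suffices h : σ' = (MulAut.conj k).toMonoidHom.comp σ from ⟨k, DFunLike.congr_fun h⟩
  refine PresentedGroup.ext ?_
  rintro (x | j)
  · exact inv_mul_mul_eq_iff.1 (congrFun hper x)
  · exact inv_mul_mul_eq_iff.1 (congrFun hglue j)

end GraphOfGroups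

section Coordinates

variable {g : ℕ} {P : CurveSystem g} {φ : P.Grp ≃* SurfaceGroup g} {ref : Sp11 → Sp11 → Sp11}
  {ρ ρ' : SurfaceGroup g →* Sp11} {c : FNCoord g}

theorem isFNCoord_iff {σ : P.Grp →* Sp11} (hσ : σ = ρ.comp φ.toMonoidHom) :
    IsFNCoord ref P φ ρ c ↔ ∃ F,
      (∀ v, IsPairCoord (peripheral σ F (v, 0)) (peripheral σ F (v, 1)) (c.pants v)) ∧
      ∀ j, IsTwistBend (peripheral σ F (P.sides (j, false)))
        (gluing σ F j * (ref (peripheral σ F (P.sides (j, false)))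
          (peripheral σ F (P.sides (j, true))))⁻¹) (c.twist j) := by
  subst hσ
  rfl

theorem exists_isPairCoord {A B : Sp11} (hA : IsLoxodromic A) (hB : IsLoxodromic B)
    (h : IsNormalized A B) : ∃ c, IsPairCoord A B c := by
  obtain ⟨k, hk⟩ := hA.exists_isProjectivePoint
  obtain ⟨k', hk'⟩ := hB.exists_isProjectivePoint
  obtain ⟨y, -, -, -, h₁, h₂, h₃, h₄⟩ := id h
  exact ⟨⟨realTrace A, realTrace B, _, _, k, k'⟩, h, rfl, rfl,
    ⟨_, ⟨_, _, _, _, h₁, h₂, h₃, h₄, rfl⟩, rfl, rfl⟩, hk, hk'⟩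

theorem IsReference.mul_inv_commute (href : IsReference ref) {S X Y : Sp11}
    (h : S * Y * S⁻¹ = X⁻¹) : Commute (S * (ref X Y)⁻¹) X := by
  have hr := href X Y (isConj_iff.2 ⟨S, h⟩)
  refine Commute.inv_right_iff.1 ?_
  calc S * (ref X Y)⁻¹ * X⁻¹ = S * Y * (ref X Y)⁻¹ := by
        rw [← hr]
        group
    _ = X⁻¹ * (S * (ref X Y)⁻¹) := by
        rw [← h]
        group

theorem IsNondegenerate.exists_isFNCoord (href : IsReference ref)
    (hρ : IsNondegenerate (ρ.comp φ.toMonoidHom)) : ∃ c, IsFNCoord ref P φ ρ c := by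
  choose F hF using fun v =>
    (hρ.2 v).exists_isNormalized (hρ.isLoxodromic (v, 0)).1 (hρ.isLoxodromic (v, 1)).1
  have hlox (x) : IsLoxodromic (peripheral _ F x) := (hρ.isLoxodromic x).inv_conj (F x.1)
  choose pants hpants using fun v => exists_isPairCoord (hlox (v, 0)) (hlox (v, 1)) (hF v)
  choose twist htwist using fun j =>
    (hlox (P.sides (j, false))).exists_isTwistBend (href.mul_inv_commute (gluing_conj _ F j))
  exact ⟨⟨pants, twist⟩, F, hpants, htwist⟩

theorem IsFNCoord.conj (h : IsFNCoord ref P φ ρ c) {k : Sp11} (hk : ∀ x, ρ' x = k * ρ x * k⁻¹) :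
    IsFNCoord ref P φ ρ' c := by
  obtain ⟨F, h₁, h₂⟩ := (isFNCoord_iff rfl).1 h
  refine (isFNCoord_iff rfl).2 ⟨fun v => k * F v, ?_⟩
  have hk' (x) : ρ'.comp φ.toMonoidHom x = k * ρ.comp φ.toMonoidHom x * k⁻¹ := hk (φ x)
  rw [peripheral_conj hk', gluing_conj_frame hk']
  exact ⟨h₁, h₂⟩

theorem isFNCoord_iff_of_repClass_eq (h : repClass ρ = repClass ρ') :
    IsFNCoord ref P φ ρ c ↔ IsFNCoord ref P φ ρ' c := by
  obtain ⟨k, hk⟩ := repClass_eq_iff.1 h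
  obtain ⟨k', hk'⟩ := repClass_eq_iff.1 h.symm
  exact ⟨fun hc => hc.conj hk, fun hc => hc.conj hk'⟩

theorem IsFNCoord.repClass_eq (hρ : IsNondegenerate (ρ.comp φ.toMonoidHom))
    (h : IsFNCoord ref P φ ρ c) (h' : IsFNCoord ref P φ ρ' c) : repClass ρ = repClass ρ' := by
  obtain ⟨F, h₁, h₂⟩ := (isFNCoord_iff rfl).1 h
  obtain ⟨F', h₁', h₂'⟩ := (isFNCoord_iff rfl).1 h'
  have hper : peripheral (ρ.comp φ.toMonoidHom) F = peripheral (ρ'.comp φ.toMonoidHom) F' := by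
    ext1 ⟨v, i⟩
    obtain ⟨h0, h1⟩ := (h₁ v).unique (h₁' v)
    fin_cases i
    · exact h0
    · exact h1
    · exact (peripheral_two _ F v).trans
        ((congrArg₂ (fun a b => (a * b)⁻¹) h0 h1).trans (peripheral_two _ F' v).symm)
  have hglue : gluing (ρ.comp φ.toMonoidHom) F = gluing (ρ'.comp φ.toMonoidHom) F' := by
    ext1 j
    have hK' := h₂' j
    rw [← hper] at hK'
    exact mul_right_cancel ((h₂ j).unique ((hρ.isLoxodromic _).inv_conj _).1 hK')
  obtain ⟨k, hk⟩ := exists_conj_of_peripheral_eq hper hglue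
  exact repClass_eq_iff.2 ⟨k, fun x => by simpa using hk (φ.symm x)⟩

end Coordinates

end SpOneOne

theorem mainTheorem10_general (g : ℕ) (hg : 2 ≤ g) (P : CurveSystem g)
    (φ : P.Grp ≃* SurfaceGroup g) (ref : Sp11 → Sp11 → Sp11) (href : IsReference ref) :
    (∀ ρ : SurfaceGroup g →* Sp11, IsNondegenerate (ρ.comp φ.toMonoidHom) →
      ∃ c, IsFNCoord ref P φ ρ c) ∧
    (∀ ρ ρ' : SurfaceGroup g →* Sp11,
      (IsNondegenerate (ρ.comp φ.toMonoidHom) →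
        ((∃ c, IsFNCoord ref P φ ρ c ∧ IsFNCoord ref P φ ρ' c) ↔ repClass ρ = repClass ρ')) ∧
      (repClass ρ = repClass ρ' → ∀ c, IsFNCoord ref P φ ρ c ↔ IsFNCoord ref P φ ρ' c)) ∧
    (∀ (ρ : SurfaceGroup g →* Sp11) (x y : SurfaceGroup g), IsIrreduciblePair (ρ x) (ρ y) →
      IsHyperbolic (ρ x) →
      ∃ e : OpenPartialHomeomorph (DeformationSpace (SurfaceGroup g))
          (EuclideanSpace ℝ (Fin (20 * g - 20))),
        repClass ρ ∈ e.source) := by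
  refine ⟨fun ρ hρ => hρ.exists_isFNCoord href, fun ρ ρ' => ⟨fun hρ => ⟨?_, fun h => ?_⟩, ?_⟩,
    fun ρ x y hirr hhyp => exists_chart_deformationSpace (by omega) hirr hhyp⟩
  · rintro ⟨c, hc, hc'⟩
    exact hc.repClass_eq hρ hc'
  · obtain ⟨c, hc⟩ := hρ.exists_isFNCoord href
    exact ⟨c, hc, (isFNCoord_iff_of_repClass_eq h).1 hc⟩
  · exact fun h c => isFNCoord_iff_of_repClass_eq h

theorem mainTheorem10 (g : ℕ) (hg : 2 ≤ g) (P : CurveSystem g) (φ : P.Grp ≃* SurfaceGroup g)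
    (ref : Sp11 → Sp11 → Sp11) (href : IsReference ref) :
    (∀ ρ : SurfaceGroup g →* Sp11, IsGeometric P φ ρ → ∃ c, IsFNCoord ref P φ ρ c) ∧
    (∀ ρ ρ' : SurfaceGroup g →* Sp11, IsGeometric P φ ρ → IsGeometric P φ ρ' →
      ((∃ c, IsFNCoord ref P φ ρ c ∧ IsFNCoord ref P φ ρ' c) ↔ repClass ρ = repClass ρ') ∧
      (repClass ρ = repClass ρ' → ∀ c, IsFNCoord ref P φ ρ c ↔ IsFNCoord ref P φ ρ' c)) ∧
    (∀ ρ : SurfaceGroup g →* Sp11, IsGeometric P φ ρ →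
      ∃ e : OpenPartialHomeomorph (DeformationSpace (SurfaceGroup g))
          (EuclideanSpace ℝ (Fin (20 * g - 20))),
        repClass ρ ∈ e.source) := by
  obtain ⟨hex, hconj, hchart⟩ := mainTheorem10_general g hg P φ ref href
  exact ⟨fun ρ hρ => hex ρ hρ.2.2, fun ρ ρ' hρ _ => ⟨(hconj ρ ρ').1 hρ.2.2, (hconj ρ ρ').2⟩,
    fun ρ hρ => hchart ρ _ _ (hρ.2.2.2 ⟨0, by omega⟩)
      (IsNondegenerate.isLoxodromic (σ := ρ.comp φ.toMonoidHom) hρ.2.2 _).1⟩
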